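/- Let $M=\begin{pmatrix}a&b\\c&d\end{pmatrix}\in GL(2,\mathbb Z)$ have no eigenvalue of modulus one, let $T$ be the hyperbolic automorphism $x\mapsto Mx$ of $\mathbb T^2=\mathbb R^2/\mathbb Z^2$, and put $r=\operatorname{Tr}M$, $\sigma=\det M=\pm1$, $C_{r,\sigma}=\begin{pmatrix}r&1\\-\sigma&0\end{pmatrix}$ and $f_T(x,y)=bx^2-(a-d)xy-cy^2$. Definition (for $r>0$). Let $\lambda=\frac12\bigl(r+\sqrt{r^2-4\sigma}\bigr)>1$. Let $\widetilde{\mathfrak X}$ be the additive semigroup of two-sided sequences $(\varepsilon_n)_{n\in\mathbb Z}$ of nonnegative integers for which $\sum_{n\ge1}\varepsilon_n\lambda^{-n}$ and $\sum_{n\ge1}\varepsilon_{-n}\lambda^{-n}$ converge, with the coarsest topology in which all coordinates and both sums are continuous, and with the shift $(\tau\varepsilon)_n=\varepsilon_{n+1}$. An arithmetic coding of $T$ is a pair $(\varphi,\mathfrak X)$, where $\varphi:\widetilde{\mathfrak X}\to\mathbb T^2$ is a continuous semigroup homomorphism (with $\varphi(0)=0$) such that $\varphi\tau=T\varphi$,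 and $\mathfrak X\subset\widetilde{\mathfrak X}$ is a closed set with $\tau^{-1}\mathfrak X=\mathfrak X$ such that: $\varphi(\mathfrak X)=\mathbb T^2$; $\varphi$ is one-to-one on the sequences in $\mathfrak X$ with finitely many nonzero terms; and $\mathfrak X$ is total, i.e. if $\varepsilon\in\mathfrak X$, $N\in\mathbb Z$ and $\varepsilon'\in\widetilde{\mathfrak X}$ are such that $(\varepsilon'_k,\varepsilon'_{k+1},\dots)$ is lexicographically (strictly) less than $(\varepsilon_N,\varepsilon_{N+1},\dots)$ for every $k\in\mathbb Z$, then $\varepsilon'\in\mathfrak X$. It is bijective (a.e.) if Lebesgue-almost every point of $\mathbb T^2$ has exactly one preimage under $\varphi$ in $\mathfrak X$. Theorem. I. If $r>0$, then $T$ admits a bijective arithmetic coding if and only if there is $B\in GL(2,\mathbb Z)$ with $BMB^{-1}=C_{r,\sigma}$. If $r<0$, the same holds with the automorphism $-T$ (given by $-M$, of positive trace) in place of $T$ on the left-hand side: $-T$ admits a bijective arithmetic coding if and only if $M$ is conjugate in $GL(2,\mathbb Z)$ to $C_{r,\sigma}$. II. (For either sign of $r$.) $M$ is conjugate in $GL(2,\mathbb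 Z)$ to $C_{r,\sigma}$ if and only if $f_T(x,y)=1$ or $f_T(x,y)=-1$ has a solution $(x,y)\in\mathbb Z^2$. Moreover $B=\begin{pmatrix}x&y\\z&t\end{pmatrix}\mapsto(x,y)$ is a bijection from the set of all $B\in GL(2,\mathbb Z)$ with $BMB^{-1}=C_{r,\sigma}$ onto the set of all $(x,y)\in\mathbb Z^2$ with $f_T(x,y)=\pm1$, and for every such $B$ one has $(z,t)=-\det M\cdot(x,y)M^{-1}$. -/

import Mathlib

open MeasureTheory
open scoped MatrixGroups

noncomputable section

namespace ToralCoding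

/-- The 2-torus `(ℝ/ℤ)²`; its `volume` is the normalized Lebesgue (Haar) measure. -/
abbrev Torus : Type := UnitAddTorus (Fin 2)

/-- The endomorphism `x ↦ M x` of the torus given by an integer matrix (column convention). -/
def toralMap (M : Matrix (Fin 2) (Fin 2) ℤ) : Torus →+ Torus where
  toFun x := fun i => ∑ j, M i j • x j
  map_zero' := by
    funext i
    simp
  map_add' x y := by
    funext i
    simp [smul_add, Finset.sum_add_distrib]

/-- `M` has no (complex) eigenvalue of modulus one. -/
def IsHyperbolic (M : Matrix (Fin 2) (Fin 2) ℤ) : Prop :=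
  ∀ z ∈ spectrum ℂ (M.map (Int.cast : ℤ → ℂ)), ‖z‖ ≠ 1

/-- `λ = (r + √D) / 2` with `r = Tr M`, `D = r² - 4 det M`: for positive trace this is the
eigenvalue of `M` of largest modulus. -/
def leadingEigenvalue (M : Matrix (Fin 2) (Fin 2) ℤ) : ℝ :=
  ((M.trace : ℝ) + Real.sqrt ((M.trace : ℝ) ^ 2 - 4 * (M.det : ℝ))) / 2

/-- The semigroup (under coordinate-wise addition) of two-sided sequences of nonnegative
integers for which `∑_{n ≥ 1} ε_n β⁻ⁿ` and `∑_{n ≥ 1} ε_{-n} β⁻ⁿ` converge. -/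
def digitSemigroup (β : ℝ) : AddSubmonoid (ℤ → ℕ) where
  carrier := {ε | Summable (fun n : ℕ => (ε ((n : ℤ) + 1) : ℝ) * (β ^ (n + 1))⁻¹) ∧
    Summable (fun n : ℕ => (ε (-((n : ℤ) + 1)) : ℝ) * (β ^ (n + 1))⁻¹)}
  zero_mem' := by
    constructor <;> simp [summable_zero]
  add_mem' := by
    rintro a b ⟨ha, ha'⟩ ⟨hb, hb'⟩
    exact ⟨by simpa [add_mul] using ha.add hb, by simpa [add_mul] using ha'.add hb'⟩

/-- The primary symbolic space. It is a type of its own because its topology is not the one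
induced by the product. -/
def SymbolicSpace (β : ℝ) : Type := digitSemigroup β

namespace SymbolicSpace

variable {β : ℝ}

instance : AddCommMonoid (SymbolicSpace β) :=
  inferInstanceAs (AddCommMonoid (digitSemigroup β))

/-- The `n`-th digit. -/
def digit (ε : SymbolicSpace β) (n : ℤ) : ℕ := ε.1 n

/-- `∑_{n ≥ 1} ε_n β⁻ⁿ`. -/
def rightSum (ε : SymbolicSpace β) : ℝ :=
  ∑' n : ℕ, (ε.digit ((n : ℤ) + 1) : ℝ) * (β ^ (n + 1))⁻¹

/-- `∑_{n ≥ 1} ε_{-n} β⁻ⁿ`. -/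
def leftSum (ε : SymbolicSpace β) : ℝ :=
  ∑' n : ℕ, (ε.digit (-((n : ℤ) + 1)) : ℝ) * (β ^ (n + 1))⁻¹

/-- The natural weak topology: the coarsest one for which all the digits and the two series
that define the space depend continuously on the sequence. On a set of sequences with uniformly
bounded digits (when `β > 1`) this is the product topology. -/
instance : TopologicalSpace (SymbolicSpace β) :=
  TopologicalSpace.induced
    (fun ε : SymbolicSpace β => (ε.digit, ε.rightSum, ε.leftSum)) inferInstance

/-- The two-sided shift `(τ ε)_n = ε_{n+1}`. -/
def shift (ε : SymbolicSpace β) : SymbolicSpace β :=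
  ⟨fun n => ε.1 (n + 1), by
    obtain ⟨e, h1, h2⟩ := ε
    by_cases hβ : β = 0
    · subst hβ
      constructor <;> simp [summable_zero]
    constructor
    · have h := ((summable_nat_add_iff 1).2 h1).mul_left β
      refine h.congr fun n => ?_
      have e1 : (((n + 1 : ℕ) : ℤ) + 1) = (n : ℤ) + 1 + 1 := by push_cast; ring
      simp only [e1]
      field_simp
      ring
    · refine (summable_nat_add_iff 1).1 ?_
      refine (h2.mul_left β⁻¹).congr fun n => ?_
      have e1 : (-(((n + 1 : ℕ) : ℤ) + 1) + 1) = -((n : ℤ) + 1) := by push_cast; ring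
      simp only [e1]
      field_simp
      ring⟩

/-- A sequence is finite if it has only finitely many nonzero digits. -/
def IsFinite (ε : SymbolicSpace β) : Prop := {n : ℤ | ε.digit n ≠ 0}.Finite

/-- `(ε'_k, ε'_{k+1}, …)` is lexicographically less than `(ε_N, ε_{N+1}, …)`. -/
def TailLexLT (ε' : SymbolicSpace β) (k : ℤ) (ε : SymbolicSpace β) (N : ℤ) : Prop :=
  ∃ j : ℕ, (∀ i : ℕ, i < j → ε'.digit (k + i) = ε.digit (N + i)) ∧
    ε'.digit (k + j) < ε.digit (N + j)

/-- A set of sequences is total if with every `ε` it contains every `ε'` all of whose tails are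
lexicographically less than some fixed tail of `ε`. -/
def IsTotal (X : Set (SymbolicSpace β)) : Prop :=
  ∀ ε ∈ X, ∀ ε' : SymbolicSpace β,
    (∃ N : ℤ, ∀ k : ℤ, TailLexLT ε' k ε N) → ε' ∈ X

end SymbolicSpace

/-- `(φ, X)` is an arithmetic coding of the toral automorphism with matrix `M` (of positive
trace): `φ` is a continuous semigroup homomorphism to the torus that turns the shift into the
automorphism, and `X` is a closed, shift-invariant, total set of sequences, mapped onto the torus,
on whose finite sequences `φ` is one-to-one. -/
structure IsArithmeticCoding (M : Matrix (Fin 2) (Fin 2) ℤ)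
    (φ : SymbolicSpace (leadingEigenvalue M) →+ Torus)
    (X : Set (SymbolicSpace (leadingEigenvalue M))) : Prop where
  continuous : Continuous φ
  map_shift : ∀ ε, φ ε.shift = toralMap M (φ ε)
  isClosed : IsClosed X
  shift_invariant : ∀ ε : SymbolicSpace (leadingEigenvalue M), ε.shift ∈ X ↔ ε ∈ X
  total : SymbolicSpace.IsTotal X
  surjective : ∀ x : Torus, ∃ ε ∈ X, φ ε = x
  injective_on_finite : Set.InjOn φ {ε | ε ∈ X ∧ ε.IsFinite}

/-- There is an arithmetic coding `(φ, X)` with `φ : X → 𝕋²` bijective almost everywhere: almost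
every point of the torus (for Lebesgue measure) has exactly one preimage in `X`. -/
def AdmitsBijectiveArithmeticCoding (M : Matrix (Fin 2) (Fin 2) ℤ) : Prop :=
  ∃ (φ : SymbolicSpace (leadingEigenvalue M) →+ Torus)
    (X : Set (SymbolicSpace (leadingEigenvalue M))),
    IsArithmeticCoding M φ X ∧
      ∀ᵐ x ∂(volume : Measure Torus), ∃! ε, ε ∈ X ∧ φ ε = x

/-- `B` conjugates `M₁` into `M₂`: `B M₁ B⁻¹ = M₂`. -/
def Conjugates (B : GL (Fin 2) ℤ) (M₁ M₂ : Matrix (Fin 2) (Fin 2) ℤ) : Prop :=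
  (B : Matrix (Fin 2) (Fin 2) ℤ) * M₁ * ((B⁻¹ : GL (Fin 2) ℤ) : Matrix (Fin 2) (Fin 2) ℤ) = M₂

/-- Algebraic conjugacy, i.e. conjugacy by an element of `GL(2, ℤ)`. -/
def AlgebraicallyConjugate (M₁ M₂ : Matrix (Fin 2) (Fin 2) ℤ) : Prop :=
  ∃ B : GL (Fin 2) ℤ, Conjugates B M₁ M₂

/-- The companion matrix `C_{r,σ}`. -/
def companionMatrix (r σ : ℤ) : Matrix (Fin 2) (Fin 2) ℤ := !![r, 1; -σ, 0]

/-- The quadratic form `b x² - (a - d) x y - c y²` associated with `M = (a b; c d)`. -/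
def associatedForm (M : Matrix (Fin 2) (Fin 2) ℤ) (x y : ℤ) : ℤ :=
  M 0 1 * x ^ 2 - (M 0 0 - M 1 1) * x * y - M 1 0 * y ^ 2

end ToralCoding

end

open ToralCoding

noncomputable section

namespace ToralCoding

open Filter Topology

/-! The conjugacy statements are linear algebra. The equation `B M = C B` expresses the second row
of `B` linearly through the first, and `det B` then becomes the quadratic form evaluated at the
first row. Integer conjugating matrices are thus the same thing as solutions of `f = ±1`.

For codings, let `N` be `M` or `-M`, whichever has positive trace, with eigenvalues `β > 1` and `μ`,
where `β μ = ±1`. A continuous equivariant homomorphism is determined by its values on the sequences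
with a single digit one. These values form an orbit homoclinic to zero, and such orbits come from
integer vectors `l` (`exists_homoclinic`, `exists_eq_codingHom`). The homomorphism attached to `l`
takes a sequence to the pair (future, past) in the plane, on which the shift acts as multiplication
by `(β, μ)` modulo the lattice `ℤ[β]` embedded by its two real embeddings. It then applies a linear
map carrying `ℤ[β]` onto `ℤ l + ℤ N l`, and projects to the torus. For `l ≠ 0` the index of `ℤ l + ℤ
N l` in `ℤ²` is `|det (l, N l)|`, and `det (l, N l)` is up to sign a value of the quadratic form. So
the claim becomes: a bijective coding exists exactly when some `l` has index one.

The central set of sequences consists of those satisfying Parry's condition: no tail exceeds the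
quasi-greedy expansion `q` of one in base `β`. Their pairs (future, past) meet every class modulo
`ℤ[β]` (`isRepresented`), and lie in two rectangles of total area `β - μ`, the covolume of `ℤ[β]`
(`exists_rectangles`).

Index one suffices: the rectangles give a compact set of area at most one that covers the torus, so
almost every point has a single lift in it (`ae_unique_lift`). Using this along a whole orbit
recovers all digits (`ae_existsUnique`).

Index one is necessary: totality, closedness and surjectivity force `X` to contain every Parry
sequence (`parry_subset`). Otherwise the tails in `X` stay uniformly below `q`, and Baire's theorem
contradicts surjectivity. If the index exceeds one, two classes modulo `ℤ[β]` project to the same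
torus point, and each contains a Parry sequence, so no point has a unique preimage
(`exists_isUnit_cyclicDet`). -/

/-! ### Conjugation to the companion matrix and the quadratic form -/

theorem conjugates_iff {B : GL (Fin 2) ℤ} {M₁ M₂ : Matrix (Fin 2) (Fin 2) ℤ} :
    Conjugates B M₁ M₂ ↔ (B : Matrix (Fin 2) (Fin 2) ℤ) * M₁ = M₂ * B := by
  unfold Conjugates
  constructor
  · rintro rfl
    rw [Matrix.mul_assoc _ _ (B : Matrix (Fin 2) (Fin 2) ℤ), ← Units.val_mul, inv_mul_cancel,
      Units.val_one, Matrix.mul_one]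
  · intro h
    rw [h, Matrix.mul_assoc, ← Units.val_mul, mul_inv_cancel, Units.val_one, Matrix.mul_one]

/-- Conjugation to the companion matrix, written out for the rows of the conjugating matrix. -/
theorem mul_eq_companionMatrix_mul_iff {B M : Matrix (Fin 2) (Fin 2) ℤ} :
    B * M = companionMatrix M.trace M.det * B ↔
      B 1 0 = -B 0 0 * M 1 1 + B 0 1 * M 1 0 ∧ B 1 1 = B 0 0 * M 0 1 - B 0 1 * M 0 0 := by
  have key : B * M = companionMatrix M.trace M.det * B ↔
      ∀ i j, (B * M) i j = (companionMatrix M.trace M.det * B) i j :=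
    ⟨fun h i j => by rw [h], fun h => Matrix.ext h⟩
  rw [key]
  simp only [Fin.forall_fin_two, Matrix.mul_apply, Fin.sum_univ_two, companionMatrix,
    Matrix.trace_fin_two, Matrix.det_fin_two, Matrix.of_apply, Matrix.cons_val', Matrix.cons_val_zero,
    Matrix.cons_val_one, Matrix.cons_val_fin_one]
  constructor
  · rintro ⟨⟨h1, h2⟩, -⟩
    constructor <;> linarith
  · rintro ⟨h1, h2⟩
    rw [h1, h2]
    refine ⟨⟨by ring, by ring⟩, by ring, by ring⟩

/-- The origin of the quadratic form: with the second row linear in the first, the determinant is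
quadratic in the first row. -/
theorem det_eq_associatedForm {B M : Matrix (Fin 2) (Fin 2) ℤ}
    (h1 : B 1 0 = -B 0 0 * M 1 1 + B 0 1 * M 1 0) (h2 : B 1 1 = B 0 0 * M 0 1 - B 0 1 * M 0 0) :
    B.det = associatedForm M (B 0 0) (B 0 1) := by
  rw [Matrix.det_fin_two, h1, h2, associatedForm]
  ring

theorem bijOn_conjugates (M : Matrix (Fin 2) (Fin 2) ℤ) :
    Set.BijOn
      (fun B : GL (Fin 2) ℤ =>
        ((B : Matrix (Fin 2) (Fin 2) ℤ) 0 0, (B : Matrix (Fin 2) (Fin 2) ℤ) 0 1))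
      {B | Conjugates B M (companionMatrix M.trace M.det)}
      {p | associatedForm M p.1 p.2 = 1 ∨ associatedForm M p.1 p.2 = -1} := by
  refine ⟨?_, ?_, ?_⟩
  · intro B hB
    obtain ⟨h1, h2⟩ := mul_eq_companionMatrix_mul_iff.1 (conjugates_iff.1 hB)
    have hd := det_eq_associatedForm h1 h2
    have hu : IsUnit (B : Matrix (Fin 2) (Fin 2) ℤ).det :=
      (Matrix.isUnit_iff_isUnit_det _).1 B.isUnit
    simp only [Set.mem_ofPred_eq]
    rw [← hd]
    exact Int.isUnit_iff.1 hu
  · intro B hB B' hB' h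
    obtain ⟨h1, h2⟩ := mul_eq_companionMatrix_mul_iff.1 (conjugates_iff.1 hB)
    obtain ⟨h1', h2'⟩ := mul_eq_companionMatrix_mul_iff.1 (conjugates_iff.1 hB')
    obtain ⟨e1, e2⟩ := Prod.mk.inj h
    refine Units.ext (Matrix.ext ?_)
    simp only [Fin.forall_fin_two]
    refine ⟨⟨e1, e2⟩, ?_, ?_⟩
    · rw [h1, h1', e1, e2]
    · rw [h2, h2', e1, e2]
  · rintro ⟨x, y⟩ h
    let B : Matrix (Fin 2) (Fin 2) ℤ := !![x, y; -x * M 1 1 + y * M 1 0, x * M 0 1 - y * M 0 0]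
    have hd : B.det = associatedForm M x y := det_eq_associatedForm (B := B) rfl rfl
    have hu : IsUnit B := by
      rw [Matrix.isUnit_iff_isUnit_det, hd]
      exact Int.isUnit_iff.2 h
    obtain ⟨U, hU⟩ := hu
    refine ⟨U, conjugates_iff.2 ?_, by simp [hU, B]⟩
    rw [hU]
    exact mul_eq_companionMatrix_mul_iff.2 ⟨rfl, rfl⟩

theorem algebraicallyConjugate_companionMatrix_iff (M : Matrix (Fin 2) (Fin 2) ℤ) :
    AlgebraicallyConjugate M (companionMatrix M.trace M.det) ↔
      ∃ x y : ℤ, associatedForm M x y = 1 ∨ associatedForm M x y = -1 := by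
  constructor
  · rintro ⟨B, hB⟩
    exact ⟨_, _, (bijOn_conjugates M).mapsTo hB⟩
  · rintro ⟨x, y, h⟩
    obtain ⟨B, hB, -⟩ := (bijOn_conjugates M).surjOn (show (x, y) ∈ _ from h)
    exact ⟨B, hB⟩

theorem det_smul_inv (M : GL (Fin 2) ℤ) :
    (M : Matrix (Fin 2) (Fin 2) ℤ).det • ((M⁻¹ : GL (Fin 2) ℤ) : Matrix (Fin 2) (Fin 2) ℤ) =
      (M : Matrix (Fin 2) (Fin 2) ℤ).adjugate := by
  have h := congrArg (· * ((M⁻¹ : GL (Fin 2) ℤ) : Matrix (Fin 2) (Fin 2) ℤ))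
    (Matrix.adjugate_mul (M : Matrix (Fin 2) (Fin 2) ℤ))
  simp only [Matrix.mul_assoc, ← Units.val_mul, mul_inv_cancel] at h
  simpa using h.symm

theorem second_row_of_conjugates (M B : GL (Fin 2) ℤ)
    (h : Conjugates B (M : Matrix (Fin 2) (Fin 2) ℤ)
      (companionMatrix (M : Matrix (Fin 2) (Fin 2) ℤ).trace (M : Matrix (Fin 2) (Fin 2) ℤ).det)) :
    (B : Matrix (Fin 2) (Fin 2) ℤ) 1 =
      (-(M : Matrix (Fin 2) (Fin 2) ℤ).det) • Matrix.vecMul ((B : Matrix (Fin 2) (Fin 2) ℤ) 0)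
        ((M⁻¹ : GL (Fin 2) ℤ) : Matrix (Fin 2) (Fin 2) ℤ) := by
  obtain ⟨h1, h2⟩ := mul_eq_companionMatrix_mul_iff.1 (conjugates_iff.1 h)
  -- Multiplying the inverse by the determinant gives the adjugate, whose entries are those of `M`
  -- up to order and sign.
  rw [neg_smul, ← Matrix.vecMul_smul, det_smul_inv, Matrix.adjugate_fin_two]
  funext j
  fin_cases j
  · simp [Matrix.vecHead, Matrix.vecTail, h1]
    ring
  · simp [Matrix.vecHead, Matrix.vecTail, h2]
    ring

/-! ### Lexicographic order and values of digit sequences in base `β` -/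

/-- Strict lexicographic order on one-sided sequences. -/
def LexLT (a b : ℕ → ℕ) : Prop := ∃ j : ℕ, (∀ i < j, a i = b i) ∧ a j < b j

theorem lexLT_trichotomy (a b : ℕ → ℕ) : LexLT a b ∨ a = b ∨ LexLT b a := by
  by_cases h : a = b
  · exact Or.inr (Or.inl h)
  obtain ⟨i, hi⟩ := Function.ne_iff.1 h
  classical
  have hex : ∃ j, a j ≠ b j := ⟨i, hi⟩
  have hlt : ∀ i < Nat.find hex, a i = b i := fun i hi => not_not.1 (Nat.find_min hex hi)
  rcases lt_or_gt_of_ne (Nat.find_spec hex) with h1 | h1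
  · exact Or.inl ⟨_, hlt, h1⟩
  · exact Or.inr (Or.inr ⟨_, fun i hi => (hlt i hi).symm, h1⟩)

theorem LexLT.trans {a b c : ℕ → ℕ} (h1 : LexLT a b) (h2 : LexLT b c) : LexLT a c := by
  obtain ⟨j, hj, hj'⟩ := h1
  obtain ⟨k, hk, hk'⟩ := h2
  rcases lt_trichotomy j k with h | rfl | h
  · exact ⟨j, fun i hi => (hj i hi).trans (hk i (hi.trans h)), hk j h ▸ hj'⟩
  · exact ⟨j, fun i hi => (hj i hi).trans (hk i hi), hj'.trans hk'⟩
  · exact ⟨k, fun i hi => (hj i (hi.trans h)).trans (hk i hi), (hj k h).symm ▸ hk'⟩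

theorem LexLT.irrefl (a : ℕ → ℕ) : ¬ LexLT a a := fun ⟨_, _, h⟩ => lt_irrefl _ h

/-- The value `∑_{k ≥ 0} a_k β^{-(k+1)}` of a one-sided sequence of digits. -/
def val (β : ℝ) (a : ℕ → ℕ) : ℝ := ∑' k : ℕ, (a k : ℝ) * (β ^ (k + 1))⁻¹

theorem hasSum_geometric_inv {β : ℝ} (hβ : 1 < β) :
    HasSum (fun k : ℕ => (β ^ (k + 1))⁻¹) (β - 1)⁻¹ := by
  have h := (hasSum_geometric_of_lt_one (r := β⁻¹) (by positivity) (inv_lt_one_of_one_lt₀ hβ)).mul_left β⁻¹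
  have e : β⁻¹ * (1 - β⁻¹)⁻¹ = (β - 1)⁻¹ := by
    rw [← mul_inv]
    congr 1
    field_simp
  rw [e] at h
  refine h.congr_fun ?_
  intro k
  rw [pow_succ, mul_inv, inv_pow, mul_comm]

theorem summable_val {β : ℝ} (hβ : 1 < β) {a : ℕ → ℕ} {R : ℕ} (hR : ∀ k, a k ≤ R) :
    Summable fun k : ℕ => (a k : ℝ) * (β ^ (k + 1))⁻¹ := by
  have hp : ∀ k : ℕ, (0 : ℝ) ≤ (β ^ (k + 1))⁻¹ := fun k => by positivity
  refine Summable.of_nonneg_of_le (fun k => by have := hp k; positivity) (fun k => ?_)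
    ((hasSum_geometric_inv hβ).summable.mul_left (R : ℝ))
  exact mul_le_mul_of_nonneg_right (by exact_mod_cast hR k) (hp k)

theorem val_nonneg {β : ℝ} (hβ : 1 < β) (a : ℕ → ℕ) : 0 ≤ val β a :=
  tsum_nonneg fun k => by positivity

theorem val_le {β : ℝ} (hβ : 1 < β) {a : ℕ → ℕ} {R : ℕ} (hR : ∀ k, a k ≤ R) :
    val β a ≤ R * (β - 1)⁻¹ := by
  rw [← (hasSum_geometric_inv hβ).tsum_eq, ← tsum_mul_left]
  refine (summable_val hβ hR).tsum_le_tsum (fun k => ?_)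
    ((hasSum_geometric_inv hβ).summable.mul_left (R : ℝ))
  exact mul_le_mul_of_nonneg_right (by exact_mod_cast hR k) (by positivity)

theorem mul_val_of_summable {β : ℝ} (hβ : 1 < β) {a : ℕ → ℕ}
    (ha : Summable fun k : ℕ => (a k : ℝ) * (β ^ (k + 1))⁻¹) :
    β * val β a = a 0 + val β (fun i => a (1 + i)) := by
  have h0 : β ≠ 0 := by positivity
  rw [val, ha.tsum_eq_zero_add, mul_add, ← tsum_mul_left, val]
  congr 1
  · field_simp
    ring
  · refine tsum_congr fun k => ?_
    rw [add_comm 1 k]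
    field_simp
    ring

theorem mul_val {β : ℝ} (hβ : 1 < β) {a : ℕ → ℕ} {R : ℕ} (hR : ∀ k, a k ≤ R) (k : ℕ) :
    β * val β (fun i => a (k + i)) = a k + val β (fun i => a (k + 1 + i)) := by
  rw [mul_val_of_summable hβ (summable_val hβ fun i => hR (k + i))]
  simp only [add_zero, add_assoc]

@[simp] theorem val_zero (β : ℝ) : val β (fun _ => 0) = 0 := by simp [val]

theorem bdd_of_admissible {q a : ℕ → ℕ} (h : ∀ k, ¬ LexLT q (fun i => a (k + i))) (k : ℕ) :
    a k ≤ q 0 := by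
  by_contra h'
  exact h k ⟨0, by simp, by simpa using h'⟩

/-! ### The quasi-greedy expansion of one and Parry's condition -/

/-- `q` is the quasi-greedy expansion of one in base `β`, and `t n` is the value of its `n`-th
tail. -/
structure QuasiGreedy (β : ℝ) (q : ℕ → ℕ) (t : ℕ → ℝ) : Prop where
  one_lt : 1 < β
  zero : t 0 = 1
  exists_pos : ∃ c > 0, ∀ n, c ≤ t n
  le_one : ∀ n, t n ≤ 1
  succ : ∀ n, t (n + 1) = β * t n - q n

namespace QuasiGreedy

variable {β : ℝ} {q : ℕ → ℕ} {t : ℕ → ℝ} (H : QuasiGreedy β q t)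

include H

theorem pos (n : ℕ) : 0 < t n := by
  obtain ⟨c, hc, h⟩ := H.exists_pos
  exact hc.trans_le (h n)

theorem bdd (n : ℕ) : q n ≤ ⌈β⌉₊ := by
  have h1 := H.succ n
  have h2 := H.pos (n + 1)
  have h3 := H.le_one n
  have h4 := H.one_lt
  have : (q n : ℝ) ≤ β := by nlinarith
  exact_mod_cast this.trans (Nat.le_ceil β)

theorem one_le_zero : 1 ≤ q 0 := by
  by_contra h
  have h0 : q 0 = 0 := by omega
  have h1 := H.succ 0
  have h2 := H.le_one 1
  have h3 := H.one_lt
  rw [h0, H.zero] at h1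
  simp only [zero_add] at h1
  rw [h1] at h2
  norm_num at h2
  linarith

/-- Values and `t` obey the same recurrence as long as the digits agree, so each common digit
contracts the difference by `β⁻¹`. -/
theorem val_sub {a : ℕ → ℕ} {R : ℕ} (hR : ∀ k, a k ≤ R) (n j : ℕ)
    (h : ∀ i < j, a i = q (n + i)) :
    val β a - t n = (β ^ j)⁻¹ * (val β (fun i => a (j + i)) - t (n + j)) := by
  have hβ := H.one_lt
  induction j with
  | zero => simp
  | succ j ih =>
    rw [ih fun i hi => h i (hi.trans (Nat.lt_succ_self j))]
    have h1 := mul_val hβ hR j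
    have h2 := H.succ (n + j)
    have h3 := h j (Nat.lt_succ_self j)
    rw [← add_assoc n j 1, h2, ← h3]
    have e : val β (fun i => a (j + 1 + i)) = β * val β (fun i => a (j + i)) - a j := by
      linarith
    rw [e, pow_succ]
    have : β ≠ 0 := by positivity
    field_simp
    ring

/-- Peels off one more digit, typically the first differing one. The sign is then decided by the
integer `a j - q (n + j)`, once the remaining difference is known to be at most one in the relevant
direction. -/
theorem val_sub_of_ne {a : ℕ → ℕ} {R : ℕ} (hR : ∀ k, a k ≤ R) (n j : ℕ)
    (h : ∀ i < j, a i = q (n + i)) :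
    val β a - t n = (β ^ (j + 1))⁻¹ *
      ((a j : ℝ) - q (n + j) + (val β (fun i => a (j + 1 + i)) - t (n + j + 1))) := by
  have hβ := H.one_lt
  rw [H.val_sub hR n j h]
  have h1 := mul_val hβ hR j
  have h2 := H.succ (n + j)
  rw [h2]
  have e : val β (fun i => a (j + 1 + i)) = β * val β (fun i => a (j + i)) - a j := by
    linarith
  rw [e, pow_succ]
  have : β ≠ 0 := by positivity
  field_simp
  ring

/-- The difference is `β⁻ʲ` times a bounded quantity for every `j`: a bounded solution of the
recurrence is unique. -/
theorem val_tail (n : ℕ) : val β (fun i => q (n + i)) = t n := by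
  have hβ := H.one_lt
  have hb : ∀ k, (fun i => q (n + i)) k ≤ ⌈β⌉₊ := fun k => H.bdd _
  set C : ℝ := (⌈β⌉₊ : ℝ) * (β - 1)⁻¹ + 1
  have hC : ∀ j : ℕ, |val β (fun i => q (n + i)) - t n| ≤ (β⁻¹) ^ j * C := by
    intro j
    rw [H.val_sub hb n j fun i _ => rfl, abs_mul, abs_of_nonneg (by positivity), inv_pow]
    refine mul_le_mul_of_nonneg_left ?_ (by positivity)
    have h1 := val_nonneg hβ (fun i => q (n + (j + i)))
    have h2 := val_le hβ (a := fun i => q (n + (j + i))) fun k => H.bdd _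
    have h3 := H.pos (n + j)
    have h4 := H.le_one (n + j)
    have h5 : (0 : ℝ) ≤ (⌈β⌉₊ : ℝ) * (β - 1)⁻¹ := h1.trans h2
    rw [abs_le]
    constructor <;> simp only [C] <;> linarith
  have hlim : Tendsto (fun j : ℕ => (β⁻¹) ^ j * C) atTop (𝓝 0) := by
    simpa using (tendsto_pow_atTop_nhds_zero_of_lt_one (by positivity)
      (inv_lt_one_of_one_lt₀ hβ)).mul_const C
  have := ge_of_tendsto' hlim hC
  have h0 := abs_nonneg (val β (fun i => q (n + i)) - t n)
  exact sub_eq_zero.1 (abs_eq_zero.1 (le_antisymm this h0))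

/-- Parry's condition implies that the values of the tails are at most one. -/
theorem val_le_one {a : ℕ → ℕ} (h : ∀ k, ¬ LexLT q (fun i => a (k + i))) (k : ℕ) :
    val β (fun i => a (k + i)) ≤ 1 := by
  have hβ := H.one_lt
  have hb := bdd_of_admissible h
  -- Bootstrapping: an excess `E` over one valid for all tails improves to `β⁻¹ E`, because past the
  -- first difference with `q` a full unit is lost. Iteration starts from the crude geometric bound.
  have step : ∀ E : ℝ, 0 ≤ E → (∀ k, val β (fun i => a (k + i)) ≤ 1 + E) →
      ∀ k, val β (fun i => a (k + i)) ≤ 1 + β⁻¹ * E := by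
    intro E hE hk k
    have hE' : 0 ≤ β⁻¹ * E := by positivity
    rcases lexLT_trichotomy q (fun i => a (k + i)) with h1 | h1 | ⟨j, h1, h2⟩
    · exact absurd h1 (h k)
    · have := H.val_tail 0
      simp only [zero_add] at this
      rw [← h1, this, H.zero]
      linarith
    · have h3 := H.val_sub_of_ne (a := fun i => a (k + i)) (fun i => hb (k + i)) 0 j
        (fun i hi => by simpa using h1 i hi)
      simp only [← add_assoc, zero_add, H.zero] at h3
      have h4 := hk (k + j + 1)
      have h5 := H.pos (j + 1)
      have h6 : ((a (k + j) : ℝ)) + 1 ≤ q j := by exact_mod_cast h2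
      have h7 : (β ^ (j + 1))⁻¹ ≤ β⁻¹ := by
        refine inv_anti₀ (by positivity) ?_
        rw [pow_succ]
        exact le_mul_of_one_le_left (by positivity) (one_le_pow₀ hβ.le)
      have h8 : (β ^ (j + 1))⁻¹ * ((a (k + j) : ℝ) - q j +
          (val β (fun i => a (k + j + 1 + i)) - t (j + 1))) ≤ (β ^ (j + 1))⁻¹ * E :=
        mul_le_mul_of_nonneg_left (by linarith) (by positivity)
      have h9 : (β ^ (j + 1))⁻¹ * E ≤ β⁻¹ * E := mul_le_mul_of_nonneg_right h7 hE
      linarith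
  set C : ℝ := (q 0 : ℝ) * (β - 1)⁻¹
  have hC : 0 ≤ C := mul_nonneg (by positivity) (inv_nonneg.2 (by linarith))
  have hn : ∀ n : ℕ, ∀ k, val β (fun i => a (k + i)) ≤ 1 + β⁻¹ ^ n * C := by
    intro n
    induction n with
    | zero =>
      intro k
      have := val_le hβ (a := fun i => a (k + i)) fun i => hb (k + i)
      simp only [pow_zero, one_mul]
      linarith
    | succ n ih =>
      intro k
      have := step _ (by positivity) ih k
      rw [pow_succ']
      linarith
  have hlim : Tendsto (fun n : ℕ => 1 + β⁻¹ ^ n * C) atTop (𝓝 (1 + 0 * C)) :=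
    ((tendsto_pow_atTop_nhds_zero_of_lt_one (by positivity)
      (inv_lt_one_of_one_lt₀ hβ)).mul_const C).const_add 1
  have := ge_of_tendsto' hlim fun n => hn n k
  linarith

/-- At the first difference `a` loses at least one, its later digits regain at most one by
`val_le_one`, and the later digits of `q` have positive value. -/
theorem val_lt_of_lexLT {a : ℕ → ℕ} (h : ∀ k, ¬ LexLT q (fun i => a (k + i))) {n : ℕ}
    (hn : LexLT a (fun i => q (n + i))) : val β a < t n := by
  have hβ := H.one_lt
  obtain ⟨j, h1, h2⟩ := hn
  have h3 := H.val_sub_of_ne (bdd_of_admissible h) n j h1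
  have h4 := H.val_le_one h (j + 1)
  have h5 := H.pos (n + j + 1)
  have h6 : ((a j : ℝ)) + 1 ≤ q (n + j) := by exact_mod_cast h2
  have h7 : (β ^ (j + 1))⁻¹ * ((a j : ℝ) - q (n + j) +
          (val β (fun i => a (j + 1 + i)) - t (n + j + 1))) < 0 :=
    mul_neg_of_pos_of_neg (by positivity) (by linarith)
  linarith

theorem val_le_of_not_lexLT {a : ℕ → ℕ} (h : ∀ k, ¬ LexLT q (fun i => a (k + i))) {n : ℕ}
    (hn : ¬ LexLT (fun i => q (n + i)) a) : val β a ≤ t n := by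
  rcases lexLT_trichotomy a (fun i => q (n + i)) with h1 | h1 | h1
  · exact (H.val_lt_of_lexLT h h1).le
  · rw [h1, H.val_tail]
  · exact absurd h1 hn

theorem val_lt_one {a : ℕ → ℕ} (h : ∀ k, ¬ LexLT q (fun i => a (k + i)))
    (hn : LexLT a q) : val β a < 1 := by
  have := H.val_lt_of_lexLT h (n := 0) (by simpa using hn)
  rwa [H.zero] at this

/-- The converse comparison needs no admissibility of `a`, only that the tails of `q` are worth at
most one. -/
theorem one_le_val {a : ℕ → ℕ} {R : ℕ} (hR : ∀ k, a k ≤ R) (h : ¬ LexLT a q) :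
    1 ≤ val β a := by
  have hβ := H.one_lt
  rcases lexLT_trichotomy a q with h1 | h1 | ⟨j, h1, h2⟩
  · exact absurd h1 h
  · have := H.val_tail 0
    simp only [zero_add] at this
    rw [h1, this, H.zero]
  · have h3 := H.val_sub_of_ne hR 0 j (fun i hi => by simpa using (h1 i hi).symm)
    simp only [zero_add, H.zero] at h3
    have h4 := val_nonneg hβ (fun i => a (j + 1 + i))
    have h5 := H.le_one (j + 1)
    have h6 : ((q j : ℝ)) + 1 ≤ a j := by exact_mod_cast h2
    have h7 : 0 ≤ (β ^ (j + 1))⁻¹ * ((a j : ℝ) - q j +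
            (val β (fun i => a (j + 1 + i)) - t (j + 1))) :=
      mul_nonneg (by positivity) (by linarith)
    linarith

theorem lexLT_of_val_lt_one {a : ℕ → ℕ} {R : ℕ} (hR : ∀ k, a k ≤ R) (h : val β a < 1) :
    LexLT a q := by
  by_contra h'
  exact absurd (H.one_le_val hR h') (not_le.2 h)

/-- Splicing an admissible sequence with one of small value. -/
theorem val_splice_lt_one {a v : ℕ → ℕ} {R : ℕ} (hR : ∀ k, v k ≤ R)
    (h : ∀ k, ¬ LexLT q (fun i => a (k + i))) {c : ℝ} (hc : ∀ n, c ≤ t n) (hv : val β v < c)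
    (n k : ℕ) (hk : k ≤ n) :
    val β (fun i => if k + i < n then a (k + i) else v (k + i - n)) < 1 := by
  have hβ := H.one_lt
  have hb := bdd_of_admissible h
  have hmain : ∀ d k, k + d = n →
      val β (fun i => if k + i < n then a (k + i) else v (k + i - n)) < 1 := by
    intro d
    induction d using Nat.strong_induction_on with
    | _ d ih =>
    intro k hkd
    have hbd : ∀ i, (fun i => if k + i < n then a (k + i) else v (k + i - n)) i ≤ max R (q 0) := by
      intro i
      dsimp only
      split_ifs
      · exact (hb _).trans (le_max_right _ _)
      · exact (hR _).trans (le_max_left _ _)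
    -- Here `d` is the distance to the splice. If the digits follow `q` up to the splice, the value
    -- of `v` lies below `c`, hence below the tail of `q`. Otherwise they drop below `q` earlier,
    -- and the induction hypothesis bounds what follows.
    by_cases hag : ∀ i < d, a (k + i) = q i
    · have h1 := H.val_sub hbd 0 d (fun i hi => by
        rw [if_pos (by omega), zero_add, hag i hi])
      have e : (fun i => if k + (d + i) < n then a (k + (d + i)) else v (k + (d + i) - n)) = v := by
        funext i
        rw [if_neg (by omega)]
        congr 1
        omega
      simp only [zero_add, H.zero] at h1
      rw [e] at h1
      have h2 := hc d
      have h3 : (β ^ d)⁻¹ * (val β v - t d) < 0 :=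
        mul_neg_of_pos_of_neg (by positivity) (by linarith)
      linarith
    · push Not at hag
      classical
      have hs := Nat.find_spec hag
      have hm : ∀ i < Nat.find hag, a (k + i) = q i := fun i hi => by
        by_contra hne
        exact Nat.find_min hag hi ⟨hi.trans hs.1, hne⟩
      set j := Nat.find hag with hj
      have hlt : a (k + j) < q j := by
        rcases lt_or_gt_of_ne hs.2 with h1 | h1
        · exact h1
        · exact absurd ⟨j, fun i hi => (hm i hi).symm, h1⟩ (h k)
      have h1 := H.val_sub_of_ne hbd 0 j (fun i hi => by
        rw [if_pos (by omega), zero_add, hm i hi])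
      simp only [zero_add, H.zero] at h1
      have h2 := ih (d - (j + 1)) (by omega) (k + (j + 1)) (by omega)
      simp only [add_assoc] at h2 h1
      rw [if_pos (by omega)] at h1
      have h5 := H.pos (j + 1)
      have h6 : ((a (k + j) : ℝ)) + 1 ≤ q j := by exact_mod_cast hlt
      have h7 : (β ^ (j + 1))⁻¹ * ((a (k + j) : ℝ) - q j +
          (val β (fun i => if k + (j + (1 + i)) < n then a (k + (j + (1 + i)))
            else v (k + (j + (1 + i)) - n)) - t (j + 1))) < 0 :=
        mul_neg_of_pos_of_neg (by positivity) (by linarith)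
      linarith
  exact hmain (n - k) k (by omega)

end QuasiGreedy

/-- Sequences all of whose tails have value less than one are determined by their value. -/
theorem eq_of_val_eq {β : ℝ} (hβ : 1 < β) {a b : ℕ → ℕ} {R : ℕ} (ha : ∀ k, a k ≤ R)
    (hb : ∀ k, b k ≤ R) (ha1 : ∀ k, val β (fun i => a (k + i)) < 1)
    (hb1 : ∀ k, val β (fun i => b (k + i)) < 1) (h : val β a = val β b) : a = b := by
  -- Since the next tail has value in `[0, 1)`, each digit is the integer part of `β` times the
  -- current value.
  have hfloor : ∀ {c : ℕ → ℕ}, (∀ k, c k ≤ R) → (∀ k, val β (fun i => c (k + i)) < 1) →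
      ∀ k, c k = ⌊β * val β (fun i => c (k + i))⌋₊ := by
    intro c hc hc1 k
    rw [mul_val hβ hc k]
    have h0 := val_nonneg hβ (fun i => c (k + 1 + i))
    symm
    rw [Nat.floor_eq_iff (by positivity)]
    exact ⟨by linarith, by linarith [hc1 (k + 1)]⟩
  have hv : ∀ k, val β (fun i => a (k + i)) = val β (fun i => b (k + i)) := by
    intro k
    induction k with
    | zero => simpa using h
    | succ k ih =>
      have h1 := mul_val hβ ha k
      have h2 := mul_val hβ hb k
      have h3 : a k = b k := by rw [hfloor ha ha1 k, hfloor hb hb1 k, ih]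
      rw [ih, h3] at h1
      linarith
  funext k
  rw [hfloor ha ha1 k, hfloor hb hb1 k, hv k]

/-- Greedy expansion of a number in `[0, 1)`. -/
theorem exists_greedy {β : ℝ} (hβ : 1 < β) {x : ℝ} (h0 : 0 ≤ x) (h1 : x < 1) :
    ∃ a : ℕ → ℕ, (∀ k, a k ≤ ⌈β⌉₊) ∧ (∀ k, val β (fun i => a (k + i)) < 1) ∧ val β a = x := by
  -- The orbit of `x` under the `β`-transformation; the digits are the integer parts removed along
  -- it.
  let y : ℕ → ℝ := fun n => (fun z => Int.fract (β * z))^[n] x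
  have hy : ∀ n, 0 ≤ y n ∧ y n < 1 := by
    intro n
    cases n with
    | zero => exact ⟨h0, h1⟩
    | succ n =>
      simp only [y, Function.iterate_succ_apply']
      exact ⟨Int.fract_nonneg _, Int.fract_lt_one _⟩
  let a : ℕ → ℕ := fun n => ⌊β * y n⌋₊
  have hrec : ∀ n, y (n + 1) = β * y n - a n := by
    intro n
    have : 0 ≤ β * y n := mul_nonneg (by linarith) (hy n).1
    simp only [y, Function.iterate_succ_apply', a]
    rw [Int.fract, natCast_floor_eq_intCast_floor this]
  have ha : ∀ k, a k ≤ ⌈β⌉₊ := by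
    intro k
    have h2 : β * y k ≤ β := by nlinarith [hy k]
    exact (Nat.floor_le_floor h2).trans (Nat.floor_le_ceil β)
  have hv : ∀ k, val β (fun i => a (k + i)) = y k := by
    intro k
    set C : ℝ := (⌈β⌉₊ : ℝ) * (β - 1)⁻¹ + 1
    have hd : ∀ j, val β (fun i => a (k + i)) - y k =
        β⁻¹ ^ j * (val β (fun i => a (k + j + i)) - y (k + j)) := by
      intro j
      induction j with
      | zero => simp
      | succ j ih =>
        have h2 := mul_val hβ ha (k + j)
        have h3 := hrec (k + j)
        rw [ih, ← add_assoc k j 1, h3]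
        have e : val β (fun i => a (k + j + 1 + i)) =
          β * val β (fun i => a (k + j + i)) - a (k + j) := by linarith
        rw [e, pow_succ]
        have : β ≠ 0 := by positivity
        field_simp
        ring
    have hC : ∀ j : ℕ, |val β (fun i => a (k + i)) - y k| ≤ (β⁻¹) ^ j * C := by
      intro j
      rw [hd j, abs_mul, abs_of_nonneg (by positivity)]
      refine mul_le_mul_of_nonneg_left ?_ (by positivity)
      have h1 := val_nonneg hβ (fun i => a (k + j + i))
      have h2 := val_le hβ (a := fun i => a (k + j + i)) fun k => ha _
      have h3 := hy (k + j)
      have h5 : (0 : ℝ) ≤ (⌈β⌉₊ : ℝ) * (β - 1)⁻¹ := h1.trans h2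
      rw [abs_le]
      constructor <;> simp only [C] <;> linarith
    have hlim : Tendsto (fun j : ℕ => (β⁻¹) ^ j * C) atTop (𝓝 0) := by
      simpa using (tendsto_pow_atTop_nhds_zero_of_lt_one (by positivity)
        (inv_lt_one_of_one_lt₀ hβ)).mul_const C
    have := ge_of_tendsto' hlim hC
    exact sub_eq_zero.1 (abs_eq_zero.1 (le_antisymm this (abs_nonneg _)))
  refine ⟨a, ha, fun k => ?_, ?_⟩
  · rw [hv]
    exact (hy k).2
  · simpa [y] using hv 0

/-! ### The quadratic unit and the lattice of its conjugate embeddings -/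

/-- `β > 1` and `μ` are the roots of `X² - r X + σ`, where `r` is an integer and `σ = ±1`. -/
structure IsUnitPair (β μ : ℝ) (r σ : ℤ) : Prop where
  one_lt : 1 < β
  add_eq : β + μ = r
  mul_eq : β * μ = σ
  sign : σ = 1 ∨ σ = -1

namespace IsUnitPair

variable {β μ : ℝ} {r σ : ℤ} (H : IsUnitPair β μ r σ)

include H

theorem abs_eq : |μ| = β⁻¹ := by
  have h := H.one_lt
  have h1 : |β * μ| = 1 := by
    rw [H.mul_eq]
    rcases H.sign with rfl | rfl <;> simp
  rw [abs_mul, abs_of_pos (by linarith)] at h1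
  exact eq_inv_of_mul_eq_one_right h1

theorem abs_lt_one : |μ| < 1 := by
  rw [H.abs_eq]
  exact inv_lt_one_of_one_lt₀ H.one_lt

theorem sub_pos : 0 < β - μ := by
  have := H.one_lt
  have := (abs_lt.1 H.abs_lt_one).2
  linarith

theorem ne_zero : μ ≠ 0 := by
  intro h
  have := H.abs_eq
  have h1 := H.one_lt
  rw [h, abs_zero, zero_eq_inv] at this
  linarith

end IsUnitPair

/-- The image of `ℤ[β]` under the two embeddings into the real numbers. -/
def conjLattice (β μ : ℝ) : AddSubgroup (ℝ × ℝ) where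
  carrier := {p | ∃ a b : ℤ, p.1 = a + b * β ∧ p.2 = a + b * μ}
  zero_mem' := ⟨0, 0, by simp, by simp⟩
  add_mem' := by
    rintro p p' ⟨a, b, h1, h2⟩ ⟨a', b', h1', h2'⟩
    refine ⟨a + a', b + b', ?_, ?_⟩
    · rw [Prod.fst_add, h1, h1']
      push_cast
      ring
    · rw [Prod.snd_add, h2, h2']
      push_cast
      ring
  neg_mem' := by
    rintro p ⟨a, b, h1, h2⟩
    refine ⟨-a, -b, ?_, ?_⟩
    · rw [Prod.fst_neg, h1]
      push_cast
      ring
    · rw [Prod.snd_neg, h2]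
      push_cast
      ring

theorem intCast_mem_conjLattice (β μ : ℝ) (a : ℤ) : ((a : ℝ), (a : ℝ)) ∈ conjLattice β μ :=
  ⟨a, 0, by simp, by simp⟩

namespace IsUnitPair

variable {β μ : ℝ} {r σ : ℤ} (H : IsUnitPair β μ r σ)

include H

theorem mul_mem {u v : ℝ} (h : (u, v) ∈ conjLattice β μ) :
    (β * u, μ * v) ∈ conjLattice β μ := by
  obtain ⟨a, b, h1, h2⟩ := h
  have e1 := H.add_eq
  have e2 := H.mul_eq
  refine ⟨-b * σ, a + b * r, ?_, ?_⟩
  · simp only at h1 ⊢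
    push_cast
    rw [h1, ← e1, ← e2]
    ring
  · simp only at h2 ⊢
    push_cast
    rw [h2, ← e1, ← e2]
    ring

theorem pow_mul_mem {u v : ℝ} (h : (u, v) ∈ conjLattice β μ) (n : ℕ) :
    (β ^ n * u, μ ^ n * v) ∈ conjLattice β μ := by
  induction n with
  | zero => simpa using h
  | succ n ih =>
    have := H.mul_mem ih
    rwa [pow_succ', pow_succ', mul_assoc, mul_assoc]

/-- As `β ≠ μ`, the two integer coordinates depend continuously on the point, so the lattice is an
intersection of preimages of `ℤ`. -/
theorem isClosed_conjLattice : IsClosed (conjLattice β μ : Set (ℝ × ℝ)) := by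
  have hs := H.sub_pos
  have e : (conjLattice β μ : Set (ℝ × ℝ)) =
      {p : ℝ × ℝ | (p.1 - p.2) / (β - μ) ∈ Set.range (Int.cast : ℤ → ℝ)} ∩
      {p : ℝ × ℝ | p.1 - (p.1 - p.2) / (β - μ) * β ∈ Set.range (Int.cast : ℤ → ℝ)} := by
    ext p
    constructor
    · rintro ⟨a, b, h1, h2⟩
      have hb : (p.1 - p.2) / (β - μ) = b := by
        rw [h1, h2]
        field_simp
        ring
      refine ⟨⟨b, hb.symm⟩, a, ?_⟩
      rw [hb, h1]
      ring
    · rintro ⟨⟨b, hb⟩, a, ha⟩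
      refine ⟨a, b, ?_, ?_⟩
      · rw [ha, hb]
        ring
      · have h3 : p.1 - p.2 = b * (β - μ) := by
          rw [hb]
          field_simp
        rw [ha, ← hb]
        linarith
  rw [e]
  have hZ := Int.isClosedEmbedding_coe_real.isClosed_range
  exact (hZ.preimage (by fun_prop)).inter (hZ.preimage (by fun_prop))

/-- `β` is irrational. -/
theorem eq_zero_of_add_mul_eq_zero {a b : ℤ} (h : (a : ℝ) + b * β = 0) : a = 0 ∧ b = 0 := by
  -- Multiplication by `(β, μ)` keeps this point in the lattice with first coordinate zero, while
  -- its second coordinate tends to zero. Discreteness makes it vanish.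
  have hmem : ((0 : ℝ), (a : ℝ) + b * μ) ∈ conjLattice β μ := ⟨a, b, h.symm, rfl⟩
  have hs := H.sub_pos
  set v := (a : ℝ) + b * μ with hv
  have hlim : Tendsto (fun n : ℕ => (μ ^ n * v) / (β - μ)) atTop (𝓝 0) := by
    simpa using ((tendsto_pow_atTop_nhds_zero_of_abs_lt_one H.abs_lt_one).mul_const v).div_const
      (β - μ)
  have hlim' : Tendsto (fun n : ℕ => μ ^ n * v) atTop (𝓝 0) := by
    simpa using (tendsto_pow_atTop_nhds_zero_of_abs_lt_one H.abs_lt_one).mul_const v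
  obtain ⟨n, hn, hn'⟩ := ((hlim.eventually (Metric.ball_mem_nhds 0 one_pos)).and
    (hlim'.eventually (Metric.ball_mem_nhds 0 one_pos))).exists
  rw [Real.dist_eq, sub_zero] at hn hn'
  obtain ⟨a', b', h1, h2⟩ := H.pow_mul_mem hmem n
  simp only [mul_zero] at h1 h2
  have hb : (b' : ℝ) = -((μ ^ n * v) / (β - μ)) := by
    rw [h2]
    field_simp
    linarith
  have hb0 : b' = 0 := by
    have : |(b' : ℝ)| < 1 := by rwa [hb, abs_neg]
    exact Int.abs_lt_one_iff.1 (by exact_mod_cast this)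
  have ha0 : a' = 0 := by
    rw [hb0] at h1
    simpa using h1.symm
  rw [ha0, hb0] at h2
  have hv0 : v = 0 := by
    have := H.ne_zero
    simpa [this] using h2
  have hb : (b : ℝ) * (β - μ) = 0 := by linarith
  have hb : b = 0 := by
    rcases mul_eq_zero.1 hb with h | h
    · exact_mod_cast h
    · linarith
  refine ⟨?_, hb⟩
  rw [hb] at h
  simpa using h

theorem eq_zero_of_snd {u : ℝ} (h : (u, (0 : ℝ)) ∈ conjLattice β μ) : u = 0 := by
  obtain ⟨a, b, h1, h2⟩ := h
  have e := H.add_eq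
  -- Substituting `μ = r - β` turns the relation into one for `β`.
  have h3 := H.eq_zero_of_add_mul_eq_zero (a := a + b * r) (b := -b) (by
    push_cast
    rw [← e]
    simp only at h2
    linarith)
  have hb : b = 0 := by omega
  have ha : a = 0 := by
    have := h3.1
    rw [hb] at this
    simpa using this
  simpa [ha, hb] using h1

end IsUnitPair

/-! ### The explicit quasi-greedy digits of the quadratic unit -/

/-- The digits of the quasi-greedy expansion of one in base `β`. -/
def qgDigits (r σ : ℤ) (n : ℕ) : ℕ :=
  if σ = 1 then (if n = 0 then (r - 1).toNat else (r - 2).toNat)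
  else (if Even n then r.toNat else 0)

/-- The values of the tails of `qgDigits`. -/
def qgTail (μ : ℝ) (σ : ℤ) (n : ℕ) : ℝ :=
  if σ = 1 then (if n = 0 then 1 else 1 - μ) else (if Even n then 1 else -μ)

namespace IsUnitPair

variable {β μ : ℝ} {r σ : ℤ} (H : IsUnitPair β μ r σ)

include H

theorem trace_pos : 1 ≤ r := by
  have h1 := H.one_lt
  have h2 := (abs_lt.1 H.abs_lt_one).1
  have h3 := H.add_eq
  have : (0 : ℝ) < r := by linarith
  have : 0 < r := by exact_mod_cast this
  omega

theorem three_le_trace (h : σ = 1) : 3 ≤ r := by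
  have h1 := H.one_lt
  have h2 := H.abs_eq
  have h3 := H.add_eq
  have h4 := H.mul_eq
  rw [h] at h4
  push_cast at h4
  have : (2 : ℝ) < r := by
    rw [← h3]
    have : 0 < (β - 1) ^ 2 := by nlinarith
    by_contra hc
    have h5 : (β + μ) * β ≤ 2 * β := mul_le_mul_of_nonneg_right (not_lt.1 hc) (by linarith)
    nlinarith
  have : 2 < r := by exact_mod_cast this
  omega

theorem conj_pos (h : σ = 1) : 0 < μ := by
  have h4 := H.mul_eq
  have h1 := H.one_lt
  rw [h] at h4
  push_cast at h4
  by_contra hc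
  nlinarith

theorem conj_neg (h : σ = -1) : μ < 0 := by
  have h4 := H.mul_eq
  have h1 := H.one_lt
  rw [h] at h4
  push_cast at h4
  by_contra hc
  nlinarith

/-- Both cases rest on `β + μ = r` and `β μ = σ`. For `σ = 1` the tail value is fixed at `1 - μ`
after the first step, the digits being `r - 1, r - 2, r - 2, …`. For `σ = -1` it alternates between
`1` and `-μ`, the digits being `r, 0, r, 0, …`. -/
theorem quasiGreedy : QuasiGreedy β (qgDigits r σ) (qgTail μ σ) := by
  have h1 := H.one_lt
  have h2 := abs_lt.1 H.abs_lt_one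
  have h3 := H.add_eq
  have h4 := H.mul_eq
  have h5 := H.trace_pos
  rcases H.sign with hσ | hσ
  · have h6 := H.three_le_trace hσ
    have h7 := H.conj_pos hσ
    rw [hσ] at h4
    push_cast at h4
    have c1 : (((r - 1).toNat : ℕ) : ℝ) = r - 1 := by
      have : (((r - 1).toNat : ℕ) : ℤ) = r - 1 := Int.toNat_of_nonneg (by omega)
      exact_mod_cast this
    have c2 : (((r - 2).toNat : ℕ) : ℝ) = r - 2 := by
      have : (((r - 2).toNat : ℕ) : ℤ) = r - 2 := Int.toNat_of_nonneg (by omega)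
      exact_mod_cast this
    refine ⟨h1, by simp [qgTail], ⟨1 - μ, by linarith, fun n => ?_⟩, fun n => ?_, fun n => ?_⟩
    · simp only [qgTail, if_pos hσ]
      split_ifs <;> linarith
    · simp only [qgTail, if_pos hσ]
      split_ifs <;> linarith
    · simp only [qgTail, qgDigits, if_pos hσ, Nat.add_eq_zero_iff, one_ne_zero, and_false, if_false]
      split_ifs
      · rw [c1]
        linarith
      · rw [c2]
        linarith
  · have h7 := H.conj_neg hσ
    have hσ' : ¬ σ = 1 := by omega
    rw [hσ] at h4
    push_cast at h4
    have c1 : ((r.toNat : ℕ) : ℝ) = r := by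
      have : ((r.toNat : ℕ) : ℤ) = r := Int.toNat_of_nonneg (by omega)
      exact_mod_cast this
    refine ⟨h1, by simp [qgTail], ⟨-μ, by linarith, fun n => ?_⟩, fun n => ?_, fun n => ?_⟩
    · simp only [qgTail, if_neg hσ']
      split_ifs <;> linarith
    · simp only [qgTail, if_neg hσ']
      split_ifs <;> linarith
    · simp only [qgTail, qgDigits, if_neg hσ', Nat.even_add_one]
      by_cases hn : Even n
      · simp only [hn, not_true, if_true, if_false, c1]
        linarith
      · simp only [hn, not_false_iff, if_true, if_false]
        push_cast
        linarith

end IsUnitPair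

/-! ### Future and past of two-sided admissible sequences -/

/-- Parry's admissibility condition for two-sided sequences. -/
def Parry (q : ℕ → ℕ) (e : ℤ → ℕ) : Prop := ∀ k : ℤ, ¬ LexLT q (fun i : ℕ => e (k + i))

namespace Parry

variable {q : ℕ → ℕ} {e : ℤ → ℕ} (h : Parry q e)

include h

theorem tail (n : ℤ) (k : ℕ) : ¬ LexLT q (fun i : ℕ => (fun j : ℕ => e (n + j)) (k + i)) := by
  simpa [add_assoc] using h (n + k)

theorem le (n : ℤ) : e n ≤ q 0 := by
  simpa using bdd_of_admissible (a := fun j : ℕ => e (n + j)) (h.tail n) 0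

theorem comp_add (m : ℤ) : Parry q (fun n => e (n + m)) := by
  intro k
  have e1 : (fun i : ℕ => e (k + i + m)) = fun i : ℕ => e (k + m + i) := by
    funext i
    congr 1
    ring
  simpa only [e1] using h (k + m)

end Parry

/-- The value `∑_{k ≥ 1} e_{n+k} β^{-k}` of the future at time `n`. -/
def future (β : ℝ) (e : ℤ → ℕ) (n : ℤ) : ℝ := val β (fun i : ℕ => e (n + 1 + i))

/-- The value `-∑_{k ≥ 0} e_{n-k} μ^k` of the past at time `n`. -/
def past (μ : ℝ) (e : ℤ → ℕ) (n : ℤ) : ℝ := -∑' k : ℕ, (e (n - k) : ℝ) * μ ^ k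

theorem mul_future {β : ℝ} (hβ : 1 < β) {e : ℤ → ℕ}  {n : ℤ}
    (h : Summable fun k : ℕ => (e (n + 1 + k) : ℝ) * (β ^ (k + 1))⁻¹) :
    β * future β e n = e (n + 1) + future β e (n + 1) := by
  rw [future, mul_val_of_summable hβ h, future]
  have e1 : (fun i : ℕ => e (n + 1 + ((1 + i : ℕ) : ℤ))) = fun i : ℕ => e (n + 1 + 1 + i) := by
    funext i
    congr 1
    push_cast
    ring
  rw [e1]
  simp

/-- The sign in `past` is chosen so that a shift subtracts the same digit from `μ` times the past as
from `β` times the future. A shift is therefore multiplication by `(β, μ)` modulo diagonal integers.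
-/
theorem past_add_one {μ : ℝ} {e : ℤ → ℕ} {n : ℤ}
    (h : Summable fun k : ℕ => (e (n - k) : ℝ) * μ ^ k) :
    past μ e (n + 1) = μ * past μ e n - e (n + 1) := by
  have e1 : ∀ k : ℕ, (e (n + 1 - ((k + 1 : ℕ) : ℤ)) : ℝ) * μ ^ (k + 1) =
      μ * ((e (n - k) : ℝ) * μ ^ k) := by
    intro k
    have : n + 1 - ((k + 1 : ℕ) : ℤ) = n - k := by
      push_cast
      ring
    rw [this]
    ring
  have hs : Summable fun k : ℕ => (e (n + 1 - k) : ℝ) * μ ^ k := by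
    refine (summable_nat_add_iff 1).1 ?_
    simp only [e1]
    exact h.mul_left μ
  rw [past, hs.tsum_eq_zero_add]
  simp only [e1]
  rw [tsum_mul_left, past]
  simp
  ring

theorem summable_past {μ : ℝ} (hμ : |μ| < 1) {e : ℤ → ℕ} {R : ℕ} (hR : ∀ n, e n ≤ R) (n : ℤ) :
    Summable fun k : ℕ => (e (n - k) : ℝ) * μ ^ k := by
  refine Summable.of_norm_bounded ((summable_geometric_of_lt_one (abs_nonneg μ) hμ).mul_left (R : ℝ))
    fun k => ?_
  rw [norm_mul, norm_pow, Real.norm_eq_abs, Real.norm_eq_abs, Nat.abs_cast]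
  exact mul_le_mul_of_nonneg_right (by exact_mod_cast hR _) (by positivity)

theorem abs_past_le {μ : ℝ} (hμ : |μ| < 1) {e : ℤ → ℕ} {R : ℕ} (hR : ∀ n, e n ≤ R) (n : ℤ) :
    |past μ e n| ≤ R * (1 - |μ|)⁻¹ := by
  rw [past, abs_neg, ← tsum_geometric_of_lt_one (abs_nonneg μ) hμ, ← tsum_mul_left,
    ← Real.norm_eq_abs]
  refine tsum_of_norm_bounded
    ((summable_geometric_of_lt_one (abs_nonneg μ) hμ).mul_left (R : ℝ)).hasSum fun k => ?_
  rw [norm_mul, norm_pow, Real.norm_eq_abs, Real.norm_eq_abs, Nat.abs_cast]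
  exact mul_le_mul_of_nonneg_right (by exact_mod_cast hR _) (by positivity)

theorem future_comp_add (β : ℝ) (e : ℤ → ℕ) (m n : ℤ) :
    future β (fun k => e (k + m)) n = future β e (n + m) := by
  have e1 : (fun i : ℕ => e (n + 1 + i + m)) = fun i : ℕ => e (n + m + 1 + i) := by
    funext i
    congr 1
    ring
  rw [future, e1, future]

theorem past_comp_add (μ : ℝ) (e : ℤ → ℕ) (m n : ℤ) :
    past μ (fun k => e (k + m)) n = past μ e (n + m) := by
  have e1 : ∀ k : ℕ, n - k + m = n + m - k := fun k => by ring
  simp only [past, e1]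

namespace QuasiGreedy

variable {β : ℝ} {q : ℕ → ℕ} {t : ℕ → ℝ} (Q : QuasiGreedy β q t)

include Q

theorem mul_future {e : ℤ → ℕ} (h : Parry q e) (n : ℤ) :
    β * future β e n = e (n + 1) + future β e (n + 1) :=
  ToralCoding.mul_future Q.one_lt
    (summable_val Q.one_lt (a := fun k : ℕ => e (n + 1 + k)) fun _ => h.le _)

theorem future_nonneg (e : ℤ → ℕ) (n : ℤ) : 0 ≤ future β e n := val_nonneg Q.one_lt _

theorem future_le_one {e : ℤ → ℕ} (h : Parry q e) (n : ℤ) : future β e n ≤ 1 := by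
  simpa [future] using Q.val_le_one (a := fun j : ℕ => e (n + 1 + j)) (h.tail (n + 1)) 0

/-- A tail beginning with the largest digit `q 0` must continue with something not exceeding the
first tail of `q`. -/
theorem future_le_of_eq {e : ℤ → ℕ} (h : Parry q e) {n : ℤ} (hn : e n = q 0) :
    future β e n ≤ t 1 := by
  refine Q.val_le_of_not_lexLT (h.tail (n + 1)) ?_
  rintro ⟨j, hj, hj'⟩
  refine h n ⟨j + 1, fun i hi => ?_, ?_⟩
  · rcases i with - | i
    · simpa using hn.symm
    · have := hj i (by omega)
      dsimp only at this ⊢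
      rw [add_comm 1 i] at this
      rw [this]
      congr 1
      push_cast
      ring
  · dsimp only at hj' ⊢
    rw [add_comm 1 j] at hj'
    have e1 : n + ((j + 1 : ℕ) : ℤ) = n + 1 + j := by
      push_cast
      ring
    rw [e1]
    exact hj'

end QuasiGreedy

theorem le_of_forall_le_add_pow {a b ρ C : ℝ} (h0 : 0 ≤ ρ) (h1 : ρ < 1)
    (h : ∀ m : ℕ, a ≤ b + ρ ^ m * C) : a ≤ b := by
  have hlim : Tendsto (fun n : ℕ => b + ρ ^ n * C) atTop (𝓝 (b + 0 * C)) :=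
    ((tendsto_pow_atTop_nhds_zero_of_lt_one h0 h1).mul_const C).const_add b
  have := ge_of_tendsto' hlim h
  linarith

namespace IsUnitPair

variable {β μ : ℝ} {r σ : ℤ} (H : IsUnitPair β μ r σ)

include H

theorem past_eq {e : ℤ → ℕ} (h : Parry (qgDigits r σ) e) (n : ℤ) :
    past μ e n = μ * past μ e (n - 1) - e n := by
  have := past_add_one (summable_past H.abs_lt_one h.le (n - 1))
  rwa [sub_add_cancel] at this

theorem future_eq {e : ℤ → ℕ} (h : Parry (qgDigits r σ) e) (n : ℤ) :
    β * future β e (n - 1) = e n + future β e n := by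
  have := H.quasiGreedy.mul_future h (n - 1)
  rwa [sub_add_cancel] at this

/-- The past evolves by `y ↦ μ y - d` with `0 ≤ d ≤ r`. For `μ < 0` these maps preserve `[-β, 1]`,
as `μ · (-β) = 1` and `μ - r = -β`. Any initial error shrinks by the factor `-μ`. -/
theorem past_bounds_of_neg (hσ : σ = -1) {e : ℤ → ℕ} (h : Parry (qgDigits r σ) e) (n : ℤ) :
    -β ≤ past μ e n ∧ past μ e n ≤ 1 := by
  have h2 := abs_lt.1 H.abs_lt_one
  have h3 := H.add_eq
  have h4 := H.mul_eq
  have h7 := H.conj_neg hσ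
  have h8 := H.one_lt
  rw [hσ] at h4
  push_cast at h4
  set C : ℝ := (qgDigits r σ 0 : ℝ) * (1 - |μ|)⁻¹
  have hC0 : 0 ≤ C := mul_nonneg (by positivity) (inv_nonneg.2 (by linarith [H.abs_lt_one]))
  have hd : ∀ n, (e n : ℝ) ≤ r := by
    intro n
    have h5 := h.le n
    have h6 := H.trace_pos
    rw [qgDigits, if_neg (by omega), if_pos (by simp)] at h5
    have : (e n : ℤ) ≤ r := by omega
    exact_mod_cast this
  have key : ∀ m : ℕ, ∀ n, -β - (-μ) ^ m * C ≤ past μ e n ∧ past μ e n ≤ 1 + (-μ) ^ m * C := by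
    intro m
    induction m with
    | zero =>
      intro n
      have := abs_le.1 (abs_past_le H.abs_lt_one h.le n)
      simp only [pow_zero, one_mul]
      exact ⟨by linarith, by linarith⟩
    | succ m ih =>
      intro n
      obtain ⟨i1, i2⟩ := ih (n - 1)
      rw [H.past_eq h n, pow_succ']
      have h5 := hd n
      have h6 : (0 : ℝ) ≤ e n := by positivity
      set E := (-μ) ^ m * C
      constructor
      · have : μ * (1 + E) ≤ μ * past μ e (n - 1) := mul_le_mul_of_nonpos_left i2 h7.le
        nlinarith
      · have : μ * past μ e (n - 1) ≤ μ * (-β - E) := mul_le_mul_of_nonpos_left i1 h7.le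
        nlinarith
  constructor
  · exact le_of_forall_le_add_pow (ρ := -μ) (C := C) (by linarith) (by linarith)
      fun m => by linarith [(key m n).1]
  · exact le_of_forall_le_add_pow (ρ := -μ) (C := C) (by linarith) (by linarith)
      fun m => (key m n).2

/-- The region is an L-shape rather than a rectangle, and both bounds must be propagated together.
Digit `r - 1`, or digit `r - 2` with future above `1 - μ`, forces the previous future above `1 - μ`,
where the better bound on the past is available. Smaller digits need only the weaker bound. -/
theorem past_bounds_of_pos (hσ : σ = 1) {e : ℤ → ℕ} (h : Parry (qgDigits r σ) e) (n : ℤ) :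
    -β ≤ past μ e n ∧ (1 - μ < future β e n → 1 - β ≤ past μ e n) := by
  have h1 := H.three_le_trace hσ
  have h2 := abs_lt.1 H.abs_lt_one
  have h3 := H.add_eq
  have h4 := H.mul_eq
  have h7 := H.conj_pos hσ
  have h8 := H.one_lt
  have Q := H.quasiGreedy
  rw [hσ] at h4
  push_cast at h4
  set C : ℝ := (qgDigits r σ 0 : ℝ) * (1 - |μ|)⁻¹
  have hC0 : 0 ≤ C := mul_nonneg (by positivity) (inv_nonneg.2 (by linarith [H.abs_lt_one]))
  have hq : qgDigits r σ 0 = (r - 1).toNat := by simp [qgDigits, hσ]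
  have hfut : ∀ n, future β e (n - 1) = μ * (e n + future β e n) := by
    intro n
    rw [← H.future_eq h n, ← mul_assoc, mul_comm μ β, h4, one_mul]
  have key : ∀ m : ℕ, ∀ n, -β - μ ^ m * C ≤ past μ e n ∧
      (1 - μ < future β e n → 1 - β - μ ^ m * C ≤ past μ e n) := by
    intro m
    induction m with
    | zero =>
      intro n
      have := abs_le.1 (abs_past_le H.abs_lt_one h.le n)
      simp only [pow_zero, one_mul]
      exact ⟨by linarith, fun _ => by linarith⟩
    | succ m ih =>
      intro n
      obtain ⟨i1, i2⟩ := ih (n - 1)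
      rw [H.past_eq h n, pow_succ']
      have hx0 := Q.future_nonneg e n
      have hle := h.le n
      rw [hq] at hle
      rw [hfut n] at i2
      set E := μ ^ m * C
      have j1 : μ * (-β - E) ≤ μ * past μ e (n - 1) := mul_le_mul_of_nonneg_left i1 h7.le
      have j2 : 1 - μ < μ * (e n + future β e n) →
          μ * (1 - β - E) ≤ μ * past μ e (n - 1) :=
        fun h => mul_le_mul_of_nonneg_left (i2 h) h7.le
      rcases lt_or_eq_of_le hle with hlt | heq
      · have hlt' : (e n : ℤ) ≤ r - 2 := by omega
        constructor
        · have : (e n : ℝ) ≤ r - 2 := by exact_mod_cast hlt'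
          nlinarith
        · intro hx
          rcases lt_or_eq_of_le hlt' with hlt2 | heq2
          · have : (e n : ℝ) ≤ r - 3 := by
              have : (e n : ℤ) ≤ r - 3 := by omega
              exact_mod_cast this
            nlinarith
          · have e2 : (e n : ℝ) = r - 2 := by exact_mod_cast heq2
            rw [e2] at j2 ⊢
            have := j2 (by
              have : μ * (r - 2 + (1 - μ)) < μ * (r - 2 + future β e n) :=
                mul_lt_mul_of_pos_left (by linarith) h7
              have e3 : μ * (r - 2 + (1 - μ)) = 1 - μ := by
                rw [← h3]
                linear_combination h4
              linarith)
            nlinarith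
      · have e2 : (e n : ℝ) = r - 1 := by
          have : (e n : ℤ) = r - 1 := by omega
          exact_mod_cast this
        have hft := Q.future_le_of_eq h (n := n) (by rw [hq, heq])
        have e5 : qgTail μ σ 1 = 1 - μ := by simp [qgTail, hσ]
        rw [e5] at hft
        refine ⟨?_, fun hx => absurd hx (not_lt.2 hft)⟩
        rw [e2] at j2 ⊢
        have := j2 (by
          have : μ * (r - 1) ≤ μ * (r - 1 + future β e n) :=
            mul_le_mul_of_nonneg_left (by linarith) h7.le
          have e3 : μ * (r - 1) = 1 - μ + μ * μ := by
            rw [← h3]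
            linear_combination h4
          have : 0 < μ * μ := by positivity
          linarith)
        nlinarith
  constructor
  · exact le_of_forall_le_add_pow (ρ := μ) (C := C) (by linarith) (by linarith)
      fun m => by linarith [(key m n).1]
  · intro hx
    exact le_of_forall_le_add_pow (ρ := μ) (C := C) (by linarith) (by linarith)
      fun m => by linarith [(key m n).2 hx]

/-- The pairs (future, past) of admissible sequences lie in the union of two rectangles of total
area `β - μ`. -/
theorem exists_rectangles : ∃ κ s : ℝ, 0 ≤ κ ∧ 1 - β ≤ s ∧ κ + s = 1 - μ ∧
    ∀ e : ℤ → ℕ, Parry (qgDigits r σ) e → ∀ n,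
      (future β e n, past μ e n) ∈
        Set.Icc (0 : ℝ) 1 ×ˢ Set.Icc (1 - β) s ∪ Set.Icc 0 κ ×ˢ Set.Icc (-β) (1 - β) := by
  have h2 := abs_lt.1 H.abs_lt_one
  have h3 := H.add_eq
  have h8 := H.one_lt
  have Q := H.quasiGreedy
  rcases H.sign with hσ | hσ
  -- The total area is `(s - (1 - β)) + κ`, so `κ + s = 1 - μ` is exactly what makes it `β - μ`.
  · refine ⟨1 - μ, 0, by linarith, by linarith, by ring, fun e he n => ?_⟩
    obtain ⟨b1, b2⟩ := H.past_bounds_of_pos hσ he n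
    have f0 := Q.future_nonneg e n
    have f1 := Q.future_le_one he n
    have b3 : past μ e n ≤ 0 := by
      have := H.conj_pos hσ
      exact neg_nonpos.2 (tsum_nonneg fun k => by positivity)
    rcases le_or_gt (1 - β) (past μ e n) with hp | hp
    · exact Or.inl ⟨⟨f0, f1⟩, hp, b3⟩
    · refine Or.inr ⟨⟨f0, ?_⟩, b1, hp.le⟩
      by_contra hc
      exact absurd (b2 (not_le.1 hc)) (not_le.2 hp)
  · have h7 := H.conj_neg hσ
    refine ⟨-μ, 1, by linarith, by linarith, by ring, fun e he n => ?_⟩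
    obtain ⟨b1, b2⟩ := H.past_bounds_of_neg hσ he n
    obtain ⟨c1, c2⟩ := H.past_bounds_of_neg hσ he (n - 1)
    have f0 := Q.future_nonneg e n
    have f1 := Q.future_le_one he n
    rcases le_or_gt (1 - β) (past μ e n) with hp | hp
    · exact Or.inl ⟨⟨f0, f1⟩, hp, b2⟩
    · refine Or.inr ⟨⟨f0, ?_⟩, b1, hp.le⟩
      have hq : qgDigits r σ 0 = r.toNat := by
        rw [qgDigits, if_neg (by omega), if_pos (by simp)]
      have e5 : qgTail μ σ 1 = -μ := by
        rw [qgTail, if_neg (by omega), if_neg (by simp)]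
      rw [← e5]
      refine Q.future_le_of_eq he ?_
      -- A past below `1 - β` requires the digit `r`: the previous past is at most one, so a digit
      -- at most `r - 1` leaves the past at least `μ - (r - 1) = 1 - β`.
      by_contra hne
      have hle := he.le n
      rw [hq] at hle hne
      have : (e n : ℝ) ≤ r - 1 := by
        have : (e n : ℤ) ≤ r - 1 := by omega
        exact_mod_cast this
      rw [H.past_eq he n] at hp
      have : μ * 1 ≤ μ * past μ e (n - 1) := mul_le_mul_of_nonpos_left c2 h7.le
      linarith

end IsUnitPair

/-! ### Admissible sequences cover the plane modulo the lattice -/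

/-- `(u, v)` agrees modulo the lattice with (future, past) of an admissible sequence. -/
def IsRepresented (β μ : ℝ) (q : ℕ → ℕ) (u v : ℝ) : Prop :=
  ∃ e : ℤ → ℕ, Parry q e ∧ (u - future β e 0, v - past μ e 0) ∈ conjLattice β μ

theorem IsRepresented.add_mem {β μ : ℝ} {q : ℕ → ℕ} {u v u' v' : ℝ}
    (h : IsRepresented β μ q u v) (h' : (u', v') ∈ conjLattice β μ) :
    IsRepresented β μ q (u + u') (v + v') := by
  obtain ⟨e, he, hl⟩ := h
  refine ⟨e, he, ?_⟩
  convert! (conjLattice β μ).add_mem hl h' using 1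
  ext
  · simp only [Prod.fst_add]
    ring
  · simp only [Prod.snd_add]
    ring

theorem isClosed_not_lexLT (q : ℕ → ℕ) : IsClosed {a : ℕ → ℕ | ¬ LexLT q a} := by
  rw [← isOpen_compl_iff]
  have : {a : ℕ → ℕ | ¬ LexLT q a}ᶜ =
      ⋃ j : ℕ, (⋂ i ∈ Finset.range j, (fun a : ℕ → ℕ => a i) ⁻¹' {q i}) ∩
        (fun a : ℕ → ℕ => a j) ⁻¹' Set.Ioi (q j) := by
    ext a
    simp only [Set.mem_compl_iff, Set.mem_ofPred_eq, not_not, LexLT, Set.mem_iUnion, Set.mem_inter_iff,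
      Set.mem_iInter, Finset.mem_range, Set.mem_preimage, Set.mem_singleton_iff, Set.mem_Ioi]
    simp only [eq_comm]
  rw [this]
  refine isOpen_iUnion fun j => IsOpen.inter (isOpen_biInter_finset fun i _ => ?_) ?_
  · exact (isOpen_discrete _).preimage (continuous_apply i)
  · exact (isOpen_discrete _).preimage (continuous_apply j)

theorem isClosed_parry (q : ℕ → ℕ) : IsClosed {e : ℤ → ℕ | Parry q e} := by
  have : {e : ℤ → ℕ | Parry q e} =
      ⋂ k : ℤ, (fun (e : ℤ → ℕ) (i : ℕ) => e (k + i)) ⁻¹' {a : ℕ → ℕ | ¬ LexLT q a} := by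
    ext e
    simp [Parry]
  rw [this]
  exact isClosed_iInter fun k => (isClosed_not_lexLT q).preimage (by fun_prop)

theorem isCompact_parry (q : ℕ → ℕ) : IsCompact {e : ℤ → ℕ | Parry q e} := by
  refine (isCompact_univ_pi (X := fun _ : ℤ => ℕ) (s := fun _ => Set.Iic (q 0)) fun _ =>
    (Set.finite_Iic _).isCompact).of_isClosed_subset (isClosed_parry q) ?_
  intro e he n _
  exact Parry.le he n

theorem continuousOn_future {β : ℝ} (hβ : 1 < β) (q : ℕ → ℕ) (n : ℤ) :
    ContinuousOn (fun e : ℤ → ℕ => future β e n) {e | Parry q e} := by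
  refine continuousOn_tsum (u := fun k => (q 0 : ℝ) * (β ^ (k + 1))⁻¹) (fun k => ?_)
    ((hasSum_geometric_inv hβ).summable.mul_left _) ?_
  · have : Continuous fun e : ℤ → ℕ => (e (n + 1 + k) : ℝ) :=
      continuous_of_discreteTopology.comp (continuous_apply _)
    exact (this.mul continuous_const).continuousOn
  · intro k e he
    rw [Real.norm_of_nonneg (by positivity)]
    exact mul_le_mul_of_nonneg_right (by exact_mod_cast Parry.le he _) (by positivity)

theorem continuousOn_past {μ : ℝ} (hμ : |μ| < 1) (q : ℕ → ℕ) (n : ℤ) :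
    ContinuousOn (fun e : ℤ → ℕ => past μ e n) {e | Parry q e} := by
  refine (continuousOn_tsum (u := fun k => (q 0 : ℝ) * |μ| ^ k) (fun k => ?_)
    ((summable_geometric_of_lt_one (abs_nonneg μ) hμ).mul_left _) ?_).neg
  · have : Continuous fun e : ℤ → ℕ => (e (n - k) : ℝ) :=
      continuous_of_discreteTopology.comp (continuous_apply _)
    exact (this.mul continuous_const).continuousOn
  · intro k e he
    rw [norm_mul, norm_pow, Real.norm_eq_abs, Real.norm_eq_abs, Nat.abs_cast]
    exact mul_le_mul_of_nonneg_right (by exact_mod_cast Parry.le he _) (by positivity)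

namespace IsUnitPair

variable {β μ : ℝ} {r σ : ℤ} (H : IsUnitPair β μ r σ)

include H

/-- The set is the sum of a compact set, the continuous image of the Parry sequences, and the closed
lattice. -/
theorem isClosed_isRepresented :
    IsClosed {p : ℝ × ℝ | IsRepresented β μ (qgDigits r σ) p.1 p.2} := by
  have hK : IsCompact ((fun e : ℤ → ℕ => (future β e 0, past μ e 0)) ''
      {e | Parry (qgDigits r σ) e}) :=
    (isCompact_parry _).image_of_continuousOn
      ((continuousOn_future H.one_lt _ 0).prodMk (continuousOn_past H.abs_lt_one _ 0))
  convert! H.isClosed_conjLattice.add_left_of_isCompact hK using 1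
  ext ⟨u, v⟩
  rw [Set.mem_add]
  constructor
  · rintro ⟨e, he, h⟩
    exact ⟨_, ⟨e, he, rfl⟩, _, h, by simp⟩
  · rintro ⟨_, ⟨e, he, rfl⟩, w, hw, h⟩
    refine ⟨e, he, ?_⟩
    rw [← h]
    simpa using hw

theorem isRepresented_unit {x : ℝ} (h0 : 0 ≤ x) (h1 : x < 1) :
    IsRepresented β μ (qgDigits r σ) x 0 := by
  have Q := H.quasiGreedy
  have hβ := H.one_lt
  obtain ⟨a, ha, ha1, hax⟩ := exists_greedy hβ h0 h1
  have hlex : ∀ k : ℕ, ¬ LexLT (qgDigits r σ) (fun i => a (k + i)) := fun k hk =>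
    LexLT.irrefl _ ((Q.lexLT_of_val_lt_one (fun i => ha _) (ha1 k)).trans hk)
  have hq := Q.one_le_zero
  let e : ℤ → ℕ := fun n => if n ≤ 0 then 0 else a (n - 1).toNat
  refine ⟨e, ?_, ?_⟩
  · intro k
    by_cases hk : k ≤ 0
    · have hlt : LexLT (fun i : ℕ => e (k + i)) (qgDigits r σ) :=
        ⟨0, by simp, by simp only [e, Nat.cast_zero, add_zero, if_pos hk]; omega⟩
      exact fun hk' => LexLT.irrefl _ (hlt.trans hk')
    · have e1 : (fun i : ℕ => e (k + i)) = fun i : ℕ => a ((k - 1).toNat + i) := by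
        funext i
        simp only [e]
        rw [if_neg (by omega)]
        congr 1
        omega
      rw [e1]
      exact hlex _
  · have e1 : future β e 0 = x := by
      rw [← hax, future]
      congr 1
      funext i
      simp only [e]
      rw [if_neg (by omega)]
      congr 1
      omega
    have e2 : past μ e 0 = 0 := by
      rw [past, neg_eq_zero]
      convert! tsum_zero with k
      simp [e]
    rw [e1, e2, sub_self, sub_self]
    exact (conjLattice β μ).zero_mem

theorem isRepresented_mul {u v : ℝ} (h : IsRepresented β μ (qgDigits r σ) u v) :
    IsRepresented β μ (qgDigits r σ) (β * u) (μ * v) := by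
  obtain ⟨e, he, hl⟩ := h
  refine ⟨fun n => e (n + 1), he.comp_add 1, ?_⟩
  have h1 := H.future_eq he 1
  have h2 := H.past_eq he 1
  rw [sub_self] at h1 h2
  rw [future_comp_add, past_comp_add, zero_add]
  convert! (conjLattice β μ).add_mem (H.mul_mem hl) (intCast_mem_conjLattice β μ (e 1)) using 1
  ext
  · simp only [Prod.fst_add, Int.cast_natCast]
    linarith
  · simp only [Prod.snd_add, Int.cast_natCast]
    linarith

/-- Scaling by `β⁻ⁿ` brings `x` into `[0, 1)`, where the greedy expansion applies; multiplying back
by shifts leaves the second coordinate zero. -/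
theorem isRepresented_of_nonneg {x : ℝ} (h0 : 0 ≤ x) :
    IsRepresented β μ (qgDigits r σ) x 0 := by
  have hβ := H.one_lt
  obtain ⟨n, hn⟩ := pow_unbounded_of_one_lt x hβ
  have hpos : 0 < β ^ n := by positivity
  have key : ∀ m : ℕ, IsRepresented β μ (qgDigits r σ) (β ^ m * (x / β ^ n)) 0 := by
    intro m
    induction m with
    | zero =>
      rw [pow_zero, one_mul]
      exact H.isRepresented_unit (by positivity) ((div_lt_one hpos).2 hn)
    | succ m ih =>
      have := H.isRepresented_mul ih
      rwa [mul_zero, ← mul_assoc, ← pow_succ'] at this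
  have := key n
  rwa [mul_div_cancel₀ _ hpos.ne'] at this

/-- Every point of the plane is represented by an admissible sequence. -/
theorem isRepresented (u v : ℝ) : IsRepresented β μ (qgDigits r σ) u v := by
  have hβ := H.one_lt
  have hμ := abs_lt.1 H.abs_lt_one
  refine H.isClosed_isRepresented.closure_subset
    (show (u, v) ∈ closure {p : ℝ × ℝ | IsRepresented β μ (qgDigits r σ) p.1 p.2} from ?_)
  rw [Metric.mem_closure_iff]
  intro δ hδ
  -- The element `β²ⁿ (1 - β)` of `ℤ[β]` is negative while its conjugate is positive and arbitrarily
  -- small. Even exponents secure the signs when `μ < 0`. Lattice translates of the half-line `x ≥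
  -- 0, y = 0` are therefore dense.
  have hlim : Tendsto (fun n : ℕ => (μ ^ 2) ^ n * (1 - μ)) atTop (𝓝 0) := by
    have : μ ^ 2 < 1 := by nlinarith
    simpa using (tendsto_pow_atTop_nhds_zero_of_lt_one (by positivity) this).mul_const (1 - μ)
  obtain ⟨n, hn⟩ := (hlim.eventually (gt_mem_nhds hδ)).exists
  set p' := (μ ^ 2) ^ n * (1 - μ) with hp'
  set p := (β ^ 2) ^ n * (1 - β) with hp
  have hμ0 := H.ne_zero
  have hp'0 : 0 < p' := mul_pos (by positivity) (by linarith)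
  have hp0 : p ≤ 0 := mul_nonpos_of_nonneg_of_nonpos (by positivity) (by linarith)
  have hmem : (p, p') ∈ conjLattice β μ := by
    rw [hp, hp', ← pow_mul, ← pow_mul]
    refine H.pow_mul_mem ⟨1, -1, ?_, ?_⟩ _ <;> push_cast <;> ring
  obtain ⟨m, hm⟩ := exists_nat_ge (max |u| |v|)
  have hu := (abs_le.1 ((le_max_left _ _).trans hm)).1
  have hv := (abs_le.1 ((le_max_right _ _).trans hm)).1
  -- With this `j` the translate by `j (p, p') - m (1, 1)` has second coordinate within `p'` of `v`,
  -- and first coordinate at most `-m ≤ u`.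
  set j := ⌊(v + m) / p'⌋ with hj
  have hj0 : 0 ≤ j := Int.floor_nonneg.2 (div_nonneg (by linarith) hp'0.le)
  have hj1 : (j : ℝ) * p' ≤ v + m := (le_div_iff₀ hp'0).1 (Int.floor_le _)
  have hj2 : v + m < (j + 1) * p' := (div_lt_iff₀ hp'0).1 (Int.lt_floor_add_one _)
  have hjr : (0 : ℝ) ≤ j := by exact_mod_cast hj0
  have hrep := H.isRepresented_of_nonneg (x := u + m - j * p) (by nlinarith)
  have hl : ((j : ℝ) * p - m, (j : ℝ) * p' - m) ∈ conjLattice β μ := by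
    convert! (conjLattice β μ).sub_mem ((conjLattice β μ).zsmul_mem hmem j)
      (intCast_mem_conjLattice β μ m) using 1
    ext <;> simp
  refine ⟨(u, (j : ℝ) * p' - m), ?_, ?_⟩
  · have := hrep.add_mem hl
    simp only [Set.mem_ofPred_eq]
    convert! this using 1 <;> ring
  · rw [Prod.dist_eq, max_lt_iff, Real.dist_eq, Real.dist_eq]
    constructor
    · simpa using hδ
    · rw [abs_lt]
      constructor <;> simp only <;> linarith

end IsUnitPair

/-! ### Topology of the symbolic space and the pair (future, past) -/

namespace SymbolicSpace

variable {β : ℝ}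

theorem ext {ε ε' : SymbolicSpace β} (h : ∀ n, ε.digit n = ε'.digit n) : ε = ε' :=
  Subtype.ext (funext h)

theorem digit_add (ε ε' : SymbolicSpace β) (n : ℤ) :
    (ε + ε').digit n = ε.digit n + ε'.digit n := rfl

theorem digit_zero (n : ℤ) : (0 : SymbolicSpace β).digit n = 0 := rfl

theorem digit_shift (ε : SymbolicSpace β) (n : ℤ) : ε.shift.digit n = ε.digit (n + 1) := rfl

/-- The homomorphism reading off the `n`-th digit. -/
def digitHom (n : ℤ) : SymbolicSpace β →+ ℕ where
  toFun ε := ε.digit n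
  map_zero' := rfl
  map_add' _ _ := rfl

theorem summable_right (ε : SymbolicSpace β) :
    Summable fun k : ℕ => (ε.digit (0 + 1 + k) : ℝ) * (β ^ (k + 1))⁻¹ := by
  have := ε.2.1
  refine this.congr fun k => ?_
  rw [zero_add, add_comm 1 (k : ℤ)]
  rfl

theorem summable_left (ε : SymbolicSpace β) :
    Summable fun k : ℕ => (ε.digit (-((k : ℤ) + 1)) : ℝ) * (β ^ (k + 1))⁻¹ := ε.2.2

theorem rightSum_eq (ε : SymbolicSpace β) : ε.rightSum = future β ε.digit 0 := by
  refine tsum_congr fun k => ?_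
  dsimp only
  rw [zero_add, add_comm 1 (k : ℤ)]

theorem tendsto_nhds_iff {ι : Type*} {l : Filter ι} {f : ι → SymbolicSpace β}
    {ε : SymbolicSpace β} :
    Tendsto f l (𝓝 ε) ↔ (∀ n, ∀ᶠ i in l, (f i).digit n = ε.digit n) ∧
      Tendsto (fun i => (f i).rightSum) l (𝓝 ε.rightSum) ∧
      Tendsto (fun i => (f i).leftSum) l (𝓝 ε.leftSum) := by
  rw [nhds_induced, tendsto_comap_iff, nhds_prod_eq, nhds_prod_eq, tendsto_prod_iff', tendsto_prod_iff',
    tendsto_pi_nhds]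
  simp only [Function.comp_def, nhds_discrete, tendsto_pure]

theorem continuous_data :
    Continuous fun ε : SymbolicSpace β => (ε.digit, ε.rightSum, ε.leftSum) :=
  continuous_induced_dom

theorem continuous_digit (n : ℤ) : Continuous fun ε : SymbolicSpace β => ε.digit n :=
  (continuous_apply n).comp (continuous_fst.comp continuous_data)

theorem continuous_rightSum : Continuous fun ε : SymbolicSpace β => ε.rightSum :=
  (continuous_fst.comp continuous_snd).comp continuous_data

theorem continuous_leftSum : Continuous fun ε : SymbolicSpace β => ε.leftSum :=
  (continuous_snd.comp continuous_snd).comp continuous_data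

/-- Sums over the past with weights dominated by those of `leftSum` are continuous. -/
theorem continuous_tsum_left {c : ℕ → ℝ} (hc : ∀ k, |c k| ≤ (β ^ (k + 1))⁻¹) :
    Continuous fun ε : SymbolicSpace β => ∑' k : ℕ, (ε.digit (-((k : ℤ) + 1)) : ℝ) * c k := by
  let F : SymbolicSpace β → ℝ := fun ε => ∑' k : ℕ, (ε.digit (-((k : ℤ) + 1)) : ℝ) * c k
  let part : (ℕ → ℝ) → ℕ → SymbolicSpace β → ℝ := fun w K ε =>
    ∑ k ∈ Finset.range K, (ε.digit (-((k : ℤ) + 1)) : ℝ) * w k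
  let w : ℕ → ℝ := fun k => (β ^ (k + 1))⁻¹
  have hcont : ∀ w K, Continuous (part w K) := fun w K =>
    continuous_finsetSum _ fun k _ =>
      ((continuous_of_discreteTopology (f := (Nat.cast : ℕ → ℝ))).comp (continuous_digit _)).mul
        continuous_const
  have hterm : ∀ (ε : SymbolicSpace β) (k : ℕ), ‖(ε.digit (-((k : ℤ) + 1)) : ℝ) * c k‖ ≤
      (ε.digit (-((k : ℤ) + 1)) : ℝ) * w k := by
    intro ε k
    rw [norm_mul, Real.norm_eq_abs, Real.norm_eq_abs, Nat.abs_cast]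
    exact mul_le_mul_of_nonneg_left (hc k) (by positivity)
  have hsum : ∀ ε : SymbolicSpace β, Summable fun k : ℕ => (ε.digit (-((k : ℤ) + 1)) : ℝ) * c k :=
    fun ε => Summable.of_norm_bounded ε.summable_left (hterm ε)
  -- The remainder is controlled by that of `leftSum`, which is continuous in `ε`; hence it is
  -- uniformly small near a given sequence.
  have hrem : ∀ K ε, |F ε - part c K ε| ≤ ε.leftSum - part w K ε := by
    intro K ε
    have h1 : F ε - part c K ε = ∑' k : ℕ,
        (ε.digit (-(((k + K : ℕ) : ℤ) + 1)) : ℝ) * c (k + K) := by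
      rw [sub_eq_iff_eq_add, add_comm]
      exact ((hsum ε).sum_add_tsum_nat_add K).symm
    have h2 : ε.leftSum - part w K ε = ∑' k : ℕ,
        (ε.digit (-(((k + K : ℕ) : ℤ) + 1)) : ℝ) * w (k + K) := by
      rw [sub_eq_iff_eq_add, add_comm]
      exact (ε.summable_left.sum_add_tsum_nat_add K).symm
    rw [h1, h2, ← Real.norm_eq_abs]
    exact tsum_of_norm_bounded ((summable_nat_add_iff K).2 ε.summable_left).hasSum
      fun k => hterm ε (k + K)
  refine continuous_iff_continuousAt.2 fun ε => Metric.tendsto_nhds.2 fun δ hδ => ?_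
  have hlim : Tendsto (fun K => ε.leftSum - part w K ε) atTop (𝓝 (ε.leftSum - ε.leftSum)) :=
    ε.summable_left.hasSum.tendsto_sum_nat.const_sub _
  rw [sub_self] at hlim
  obtain ⟨K, hK⟩ := (hlim.eventually (gt_mem_nhds (show (0 : ℝ) < δ / 3 by linarith))).exists
  have h1 : ∀ᶠ ε' in 𝓝 ε, ε'.leftSum - part w K ε' < δ / 3 :=
    ((continuous_leftSum.sub (hcont w K)).tendsto ε).eventually (gt_mem_nhds hK)
  have h2 : ∀ᶠ ε' in 𝓝 ε, dist (part c K ε') (part c K ε) < δ / 3 :=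
    Metric.tendsto_nhds.1 ((hcont c K).tendsto ε) (δ / 3) (by linarith)
  filter_upwards [h1, h2] with ε' h1 h2
  rw [Real.dist_eq] at h2
  have h3 := abs_le.1 (hrem K ε)
  have h4 := abs_le.1 (hrem K ε')
  have h5 := abs_lt.1 h2
  change |F ε' - F ε| < δ
  rw [abs_lt]
  constructor <;> linarith

/-- A sequence with finitely many nonzero digits. -/
def ofFinite (β : ℝ) (e : ℤ → ℕ) (h : {n | e n ≠ 0}.Finite) : SymbolicSpace β :=
  ⟨e, by
    refine ⟨summable_of_hasFiniteSupport ?_, summable_of_hasFiniteSupport ?_⟩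
    · refine (h.preimage (f := fun k : ℕ => (k : ℤ) + 1) ?_).subset fun k hk => ?_
      · intro a _ b _ hab
        simpa using hab
      · simp only [Function.mem_support, ne_eq, mul_eq_zero, not_or, Nat.cast_eq_zero] at hk
        exact hk.1
    · refine (h.preimage (f := fun k : ℕ => -((k : ℤ) + 1)) ?_).subset fun k hk => ?_
      · intro a _ b _ hab
        simpa using hab
      · simp only [Function.mem_support, ne_eq, mul_eq_zero, not_or, Nat.cast_eq_zero] at hk
        exact hk.1⟩

theorem isFinite_ofFinite {e : ℤ → ℕ} (h : {n | e n ≠ 0}.Finite) : (ofFinite β e h).IsFinite := h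

theorem digit_ofFinite {e : ℤ → ℕ} (h : {n | e n ≠ 0}.Finite) (n : ℤ) :
    (ofFinite β e h).digit n = e n := rfl

/-- The sequence with a single nonzero digit, equal to one, at the `n`-th place. -/
def single (β : ℝ) (n : ℤ) : SymbolicSpace β :=
  ofFinite β (Pi.single n 1) ((Set.finite_singleton n).subset fun m hm => by
    by_contra hne
    exact hm (Pi.single_eq_of_ne hne _))

theorem digit_single (n m : ℤ) : (single β n).digit m = if m = n then 1 else 0 := by
  rw [single, digit_ofFinite, Pi.single_apply]

theorem shift_single (n : ℤ) : (single β n).shift = single β (n - 1) := by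
  refine ext fun m => ?_
  rw [digit_shift, digit_single, digit_single]
  simp only [eq_sub_iff_add_eq]

/-- Truncation of a sequence to the places in `[-m, m]`. -/
def trunc (m : ℕ) (ε : SymbolicSpace β) : SymbolicSpace β :=
  ofFinite β (fun n => if |n| ≤ m then ε.digit n else 0)
    ((Set.finite_Icc (-(m : ℤ)) m).subset fun n hn => by
      by_contra hc
      exact hn (if_neg fun h => hc (abs_le.1 h)))

theorem digit_trunc (m : ℕ) (ε : SymbolicSpace β) (n : ℤ) :
    (ε.trunc m).digit n = if |n| ≤ m then ε.digit n else 0 := rfl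

theorem trunc_eq_sum (m : ℕ) (ε : SymbolicSpace β) :
    ε.trunc m = ∑ n ∈ Finset.Icc (-(m : ℤ)) m, ε.digit n • single β n := by
  refine ext fun k => ?_
  have : (∑ n ∈ Finset.Icc (-(m : ℤ)) m, ε.digit n • single β n).digit k =
      ∑ n ∈ Finset.Icc (-(m : ℤ)) m, ε.digit n • (single β n).digit k := by
    change digitHom k _ = _
    rw [map_sum]
    exact Finset.sum_congr rfl fun n _ => map_nsmul _ _ _
  rw [this, digit_trunc]
  simp [digit_single, abs_le]

theorem tendsto_trunc (ε : SymbolicSpace β) :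
    Tendsto (fun m => ε.trunc m) atTop (𝓝 ε) := by
  refine tendsto_nhds_iff.2 ⟨fun n => ?_, ?_, ?_⟩
  · filter_upwards [eventually_ge_atTop n.natAbs] with m hm
    rw [digit_trunc, if_pos (by rw [abs_le]; omega)]
  · have h := (show HasSum (fun n : ℕ => (ε.digit ((n : ℤ) + 1) : ℝ) * (β ^ (n + 1))⁻¹) ε.rightSum
      from Summable.hasSum ε.2.1).tendsto_sum_nat
    refine h.congr fun m => ?_
    symm
    rw [rightSum, tsum_eq_sum (s := Finset.range m)]
    · refine Finset.sum_congr rfl fun k hk => ?_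
      rw [Finset.mem_range] at hk
      rw [digit_trunc, if_pos (by rw [abs_of_nonneg] <;> omega)]
    · intro k hk
      rw [Finset.mem_range] at hk
      rw [digit_trunc, if_neg (by rw [abs_of_nonneg] <;> omega)]
      simp
  · have h := (show HasSum (fun n : ℕ => (ε.digit (-((n : ℤ) + 1)) : ℝ) * (β ^ (n + 1))⁻¹) ε.leftSum
      from Summable.hasSum ε.2.2).tendsto_sum_nat
    refine h.congr fun m => ?_
    symm
    rw [leftSum, tsum_eq_sum (s := Finset.range m)]
    · refine Finset.sum_congr rfl fun k hk => ?_
      rw [Finset.mem_range] at hk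
      rw [digit_trunc, if_pos (by rw [abs_neg, abs_of_nonneg] <;> omega)]
    · intro k hk
      rw [Finset.mem_range] at hk
      rw [digit_trunc, if_neg (by rw [abs_neg, abs_of_nonneg] <;> omega)]
      simp

theorem rightSum_single (n : ℤ) :
    (single β n).rightSum = if 0 < n then (β ^ n.toNat)⁻¹ else 0 := by
  rw [rightSum]
  split_ifs with h
  · rw [tsum_eq_single (n - 1).toNat]
    · rw [digit_single, if_pos (by omega), show (n - 1).toNat + 1 = n.toNat by omega]
      simp
    · intro k hk
      rw [digit_single, if_neg (by omega)]
      simp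
  · convert! tsum_zero with k
    rw [digit_single, if_neg (by omega)]
    simp

theorem leftSum_single (n : ℤ) :
    (single β n).leftSum = if n < 0 then (β ^ (-n).toNat)⁻¹ else 0 := by
  rw [leftSum]
  split_ifs with h
  · rw [tsum_eq_single (-n - 1).toNat]
    · rw [digit_single, if_pos (by omega), show (-n - 1).toNat + 1 = (-n).toNat by omega]
      simp
    · intro k hk
      rw [digit_single, if_neg (by omega)]
      simp
  · convert! tsum_zero with k
    rw [digit_single, if_neg (by omega)]
    simp

/-- Together with `tendsto_single_neg` this makes the images of the single-digit sequences a
homoclinic orbit. -/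
theorem tendsto_single_pos (hβ : 1 < β) :
    Tendsto (fun n : ℕ => single β (n : ℤ)) atTop (𝓝 0) := by
  have hr : (0 : SymbolicSpace β).rightSum = 0 := by simp [rightSum, digit_zero]
  have hl : (0 : SymbolicSpace β).leftSum = 0 := by simp [leftSum, digit_zero]
  refine tendsto_nhds_iff.2 ⟨fun n => ?_, ?_, ?_⟩
  · filter_upwards [eventually_gt_atTop n.natAbs] with m hm
    rw [digit_single, if_neg (by omega), digit_zero]
  · rw [hr]
    have := tendsto_pow_atTop_nhds_zero_of_lt_one (r := β⁻¹) (by positivity)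
      (inv_lt_one_of_one_lt₀ hβ)
    refine this.congr' ?_
    filter_upwards [eventually_gt_atTop 0] with m hm
    rw [rightSum_single, if_pos (by exact_mod_cast hm), inv_pow]
    simp
  · rw [hl]
    refine tendsto_const_nhds.congr fun m => ?_
    rw [leftSum_single, if_neg (by omega)]

theorem tendsto_single_neg (hβ : 1 < β) :
    Tendsto (fun n : ℕ => single β (-(n : ℤ))) atTop (𝓝 0) := by
  have hr : (0 : SymbolicSpace β).rightSum = 0 := by simp [rightSum, digit_zero]
  have hl : (0 : SymbolicSpace β).leftSum = 0 := by simp [leftSum, digit_zero]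
  refine tendsto_nhds_iff.2 ⟨fun n => ?_, ?_, ?_⟩
  · filter_upwards [eventually_gt_atTop n.natAbs] with m hm
    rw [digit_single, if_neg (by omega), digit_zero]
  · rw [hr]
    refine tendsto_const_nhds.congr fun m => ?_
    rw [rightSum_single, if_neg (by omega)]
  · rw [hl]
    have := tendsto_pow_atTop_nhds_zero_of_lt_one (r := β⁻¹) (by positivity)
      (inv_lt_one_of_one_lt₀ hβ)
    refine this.congr' ?_
    filter_upwards [eventually_gt_atTop 0] with m hm
    rw [leftSum_single, if_pos (by omega), inv_pow]
    simp

/-- A sequence with bounded digits. -/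
def ofBounded (hβ : 1 < β) (e : ℤ → ℕ) {R : ℕ} (h : ∀ n, e n ≤ R) : SymbolicSpace β :=
  ⟨e, summable_val hβ (a := fun k : ℕ => e ((k : ℤ) + 1)) fun _ => h _,
    summable_val hβ (a := fun k : ℕ => e (-((k : ℤ) + 1))) fun _ => h _⟩

theorem digit_ofBounded (hβ : 1 < β) {e : ℤ → ℕ} {R : ℕ} (h : ∀ n, e n ≤ R) (n : ℤ) :
    (ofBounded hβ e h).digit n = e n := rfl

/-- Two continuous homomorphisms to a Hausdorff group that agree on the sequences with a single
nonzero digit are equal. -/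
theorem hom_ext {G : Type*} [AddCommMonoid G] [TopologicalSpace G] [T2Space G]
    {φ ψ : SymbolicSpace β →+ G} (hφ : Continuous φ) (hψ : Continuous ψ)
    (h : ∀ n, φ (single β n) = ψ (single β n)) : φ = ψ := by
  ext ε
  have h1 := (hφ.tendsto ε).comp ε.tendsto_trunc
  have h2 := (hψ.tendsto ε).comp ε.tendsto_trunc
  refine tendsto_nhds_unique h1 (h2.congr fun m => ?_)
  simp only [Function.comp_def, trunc_eq_sum, map_sum, map_nsmul, h]

end SymbolicSpace

open SymbolicSpace

namespace IsUnitPair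

variable {β μ : ℝ} {r σ : ℤ} (H : IsUnitPair β μ r σ)

include H

theorem abs_pow_eq (k : ℕ) : |μ ^ k| = (β ^ k)⁻¹ := by
  rw [abs_pow, H.abs_eq, inv_pow]

theorem summable_past (ε : SymbolicSpace β) :
    Summable fun k : ℕ => (ε.digit (0 - k) : ℝ) * μ ^ k := by
  refine (summable_nat_add_iff 1).1 (Summable.of_norm_bounded ε.summable_left fun k => ?_)
  rw [norm_mul, Real.norm_eq_abs, Real.norm_eq_abs, Nat.abs_cast, H.abs_pow_eq, zero_sub]
  push_cast
  rfl

theorem past_eq_sub_tsum (ε : SymbolicSpace β) : past μ ε.digit 0 =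
    -(ε.digit 0 : ℝ) - ∑' k : ℕ, (ε.digit (-((k : ℤ) + 1)) : ℝ) * μ ^ (k + 1) := by
  rw [past, (H.summable_past ε).tsum_eq_zero_add]
  simp
  ring

/-- The homomorphism mapping a sequence to the values of its future and of its past. -/
def codingPair : SymbolicSpace β →+ ℝ × ℝ where
  toFun ε := (future β ε.digit 0, past μ ε.digit 0)
  map_zero' := by
    simp [future, past, val, digit_zero]
  map_add' ε ε' := by
    rw [Prod.mk_add_mk, Prod.mk.injEq]
    constructor
    · rw [future, val, future, val, future, val, ← ε.summable_right.tsum_add ε'.summable_right]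
      refine tsum_congr fun k => ?_
      rw [digit_add]
      push_cast
      ring
    · rw [past, past, past, ← neg_add, ← (H.summable_past ε).tsum_add (H.summable_past ε')]
      congr 1
      refine tsum_congr fun k => ?_
      rw [digit_add]
      push_cast
      ring

theorem codingPair_apply (ε : SymbolicSpace β) :
    H.codingPair ε = (future β ε.digit 0, past μ ε.digit 0) := rfl

/-- The future is `rightSum`. Since `|μ| = β⁻¹`, the past without its zeroth digit has weights
dominated by those of `leftSum`. -/
theorem continuous_codingPair : Continuous H.codingPair := by
  refine Continuous.prodMk ?_ ?_
  · simp only [← rightSum_eq]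
    exact continuous_rightSum
  · simp only [H.past_eq_sub_tsum]
    refine Continuous.sub (Continuous.neg ?_) ?_
    · exact continuous_of_discreteTopology.comp (continuous_digit 0)
    · exact continuous_tsum_left fun k => (H.abs_pow_eq (k + 1)).le

theorem codingPair_shift (ε : SymbolicSpace β) :
    H.codingPair ε.shift = (β * (H.codingPair ε).1 - ε.digit 1, μ * (H.codingPair ε).2 - ε.digit 1) := by
  have h1 := mul_future H.one_lt ε.summable_right
  have h2 := past_add_one (H.summable_past ε)
  have e1 : future β ε.shift.digit 0 = future β ε.digit (0 + 1) := future_comp_add β ε.digit 1 0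
  have e2 : past μ ε.shift.digit 0 = past μ ε.digit (0 + 1) := past_comp_add μ ε.digit 1 0
  rw [zero_add] at h1 h2 e1 e2
  rw [codingPair_apply, codingPair_apply, e1, e2, h2, h1]
  simp

theorem codingPair_single_zero : H.codingPair (single β 0) = (0, -1) := by
  rw [codingPair_apply, ← rightSum_eq, rightSum_single, H.past_eq_sub_tsum]
  have h0 : ∀ k : ℕ, (single β 0).digit (-((k : ℤ) + 1)) = 0 := fun k => by
    rw [digit_single, if_neg (by omega)]
  simp only [h0]
  simp [digit_single]

end IsUnitPair

/-! ### The torus, integer matrices and eigendirections -/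

/-- The projection from the plane to the torus. -/
def torusMk : (Fin 2 → ℝ) →+ Torus where
  toFun p := fun i => (p i : UnitAddCircle)
  map_zero' := rfl
  map_add' _ _ := rfl

theorem torusMk_apply (p : Fin 2 → ℝ) (i : Fin 2) : torusMk p i = (p i : UnitAddCircle) := rfl

theorem continuous_torusMk : Continuous torusMk :=
  continuous_pi fun i => (AddCircle.continuous_mk' 1).comp (continuous_apply i)

/-- Integer points of the plane. -/
def intVec : (Fin 2 → ℤ) →+ (Fin 2 → ℝ) where
  toFun z := fun i => (z i : ℝ)
  map_zero' := by
    funext i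
    simp
  map_add' z w := by
    funext i
    simp

theorem intVec_apply (z : Fin 2 → ℤ) (i : Fin 2) : intVec z i = (z i : ℝ) := rfl

theorem torusMk_eq_zero_iff {p : Fin 2 → ℝ} : torusMk p = 0 ↔ ∃ z, intVec z = p := by
  constructor
  · intro h
    have : ∀ i, ∃ n : ℤ, (n : ℝ) = p i := fun i => by
      obtain ⟨n, hn⟩ := (AddCircle.coe_eq_zero_iff (1 : ℝ)).1 (congrFun h i)
      exact ⟨n, by simpa using hn⟩
    choose z hz using this
    exact ⟨z, funext hz⟩
  · rintro ⟨z, rfl⟩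
    funext i
    exact (AddCircle.coe_eq_zero_iff (1 : ℝ)).2 ⟨z i, by simp [intVec_apply]⟩

theorem torusMk_intVec (z : Fin 2 → ℤ) : torusMk (intVec z) = 0 := torusMk_eq_zero_iff.2 ⟨z, rfl⟩

theorem torusMk_eq_iff {p p' : Fin 2 → ℝ} : torusMk p = torusMk p' ↔ ∃ z, intVec z = p - p' := by
  rw [← sub_eq_zero, ← map_sub, torusMk_eq_zero_iff]

theorem exists_small_lift (x : Torus) :
    ∃ p : Fin 2 → ℝ, torusMk p = x ∧ ∀ i, |p i| = ‖x i‖ := by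
  have : ∀ i, ∃ y : ℝ, (y : UnitAddCircle) = x i ∧ |y| = ‖x i‖ := by
    intro i
    obtain ⟨y, hy⟩ := QuotientAddGroup.mk_surjective (x i)
    refine ⟨y - round y, ?_, ?_⟩
    · rw [← hy]
      have : ((round y : ℝ) : UnitAddCircle) = 0 :=
        (AddCircle.coe_eq_zero_iff (1 : ℝ)).2 ⟨round y, by simp⟩
      change ((y - round y : ℝ) : UnitAddCircle) = (y : UnitAddCircle)
      rw [AddCircle.coe_sub, this, sub_zero]
    · rw [← hy]
      exact (UnitAddCircle.norm_eq (x := y)).symm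
  choose p hp hp' using this
  exact ⟨p, funext hp, hp'⟩

theorem torusMk_surjective : Function.Surjective torusMk := fun x =>
  (exists_small_lift x).imp fun _ h => h.1

/-- The linear map of the plane given by an integer matrix. -/
def realAct (N : Matrix (Fin 2) (Fin 2) ℤ) : (Fin 2 → ℝ) →ₗ[ℝ] (Fin 2 → ℝ) :=
  Matrix.toLin' (N.map (Int.cast : ℤ → ℝ))

theorem realAct_apply (N : Matrix (Fin 2) (Fin 2) ℤ) (p : Fin 2 → ℝ) (i : Fin 2) :
    realAct N p i = N i 0 * p 0 + N i 1 * p 1 := by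
  simp [realAct, Matrix.mulVec, dotProduct, Fin.sum_univ_two]

theorem realAct_intVec (N : Matrix (Fin 2) (Fin 2) ℤ) (z : Fin 2 → ℤ) :
    realAct N (intVec z) = intVec (N.mulVec z) := by
  funext i
  rw [realAct_apply]
  simp only [intVec_apply, Matrix.mulVec, dotProduct, Fin.sum_univ_two]
  push_cast
  rfl

theorem realAct_realAct (N : Matrix (Fin 2) (Fin 2) ℤ) (p : Fin 2 → ℝ) :
    realAct N (realAct N p) = (N.trace : ℝ) • realAct N p - (N.det : ℝ) • p := by
  funext i
  simp only [realAct_apply, Pi.sub_apply, Pi.smul_apply, smul_eq_mul, Matrix.trace_fin_two,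
    Matrix.det_fin_two]
  push_cast
  fin_cases i <;> simp <;> ring

theorem toralMap_torusMk (N : Matrix (Fin 2) (Fin 2) ℤ) (p : Fin 2 → ℝ) :
    toralMap N (torusMk p) = torusMk (realAct N p) := by
  funext i
  change ∑ j, N i j • torusMk p j = _
  rw [Fin.sum_univ_two, torusMk_apply, torusMk_apply, torusMk_apply, realAct_apply,
    AddCircle.coe_add, ← zsmul_eq_mul, ← zsmul_eq_mul, AddCircle.coe_zsmul, AddCircle.coe_zsmul]

theorem toralMap_mul (N N' : Matrix (Fin 2) (Fin 2) ℤ) (x : Torus) :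
    toralMap (N * N') x = toralMap N (toralMap N' x) := by
  obtain ⟨p, rfl⟩ := torusMk_surjective x
  rw [toralMap_torusMk, toralMap_torusMk, toralMap_torusMk]
  congr 1
  funext i
  simp only [realAct_apply, Matrix.mul_apply, Fin.sum_univ_two]
  push_cast
  ring

theorem toralMap_one (x : Torus) : toralMap 1 x = x := by
  obtain ⟨p, rfl⟩ := torusMk_surjective x
  rw [toralMap_torusMk]
  congr 1
  simp [realAct]

theorem continuous_toralMap (N : Matrix (Fin 2) (Fin 2) ℤ) : Continuous (toralMap N) :=
  continuous_pi fun i => continuous_finsetSum Finset.univ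
    (f := fun (j : Fin 2) (x : Torus) => N i j • x j)
    fun j _ => (continuous_zsmul (N i j)).comp (continuous_apply j)

/-- The linear map sending `(u, v)` to the vector whose components in the expanding and in the
contracting direction are `u` and `v` times those of `l`. -/
def planeMap (N : Matrix (Fin 2) (Fin 2) ℤ) (β μ : ℝ) (l : Fin 2 → ℝ) :
    (ℝ × ℝ) →ₗ[ℝ] (Fin 2 → ℝ) :=
  (LinearMap.fst ℝ ℝ ℝ).smulRight ((β - μ)⁻¹ • (realAct N l - μ • l)) +
    (LinearMap.snd ℝ ℝ ℝ).smulRight ((β - μ)⁻¹ • (β • l - realAct N l))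

theorem planeMap_apply (N : Matrix (Fin 2) (Fin 2) ℤ) (β μ : ℝ) (l : Fin 2 → ℝ) (p : ℝ × ℝ) :
    planeMap N β μ l p = p.1 • ((β - μ)⁻¹ • (realAct N l - μ • l)) +
      p.2 • ((β - μ)⁻¹ • (β • l - realAct N l)) := rfl

/-- The vector `l` is the sum of its two eigencomponents, scaled by `β` and `μ` respectively in `N
l`. So `ℤ[β]` goes to the lattice spanned by `l` and `N l`. -/
theorem planeMap_lattice (N : Matrix (Fin 2) (Fin 2) ℤ) {β μ : ℝ} (h : 0 < β - μ) (l : Fin 2 → ℝ)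
    (a b : ℝ) : planeMap N β μ l (a + b * β, a + b * μ) = a • l + b • realAct N l := by
  rw [planeMap_apply]
  funext i
  simp only [Pi.add_apply, Pi.smul_apply, Pi.sub_apply, smul_eq_mul]
  field_simp
  ring

theorem realAct_planeMap (N : Matrix (Fin 2) (Fin 2) ℤ) {β μ : ℝ}
    (H : IsUnitPair β μ N.trace N.det) (l : Fin 2 → ℝ) (p : ℝ × ℝ) :
    realAct N (planeMap N β μ l p) = planeMap N β μ l (β * p.1, μ * p.2) := by
  rw [planeMap_apply, planeMap_apply]
  simp only [map_add, map_smul, map_sub, realAct_realAct]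
  rw [← H.add_eq, ← H.mul_eq]
  module

theorem toralMap_injective {N : Matrix (Fin 2) (Fin 2) ℤ} (h : IsUnit N.det) :
    Function.Injective (toralMap N) := by
  intro x y hxy
  rw [← toralMap_one x, ← toralMap_one y, ← Matrix.nonsing_inv_mul N h, toralMap_mul, toralMap_mul,
    hxy]

theorem IsUnitPair.isUnit_det {N : Matrix (Fin 2) (Fin 2) ℤ} {β μ : ℝ}
    (H : IsUnitPair β μ N.trace N.det) : IsUnit N.det := Int.isUnit_iff.2 H.sign

theorem eq_zero_of_forall_abs_le_pow {a ρ C : ℝ} (h0 : 0 ≤ ρ) (h1 : ρ < 1)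
    (h : ∀ m : ℕ, |a| ≤ ρ ^ m * C) : a = 0 :=
  abs_eq_zero.1 (le_antisymm
    (le_of_forall_le_add_pow (b := 0) h0 h1 fun m => by simpa using h m) (abs_nonneg a))

/-! ### Equivariant homomorphisms and homoclinic points -/

/-- Homoclinic points of a hyperbolic toral automorphism are the projections of the contracting
components of integer vectors. -/
theorem exists_homoclinic {N : Matrix (Fin 2) (Fin 2) ℤ} {β μ : ℝ}
    (H : IsUnitPair β μ N.trace N.det) {t : ℤ → Torus} (ht : ∀ n, toralMap N (t n) = t (n - 1))
    (hpos : Tendsto (fun n : ℕ => t n) atTop (𝓝 0))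
    (hneg : Tendsto (fun n : ℕ => t (-n)) atTop (𝓝 0)) :
    ∃ l : Fin 2 → ℤ, t 0 = torusMk (planeMap N β μ (intVec l) (0, -1)) := by
  have hβ := H.one_lt
  have hs := H.sub_pos
  have hμ0 := H.ne_zero
  have hinj := toralMap_injective H.isUnit_det
  choose a ha ha' using fun n => exists_small_lift (t n)
  set K : ℝ := |(N 0 0 : ℝ)| + |(N 0 1 : ℝ)| + |(N 1 0 : ℝ)| + |(N 1 1 : ℝ)| with hK
  have hK0 : 0 ≤ K := by positivity
  have hact : ∀ (p : Fin 2 → ℝ) (d : ℝ), (∀ i, |p i| ≤ d) → ∀ i, |realAct N p i| ≤ K * d := by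
    intro p d hp i
    have hd : 0 ≤ d := (abs_nonneg _).trans (hp 0)
    have h1 : |realAct N p i| ≤ |(N i 0 : ℝ)| * d + |(N i 1 : ℝ)| * d := by
      rw [realAct_apply]
      refine (abs_add_le _ _).trans ?_
      rw [abs_mul, abs_mul]
      exact add_le_add (mul_le_mul_of_nonneg_left (hp 0) (abs_nonneg _))
        (mul_le_mul_of_nonneg_left (hp 1) (abs_nonneg _))
    refine h1.trans ?_
    rw [← add_mul]
    refine mul_le_mul_of_nonneg_right ?_ hd
    have := abs_nonneg (N 0 0 : ℝ)
    have := abs_nonneg (N 0 1 : ℝ)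
    have := abs_nonneg (N 1 0 : ℝ)
    have := abs_nonneg (N 1 1 : ℝ)
    fin_cases i
    · change |(N 0 0 : ℝ)| + |(N 0 1 : ℝ)| ≤ K
      linarith
    · change |(N 1 0 : ℝ)| + |(N 1 1 : ℝ)| ≤ K
      linarith
  -- Lifts of size at most `δ` make `N a n - a (n - 1)` an integer vector with entries below one,
  -- hence zero. Far out in both directions the lifts follow the linear map exactly.
  set δ : ℝ := (K + 1)⁻¹ / 2 with hδ
  have hδ0 : 0 < δ := by positivity
  have hδ1 : K * δ + δ < 1 := by
    have : K * δ + δ = 1 / 2 := by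
      rw [hδ]
      field_simp
    linarith
  have hsmall : ∀ {f : ℕ → ℤ}, Tendsto (fun n => t (f n)) atTop (𝓝 0) →
      ∀ᶠ n in atTop, ∀ i, |a (f n) i| ≤ δ := by
    intro f hf
    refine eventually_all.2 fun i => ?_
    have h1 : Tendsto (fun n => ‖t (f n) i‖) atTop (𝓝 0) := by
      simpa using (tendsto_pi_nhds.1 hf i).norm
    filter_upwards [h1.eventually (gt_mem_nhds hδ0)] with n hn
    rw [ha']
    exact hn.le
  have hstep : ∀ n, (∀ i, |a n i| ≤ δ) → (∀ i, |a (n - 1) i| ≤ δ) → realAct N (a n) = a (n - 1) := by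
    intro n h1 h2
    have h3 : torusMk (realAct N (a n)) = torusMk (a (n - 1)) := by
      rw [← toralMap_torusMk, ha, ha, ht]
    obtain ⟨z, hz⟩ := torusMk_eq_iff.1 h3
    have hz0 : z = 0 := by
      funext i
      have h4 : |(z i : ℝ)| < 1 := by
        rw [← intVec_apply, hz, Pi.sub_apply]
        refine (abs_sub _ _).trans_lt (lt_of_le_of_lt (add_le_add (hact _ _ h1 i) (h2 i)) hδ1)
      exact Int.abs_lt_one_iff.1 (by exact_mod_cast h4)
    rw [hz0, map_zero] at hz
    exact (sub_eq_zero.1 hz.symm)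
  obtain ⟨n₀, hn₀⟩ := eventually_atTop.1 ((hsmall hpos).and (hsmall hneg))
  have hp1 : ∀ k : ℕ, realAct N (a (n₀ + k + 1)) = a (n₀ + k) := by
    intro k
    have h1 := (hn₀ (n₀ + k + 1) (by omega)).1
    have h2 := (hn₀ (n₀ + k) (by omega)).1
    push_cast at h1 h2
    have := hstep (n₀ + k + 1) h1 (by rwa [add_sub_cancel_right])
    rwa [add_sub_cancel_right] at this
  have hn1 : ∀ k : ℕ, realAct N (a (-(n₀ + k : ℤ))) = a (-(n₀ + k + 1 : ℤ)) := by
    intro k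
    have h1 := (hn₀ (n₀ + k) (by omega)).2
    have h2 := (hn₀ (n₀ + k + 1) (by omega)).2
    push_cast at h1 h2
    have e : (-(n₀ + k + 1 : ℤ)) = -(n₀ + k : ℤ) - 1 := by ring
    rw [e] at h2 ⊢
    exact hstep _ h1 h2
  have hbound : ∀ (ν : ℝ) (p : Fin 2 → ℝ), (∀ i, |p i| ≤ δ) → ∀ i,
      |(realAct N p - ν • p) i| ≤ K * δ + |ν| * δ := by
    intro ν p hp i
    rw [Pi.sub_apply, Pi.smul_apply, smul_eq_mul]
    refine (abs_sub _ _).trans (add_le_add (hact _ _ hp i) ?_)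
    rw [abs_mul]
    exact mul_le_mul_of_nonneg_left (hp i) (abs_nonneg _)
  -- Applying `N - β` removes the expanding component. Boundedness of the lifts as the index grows,
  -- that is under `N⁻¹`, leaves no contracting component.
  have hb : realAct N (a n₀) = β • a n₀ := by
    have key : ∀ k : ℕ, realAct N (a n₀) - β • a n₀ =
        μ ^ k • (realAct N (a (n₀ + k)) - β • a (n₀ + k)) := by
      intro k
      induction k with
      | zero => simp
      | succ k ih =>
        rw [ih]
        push_cast
        rw [← add_assoc, ← hp1 k, realAct_realAct, ← H.add_eq, ← H.mul_eq]
        module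
    rw [← sub_eq_zero]
    funext i
    refine eq_zero_of_forall_abs_le_pow (abs_nonneg μ) H.abs_lt_one (C := K * δ + |β| * δ)
      fun k => ?_
    rw [key k, Pi.smul_apply, smul_eq_mul, abs_mul, abs_pow]
    refine mul_le_mul_of_nonneg_left (hbound β _ ?_ i) (by positivity)
    have := (hn₀ (n₀ + k) (by omega)).1
    push_cast at this
    exact this
  -- Symmetrically, boundedness under forward iteration excludes an expanding component.
  have hc : realAct N (a (-n₀)) = μ • a (-n₀) := by
    have key : ∀ k : ℕ, β ^ k • (realAct N (a (-n₀)) - μ • a (-n₀)) =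
        (realAct N (a (-(n₀ + k : ℤ))) - μ • a (-(n₀ + k : ℤ))) := by
      intro k
      induction k with
      | zero => simp
      | succ k ih =>
        rw [pow_succ', mul_smul, ih]
        push_cast
        rw [← add_assoc, ← hn1 k, realAct_realAct, ← H.add_eq, ← H.mul_eq]
        module
    rw [← sub_eq_zero]
    funext i
    refine eq_zero_of_forall_abs_le_pow (ρ := β⁻¹) (by positivity) (inv_lt_one_of_one_lt₀ hβ)
      (C := K * δ + |μ| * δ) fun k => ?_
    have h1 := congrFun (key k) i
    rw [Pi.smul_apply, smul_eq_mul] at h1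
    have h2 : (realAct N (a (-n₀)) - μ • a (-n₀)) i =
        β⁻¹ ^ k * (realAct N (a (-(n₀ + k : ℤ))) - μ • a (-(n₀ + k : ℤ))) i := by
      rw [← h1, ← mul_assoc, ← mul_pow, inv_mul_cancel₀ (by positivity), one_pow, one_mul]
    rw [h2, abs_mul, abs_of_nonneg (by positivity)]
    refine mul_le_mul_of_nonneg_left (hbound μ _ ?_ i) (by positivity)
    have := (hn₀ (n₀ + k) (by omega)).2
    push_cast at this
    exact this
  have hb' : ∀ j : ℕ, torusMk (β ^ j • a n₀) = t (n₀ - j) := by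
    intro j
    induction j with
    | zero => simp [ha]
    | succ j ih =>
      push_cast
      rw [← sub_sub, ← ht, ← ih, toralMap_torusMk, map_smul (realAct N), hb, smul_smul, pow_succ]
  have hc' : ∀ j : ℕ, torusMk (μ⁻¹ ^ j • a (-n₀)) = t (-n₀ + j) := by
    intro j
    induction j with
    | zero => simp [ha]
    | succ j ih =>
      refine hinj ?_
      push_cast
      rw [ht, ← add_assoc, add_sub_cancel_right, ← ih, toralMap_torusMk, map_smul (realAct N), hc, smul_smul,
        pow_succ, mul_assoc, inv_mul_cancel₀ hμ0, mul_one]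
  have h1 := hb' n₀
  have h2 := hc' n₀
  rw [sub_self] at h1
  rw [neg_add_cancel] at h2
  -- Thus `t 0` has one lift in the expanding and one in the contracting direction. Their difference
  -- is the integer vector `l`, whose contracting component is minus the second lift.
  obtain ⟨l, hl⟩ := torusMk_eq_iff.1 (h1.trans h2.symm)
  refine ⟨l, ?_⟩
  rw [← h2, hl, planeMap_apply]
  congr 1
  rw [map_sub, map_smul, map_smul, hb, hc]
  have hinv : (β - μ)⁻¹ * (β - μ) = 1 := inv_mul_cancel₀ hs.ne'
  funext i
  simp only [Pi.add_apply, Pi.smul_apply, Pi.sub_apply, smul_eq_mul]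
  linear_combination (-(μ⁻¹ ^ n₀ * a (-n₀) i)) * hinv

/-- The homomorphism to the torus attached to an integer vector. -/
def codingHom {N : Matrix (Fin 2) (Fin 2) ℤ} {β μ : ℝ} (H : IsUnitPair β μ N.trace N.det)
    (l : Fin 2 → ℤ) : SymbolicSpace β →+ Torus :=
  torusMk.comp ((planeMap N β μ (intVec l)).toAddMonoidHom.comp H.codingPair)

section codingHom

variable {N : Matrix (Fin 2) (Fin 2) ℤ} {β μ : ℝ} (H : IsUnitPair β μ N.trace N.det)
  (l : Fin 2 → ℤ)

theorem codingHom_apply (ε : SymbolicSpace β) :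
    codingHom H l ε = torusMk (planeMap N β μ (intVec l) (H.codingPair ε)) := rfl

theorem continuous_codingHom : Continuous (codingHom H l) :=
  continuous_torusMk.comp
    ((LinearMap.continuous_of_finiteDimensional (planeMap N β μ (intVec l))).comp
      H.continuous_codingPair)

include H in
theorem torusMk_planeMap_of_mem {p : ℝ × ℝ} (hp : p ∈ conjLattice β μ) :
    torusMk (planeMap N β μ (intVec l) p) = 0 := by
  obtain ⟨a, b, h1, h2⟩ := hp
  have : p = ((a : ℝ) + b * β, (a : ℝ) + b * μ) := Prod.ext h1 h2
  rw [this, planeMap_lattice N H.sub_pos, realAct_intVec]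
  refine torusMk_eq_zero_iff.2 ⟨a • l + b • N.mulVec l, ?_⟩
  rw [map_add, map_zsmul, map_zsmul, Int.cast_smul_eq_zsmul, Int.cast_smul_eq_zsmul]

theorem codingHom_shift (ε : SymbolicSpace β) :
    codingHom H l ε.shift = toralMap N (codingHom H l ε) := by
  rw [codingHom_apply, codingHom_apply, toralMap_torusMk, realAct_planeMap N H,
    H.codingPair_shift, ← sub_eq_zero, ← map_sub, ← map_sub]
  refine torusMk_planeMap_of_mem H l ⟨-(ε.digit 1 : ℤ), 0, ?_, ?_⟩ <;> simp

/-- Every continuous equivariant homomorphism is attached to an integer vector. -/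
theorem exists_eq_codingHom {φ : SymbolicSpace β →+ Torus} (hφ : Continuous φ)
    (hshift : ∀ ε, φ ε.shift = toralMap N (φ ε)) : ∃ l, φ = codingHom H l := by
  have hβ := H.one_lt
  have hinj := toralMap_injective H.isUnit_det
  obtain ⟨l, hl⟩ := exists_homoclinic H (t := fun n => φ (SymbolicSpace.single β n))
    (fun n => by rw [← hshift, SymbolicSpace.shift_single])
    (by simpa [Function.comp_def] using (hφ.tendsto 0).comp (SymbolicSpace.tendsto_single_pos hβ))
    (by simpa [Function.comp_def] using (hφ.tendsto 0).comp (SymbolicSpace.tendsto_single_neg hβ))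
  refine ⟨l, SymbolicSpace.hom_ext hφ (continuous_codingHom H l) fun n => ?_⟩
  -- Equivariance under the shift carries the agreement at `0` to all places; the upward direction
  -- uses injectivity of the toral map.
  induction n using Int.induction_on with
  | zero => rw [hl, codingHom_apply, H.codingPair_single_zero]
  | succ n ih =>
    refine hinj ?_
    rw [← hshift, ← codingHom_shift, SymbolicSpace.shift_single, add_sub_cancel_right, ih]
  | pred n ih =>
    rw [← SymbolicSpace.shift_single, hshift, codingHom_shift, ih]

end codingHom

/-! ### Sequences staying uniformly below the quasi-greedy expansion -/

/-- `a` is lexicographically less than `q`, and this is witnessed by the first `J + 1` terms. -/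
def LexLTWithin (q : ℕ → ℕ) (J : ℕ) (a : ℕ → ℕ) : Prop :=
  ∃ j ≤ J, (∀ i < j, a i = q i) ∧ a j < q j

theorem LexLTWithin.lexLT {q a : ℕ → ℕ} {J : ℕ} (h : LexLTWithin q J a) : LexLT a q := by
  obtain ⟨j, -, h⟩ := h
  exact ⟨j, h⟩

theorem LexLTWithin.not_lexLT {q a : ℕ → ℕ} {J : ℕ} (h : LexLTWithin q J a) : ¬ LexLT q a :=
  fun h' => LexLT.irrefl _ (h.lexLT.trans h')

theorem LexLTWithin.of_lexLT {q a b : ℕ → ℕ} {J : ℕ} (h : LexLTWithin q J b) (hab : LexLT a b) :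
    LexLTWithin q J a := by
  obtain ⟨j, hjJ, hj, hj'⟩ := h
  obtain ⟨k, hk, hk'⟩ := hab
  rcases lt_trichotomy k j with h | rfl | h
  · exact ⟨k, h.le.trans hjJ, fun i hi => (hk i hi).trans (hj i (hi.trans h)), hj k h ▸ hk'⟩
  · exact ⟨k, hjJ, fun i hi => (hk i hi).trans (hj i hi), hk'.trans hj'⟩
  · exact ⟨j, hjJ, fun i hi => (hk i (hi.trans h)).trans (hj i hi), (hk j h).symm ▸ hj'⟩

theorem LexLT.mono_right {q a b : ℕ → ℕ} (h : LexLT q a) (hab : ∀ i, a i ≤ b i) : LexLT q b := by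
  obtain ⟨j, hj, hj'⟩ := h
  by_cases hall : ∀ i < j, q i = b i
  · exact ⟨j, hall, hj'.trans_le (hab j)⟩
  · push Not at hall
    classical
    obtain ⟨h1, h2⟩ := Nat.find_spec hall
    refine ⟨Nat.find hall, fun i hi => ?_, lt_of_le_of_ne ?_ h2⟩
    · by_contra hne
      exact Nat.find_min hall hi ⟨hi.trans h1, hne⟩
    · rw [hj _ h1]
      exact hab _

theorem val_sub_val {β : ℝ} (hβ : 1 < β) {a b : ℕ → ℕ} {R : ℕ} (ha : ∀ k, a k ≤ R)
    (hb : ∀ k, b k ≤ R) (n : ℕ) (h : ∀ i < n, a i = b i) :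
    val β a - val β b =
      β⁻¹ ^ n * (val β (fun i => a (n + i)) - val β (fun i => b (n + i))) := by
  induction n with
  | zero => simp
  | succ n ih =>
    rw [ih fun i hi => h i (by omega)]
    have h1 := mul_val hβ ha n
    have h2 := mul_val hβ hb n
    rw [h n (by omega)] at h1
    have h3 : val β (fun i => a (n + 1 + i)) - val β (fun i => b (n + 1 + i)) =
        β * (val β (fun i => a (n + i)) - val β (fun i => b (n + i))) := by linarith
    rw [h3, pow_succ]
    have : β ≠ 0 := by positivity
    field_simp

/-- The sequences all of whose tails are less than `q` in their first `J + 1` terms. -/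
def withinSet (q : ℕ → ℕ) (J : ℕ) : Set (ℕ → ℕ) :=
  {a | ∀ k, LexLTWithin q J (fun i => a (k + i))}

/-- Bounding the position of the witness by `J` makes each condition depend on finitely many digits,
hence closed; the strict order alone is not a closed condition. -/
theorem isCompact_withinSet (q : ℕ → ℕ) (J : ℕ) : IsCompact (withinSet q J) := by
  refine (isCompact_univ_pi (X := fun _ : ℕ => ℕ) (s := fun _ => Set.Iic (q 0)) fun _ =>
    (Set.finite_Iic _).isCompact).of_isClosed_subset ?_ ?_
  · have h1 : IsClosed {a : ℕ → ℕ | LexLTWithin q J a} := by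
      have : {a : ℕ → ℕ | LexLTWithin q J a} =
          ⋃ j ∈ Finset.range (J + 1), (⋂ i ∈ Finset.range j, (fun a : ℕ → ℕ => a i) ⁻¹' {q i}) ∩
            (fun a : ℕ → ℕ => a j) ⁻¹' Set.Iio (q j) := by
        ext a
        simp only [Set.mem_ofPred_eq, LexLTWithin, Set.mem_iUnion, Set.mem_inter_iff,
          Set.mem_iInter, Finset.mem_range, Set.mem_preimage, Set.mem_singleton_iff, Set.mem_Iio,
          Nat.lt_succ_iff, exists_prop]
      rw [this]
      refine isClosed_biUnion_finset fun j _ => IsClosed.inter (isClosed_biInter fun i _ => ?_) ?_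
      · exact (isClosed_discrete _).preimage (continuous_apply i)
      · exact (isClosed_discrete _).preimage (continuous_apply j)
    have : withinSet q J = ⋂ k : ℕ, (fun (a : ℕ → ℕ) (i : ℕ) => a (k + i)) ⁻¹'
        {a : ℕ → ℕ | LexLTWithin q J a} := by
      ext a
      simp [withinSet]
    rw [this]
    exact isClosed_iInter fun k => h1.preimage (by fun_prop)
  · intro a ha n _
    exact bdd_of_admissible (fun k => (ha k).not_lexLT) n

namespace QuasiGreedy

variable {β : ℝ} {q : ℕ → ℕ} {t : ℕ → ℝ} (Q : QuasiGreedy β q t)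

include Q

theorem isCompact_val_image (J : ℕ) : IsCompact (val β '' withinSet q J) := by
  have hβ := Q.one_lt
  refine (isCompact_withinSet q J).image_of_continuousOn ?_
  refine continuousOn_tsum (u := fun k => (q 0 : ℝ) * (β ^ (k + 1))⁻¹) (fun k => ?_)
    ((hasSum_geometric_inv hβ).summable.mul_left _) ?_
  · have : Continuous fun a : ℕ → ℕ => (a k : ℝ) :=
      continuous_of_discreteTopology.comp (continuous_apply _)
    exact (this.mul continuous_const).continuousOn
  · intro k a ha
    rw [Real.norm_of_nonneg (by positivity)]
    refine mul_le_mul_of_nonneg_right ?_ (by positivity)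
    exact_mod_cast bdd_of_admissible (fun k => (ha k).not_lexLT) k

/-- A finite admissible sequence of small value that contains a given initial segment of `q`. -/
theorem exists_small_block (J M : ℕ) : ∃ v : ℕ → ℕ, (∀ k, v k ≤ ⌈β⌉₊) ∧
    (∀ k, val β (fun i => v (k + i)) < 1) ∧ val β v ≤ β⁻¹ ^ M ∧ ∀ i ≤ J, v (M + i) = q i := by
  have hβ := Q.one_lt
  induction M with
  | zero =>
    -- The block is `q` cut off after `J`; the induction on `M` puts zeros in front of it.
    have hb : ∀ k, (fun i => if i ≤ J then q i else 0) k ≤ ⌈β⌉₊ := by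
      intro k
      dsimp only
      split_ifs
      · exact Q.bdd k
      · exact Nat.zero_le _
    have hlt : ∀ k, val β (fun i => (fun i => if i ≤ J then q i else 0) (k + i)) < 1 := by
      intro k
      by_cases hk : k ≤ J
      · have h1 := Q.val_sub (a := fun i => (fun i => if i ≤ J then q i else 0) (k + i))
          (fun i => hb (k + i)) k (J + 1 - k) (fun i hi => by
            dsimp only
            rw [if_pos (by omega)])
        have e : (fun i => if k + (J + 1 - k + i) ≤ J then q (k + (J + 1 - k + i)) else 0) =
            fun _ => 0 := by
          funext i
          rw [if_neg (by omega)]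
        simp only [e, val_zero] at h1
        have h2 := Q.pos (k + (J + 1 - k))
        have h3 : (β ^ (J + 1 - k))⁻¹ * (0 - t (k + (J + 1 - k))) < 0 :=
          mul_neg_of_pos_of_neg (by positivity) (by linarith)
        have h4 := Q.le_one k
        linarith
      · have e : (fun i => if k + i ≤ J then q (k + i) else 0) = fun _ => 0 := by
          funext i
          rw [if_neg (by omega)]
        simp only [e, val_zero]
        exact one_pos
    refine ⟨fun i => if i ≤ J then q i else 0, hb, hlt, ?_, fun i hi => by
      rw [zero_add]
      exact if_pos hi⟩
    have := hlt 0
    simp only [zero_add] at this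
    simpa using this.le
  | succ M ih =>
    obtain ⟨v, hb, hlt, hv, hw⟩ := ih
    let w : ℕ → ℕ := fun i => if i = 0 then 0 else v (i - 1)
    have hwb : ∀ k, w k ≤ ⌈β⌉₊ := by
      intro k
      dsimp only [w]
      split_ifs
      · exact Nat.zero_le _
      · exact hb _
    have hw0 : β * val β w = val β v := by
      have := mul_val hβ hwb 0
      have e : (fun i => w (0 + 1 + i)) = v := by
        funext i
        dsimp only [w]
        rw [if_neg (by omega)]
        congr 1
        omega
      rw [e] at this
      simpa [w] using this
    have hw1 : val β w = β⁻¹ * val β v := by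
      rw [← hw0, ← mul_assoc, inv_mul_cancel₀ (by positivity), one_mul]
    refine ⟨w, hwb, fun k => ?_, ?_, fun i hi => ?_⟩
    · rcases k with - | k
      · simp only [zero_add]
        rw [hw1]
        have h1 := hlt 0
        simp only [zero_add] at h1
        have h2 := val_nonneg hβ v
        have h3 := inv_lt_one_of_one_lt₀ hβ
        have h4 : 0 < β⁻¹ := by positivity
        change β⁻¹ * val β v < 1
        nlinarith
      · have e : (fun i => w (k + 1 + i)) = fun i => v (k + i) := by
          funext i
          dsimp only [w]
          rw [if_neg (by omega)]
          congr 1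
          omega
        rw [e]
        exact hlt k
    · rw [hw1, pow_succ']
      exact mul_le_mul_of_nonneg_left hv (by positivity)
    · dsimp only [w]
      rw [if_neg (by omega), ← hw i hi]
      congr 1
      omega

/-- Each value is a limit of values outside the set: keep `n` digits of `a`, then insert zeros and
the initial segment of `q` through `J`. Uniqueness of expansions shows that the modified value has
no expansion in the set. -/
theorem interior_val_image (J : ℕ) : interior (val β '' withinSet q J) = ∅ := by
  have hβ := Q.one_lt
  have hlt : ∀ a ∈ withinSet q J, ∀ k, val β (fun i => a (k + i)) < 1 := by
    intro a ha k
    refine Q.val_lt_one (fun n => ?_) (ha k).lexLT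
    simpa [add_assoc] using (ha (k + n)).not_lexLT
  have hbd : ∀ a ∈ withinSet q J, ∀ k, a k ≤ ⌈β⌉₊ := fun a ha k =>
    (bdd_of_admissible (fun k => (ha k).not_lexLT) k).trans (Q.bdd 0)
  by_contra hne
  obtain ⟨x, hx⟩ := Set.nonempty_iff_ne_empty.2 hne
  obtain ⟨a, ha, rfl⟩ := interior_subset hx
  obtain ⟨c, hc0, hc⟩ := Q.exists_pos
  -- Enough zeros to push the value of the block below every tail of `q`, which is what splicing
  -- requires.
  obtain ⟨M, hM⟩ := exists_pow_lt_of_lt_one hc0 (inv_lt_one_of_one_lt₀ hβ)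
  obtain ⟨v, hvb, hv1, hvs, hvq⟩ := Q.exists_small_block J M
  let y : ℕ → ℕ → ℕ := fun n i => if i < n then a i else v (i - n)
  have hyb : ∀ n k, y n k ≤ ⌈β⌉₊ := by
    intro n k
    dsimp only [y]
    split_ifs
    · exact hbd a ha _
    · exact hvb _
  have hy1 : ∀ n k, val β (fun i => y n (k + i)) < 1 := by
    intro n k
    rcases le_total k n with h | h
    · exact Q.val_splice_lt_one hvb (fun k => (ha k).not_lexLT) hc (hvs.trans_lt hM) n k h
    · have e : (fun i => y n (k + i)) = fun i => v (k - n + i) := by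
        funext i
        dsimp only [y]
        rw [if_neg (by omega)]
        congr 1
        omega
      rw [e]
      exact hv1 _
  have hnot : ∀ n, val β (y n) ∉ val β '' withinSet q J := by
    rintro n ⟨b, hb, hbv⟩
    have hby := eq_of_val_eq hβ (hbd b hb) (hyb n) (hlt b hb) (hy1 n) hbv
    obtain ⟨j, hjJ, -, hj⟩ := hb (n + M)
    rw [hby] at hj
    dsimp only [y] at hj
    rw [if_neg (by omega), show n + M + j - n = M + j by omega, hvq j hjJ] at hj
    exact lt_irrefl _ hj
  have hlim : Tendsto (fun n => val β (y n)) atTop (𝓝 (val β a)) := by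
    rw [tendsto_iff_dist_tendsto_zero]
    refine squeeze_zero (fun _ => dist_nonneg) (fun n => ?_)
      (tendsto_pow_atTop_nhds_zero_of_lt_one (r := β⁻¹) (by positivity)
        (inv_lt_one_of_one_lt₀ hβ))
    rw [Real.dist_eq, val_sub_val hβ (hyb n) (hbd a ha) n fun i hi => if_pos hi, abs_mul,
      abs_of_nonneg (by positivity)]
    refine mul_le_of_le_one_right (by positivity) (abs_le.2 ?_)
    have h1 := hy1 n n
    have h2 := hlt a ha n
    have h3 := val_nonneg hβ (fun i => y n (n + i))
    have h4 := val_nonneg hβ (fun i => a (n + i))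
    constructor <;> linarith
  obtain ⟨n, hn⟩ := (hlim.eventually (isOpen_interior.mem_nhds hx)).exists
  exact hnot n (interior_subset hn)

theorem lexLT_of_finite {e : ℤ → ℕ} (h : Parry q e) (hfin : {n | e n ≠ 0}.Finite) (k : ℤ) :
    LexLT (fun i : ℕ => e (k + i)) q := by
  rcases lexLT_trichotomy (fun i : ℕ => e (k + i)) q with h1 | h1 | h1
  · exact h1
  -- A finite sequence cannot have `q` as a tail, since the tails of `q` all have positive value.
  · obtain ⟨m, hm⟩ := hfin.bddAbove
    have h2 := Q.val_tail (m + 1 - k).toNat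
    have e1 : (fun i => q ((m + 1 - k).toNat + i)) = fun _ => 0 := by
      funext i
      rw [← h1]
      by_contra hne
      have := hm hne
      push_cast at this
      omega
    rw [e1, val_zero] at h2
    exact absurd h2 (Q.pos _).ne
  · exact absurd h1 (h k)

theorem exists_lexLTWithin {e : ℤ → ℕ} (h : Parry q e) (hfin : {n | e n ≠ 0}.Finite) :
    ∃ J, ∀ k : ℤ, LexLTWithin q J (fun i : ℕ => e (k + i)) := by
  choose j hj hj' using Q.lexLT_of_finite h hfin
  refine ⟨hfin.toFinset.sup j, fun k => ?_⟩
  -- A tail starting with zero is already below `q` at its first digit, as `q 0 ≥ 1`. Only finitely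
  -- many tails remain.
  by_cases hk : e k = 0
  · exact ⟨0, Nat.zero_le _, by simp, by
      have := Q.one_le_zero
      simp only [Nat.cast_zero, add_zero, hk]
      omega⟩
  · exact ⟨j k, Finset.le_sup (f := j) (hfin.mem_toFinset.2 hk), hj k, hj' k⟩

end QuasiGreedy

/-! ### The lattice spanned by an integer vector and its image -/

/-- The determinant of the matrix with columns `l` and `N l`. -/
def cyclicDet (N : Matrix (Fin 2) (Fin 2) ℤ) (l : Fin 2 → ℤ) : ℤ :=
  l 0 * (N.mulVec l) 1 - l 1 * (N.mulVec l) 0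

theorem associatedForm_eq_neg_cyclicDet (N : Matrix (Fin 2) (Fin 2) ℤ) (l : Fin 2 → ℤ) :
    associatedForm N (l 1) (-l 0) = -cyclicDet N l := by
  simp only [associatedForm, cyclicDet, Matrix.mulVec, dotProduct, Fin.sum_univ_two]
  ring

section cyclicDet

variable {N : Matrix (Fin 2) (Fin 2) ℤ} {β μ : ℝ} (H : IsUnitPair β μ N.trace N.det)
  {l : Fin 2 → ℤ}

include H

theorem cyclicDet_ne_zero (hl : l ≠ 0) : cyclicDet N l ≠ 0 := by
  intro h
  obtain ⟨i, hi⟩ := Function.ne_iff.1 hl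
  set m := N.mulVec l with hm
  have hm' : ∀ j, m j = N j 0 * l 0 + N j 1 * l 1 := fun j => by
    simp only [hm, Matrix.mulVec, dotProduct, Fin.sum_univ_two]
  have hD : l 0 * m 1 = l 1 * m 0 := by
    rw [cyclicDet, sub_eq_zero] at h
    exact h
  -- If `N l` is parallel to `l`, the rational number `m i / l i` is a root of the characteristic
  -- polynomial, contrary to the irrationality of `β` and `μ`.
  have h2 : m i ^ 2 = l i * (N.trace * m i - N.det * l i) := by
    have e1 := hm' 0
    have e2 := hm' 1
    rw [Matrix.trace_fin_two, Matrix.det_fin_two]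
    fin_cases i
    · change m 0 ^ 2 = l 0 * ((N 0 0 + N 1 1) * m 0 - (N 0 0 * N 1 1 - N 0 1 * N 1 0) * l 0)
      rw [e1, e2] at hD
      rw [e1]
      linear_combination (-N 0 1) * hD
    · change m 1 ^ 2 = l 1 * ((N 0 0 + N 1 1) * m 1 - (N 0 0 * N 1 1 - N 0 1 * N 1 0) * l 1)
      rw [e1, e2] at hD
      rw [e2]
      linear_combination (N 1 0) * hD
  have h3 : ((m i : ℝ) - l i * β) * ((m i : ℝ) - l i * μ) = 0 := by
    have h2' : (m i : ℝ) ^ 2 = l i * ((N.trace : ℝ) * m i - (N.det : ℝ) * l i) := by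
      exact_mod_cast h2
    rw [← H.add_eq, ← H.mul_eq] at h2'
    linear_combination h2'
  rcases mul_eq_zero.1 h3 with h4 | h4
  · have := H.eq_zero_of_add_mul_eq_zero (a := m i) (b := -l i) (by push_cast; linarith)
    exact hi (by simpa using this.2)
  · have h5 := H.add_eq
    have := H.eq_zero_of_add_mul_eq_zero (a := m i - l i * N.trace) (b := l i) (by
      push_cast
      rw [← h5]
      linarith)
    exact hi this.2

theorem planeMap_surjective (hl : cyclicDet N l ≠ 0) :
    Function.Surjective (planeMap N β μ (intVec l)) := by
  intro p
  have hD : (cyclicDet N l : ℝ) ≠ 0 := by exact_mod_cast hl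
  set m := N.mulVec l
  have hDe : (cyclicDet N l : ℝ) = l 0 * m 1 - l 1 * m 0 := by
    simp [cyclicDet, m]
  set a := (p 0 * m 1 - p 1 * m 0) / cyclicDet N l with ha
  set b := (l 0 * p 1 - l 1 * p 0) / cyclicDet N l with hb
  refine ⟨(a + b * β, a + b * μ), ?_⟩
  rw [planeMap_lattice N H.sub_pos, realAct_intVec]
  funext i
  simp only [Pi.add_apply, Pi.smul_apply, smul_eq_mul, intVec_apply, ha, hb]
  rw [div_mul_eq_mul_div, div_mul_eq_mul_div, ← add_div, div_eq_iff hD, hDe]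
  fin_cases i <;> simp [m] <;> ring

theorem planeMap_eq_zero (hl : cyclicDet N l ≠ 0) {p : ℝ × ℝ}
    (hp : planeMap N β μ (intVec l) p = 0) : p = 0 := by
  have hD : (cyclicDet N l : ℝ) ≠ 0 := by exact_mod_cast hl
  have hs := H.sub_pos
  set m := N.mulVec l
  have hDe : (cyclicDet N l : ℝ) = l 0 * m 1 - l 1 * m 0 := by
    simp [cyclicDet, m]
  set b := (p.1 - p.2) / (β - μ) with hb
  set a := p.1 - b * β with ha
  have h2 : p.2 = a + b * μ := by
    have : b * (β - μ) = p.1 - p.2 := div_mul_cancel₀ _ hs.ne'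
    rw [ha]
    linarith
  have he : p = (a + b * β, a + b * μ) := Prod.ext (by simp [ha]) h2
  rw [he, planeMap_lattice N hs, realAct_intVec] at hp
  have h0 : a * l 0 + b * m 0 = 0 := congrFun hp 0
  have h1 : a * l 1 + b * m 1 = 0 := congrFun hp 1
  have ha0 : a * cyclicDet N l = 0 := by
    rw [hDe]
    linear_combination m 1 * h0 - m 0 * h1
  have hb0 : b * cyclicDet N l = 0 := by
    rw [hDe]
    linear_combination l 0 * h1 - l 1 * h0
  have ha1 := (mul_eq_zero.1 ha0).resolve_right hD
  have hb1 := (mul_eq_zero.1 hb0).resolve_right hD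
  rw [he, ha1, hb1]
  simp

theorem mem_conjLattice_of_torusMk_eq_zero (hl : IsUnit (cyclicDet N l)) {p : ℝ × ℝ}
    (hp : torusMk (planeMap N β μ (intVec l) p) = 0) : p ∈ conjLattice β μ := by
  obtain ⟨z, hz⟩ := torusMk_eq_zero_iff.1 hp
  set D := cyclicDet N l with hD
  have hDD : D * D = 1 := by
    rcases Int.isUnit_iff.1 hl with h | h <;> rw [h] <;> norm_num
  set m := N.mulVec l with hm
  have hDe : D = l 0 * m 1 - l 1 * m 0 := rfl
  -- Cramer's rule; the determinant `D = ±1` is its own inverse, so the coordinates are integers.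
  set a : ℤ := D * (z 0 * m 1 - z 1 * m 0) with ha
  set b : ℤ := D * (l 0 * z 1 - l 1 * z 0) with hb
  have h1 : planeMap N β μ (intVec l) ((a : ℝ) + b * β, (a : ℝ) + b * μ) = intVec z := by
    rw [planeMap_lattice N H.sub_pos, realAct_intVec, Int.cast_smul_eq_zsmul, Int.cast_smul_eq_zsmul,
      ← map_zsmul, ← map_zsmul, ← map_add]
    congr 1
    funext i
    have : (a • l + b • m) i = D * D * z i := by
      rw [Pi.add_apply, Pi.smul_apply, Pi.smul_apply, smul_eq_mul, smul_eq_mul, ha, hb]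
      conv_rhs => rw [mul_assoc]; enter [2, 1]; rw [hDe]
      fin_cases i
      · change D * (z 0 * m 1 - z 1 * m 0) * l 0 + D * (l 0 * z 1 - l 1 * z 0) * m 0 =
          D * ((l 0 * m 1 - l 1 * m 0) * z 0)
        ring
      · change D * (z 0 * m 1 - z 1 * m 0) * l 1 + D * (l 0 * z 1 - l 1 * z 0) * m 1 =
          D * ((l 0 * m 1 - l 1 * m 0) * z 1)
        ring
    rw [hDD, one_mul] at this
    exact this
  have h2 := planeMap_eq_zero H hl.ne_zero
    (p := p - ((a : ℝ) + b * β, (a : ℝ) + b * μ)) (by rw [map_sub, h1, hz, sub_self])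
  rw [sub_eq_zero] at h2
  exact ⟨a, b, by rw [h2], by rw [h2]⟩

/-- Otherwise `l` and `N l` would generate `ℤ²`, and expressing the standard basis through them
would give an integer inverse of their determinant. -/
theorem exists_not_mem_conjLattice (hl : cyclicDet N l ≠ 0) (hl' : ¬ IsUnit (cyclicDet N l)) :
    ∃ p : ℝ × ℝ, torusMk (planeMap N β μ (intVec l) p) = 0 ∧ p ∉ conjLattice β μ := by
  by_contra hcon
  push Not at hcon
  have key : ∀ z : Fin 2 → ℤ, ∃ a b : ℤ, z = a • l + b • N.mulVec l := by
    intro z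
    obtain ⟨p, hp⟩ := planeMap_surjective H hl (intVec z)
    obtain ⟨a, b, h1, h2⟩ := hcon p (by rw [hp, torusMk_intVec])
    refine ⟨a, b, ?_⟩
    have : p = ((a : ℝ) + b * β, (a : ℝ) + b * μ) := Prod.ext h1 h2
    rw [this, planeMap_lattice N H.sub_pos, realAct_intVec, Int.cast_smul_eq_zsmul,
      Int.cast_smul_eq_zsmul, ← map_zsmul, ← map_zsmul, ← map_add] at hp
    funext i
    have := congrFun hp i
    rw [intVec_apply, intVec_apply] at this
    exact_mod_cast this.symm
  obtain ⟨a, b, h1⟩ := key ![1, 0]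
  obtain ⟨a', b', h2⟩ := key ![0, 1]
  have e1 := congrFun h1 0
  have e2 := congrFun h1 1
  have e3 := congrFun h2 0
  have e4 := congrFun h2 1
  simp only [Matrix.cons_val_zero, Matrix.cons_val_one, Pi.add_apply,
    Pi.smul_apply, smul_eq_mul] at e1 e2 e3 e4
  refine hl' (IsUnit.of_mul_eq_one (a * b' - b * a') ?_)
  rw [cyclicDet]
  set m := N.mulVec l
  calc (l 0 * m 1 - l 1 * m 0) * (a * b' - b * a')
      = (a * l 0 + b * m 0) * (a' * l 1 + b' * m 1) -
        (a * l 1 + b * m 1) * (a' * l 0 + b' * m 0) := by ring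
    _ = 1 := by
      rw [← e1, ← e2, ← e3, ← e4]
      norm_num

end cyclicDet

theorem IsUnitPair.exists_parry {β μ : ℝ} {r σ : ℤ} (H : IsUnitPair β μ r σ) (p : ℝ × ℝ) :
    ∃ ε : SymbolicSpace β, Parry (qgDigits r σ) ε.digit ∧
      p - H.codingPair ε ∈ conjLattice β μ := by
  obtain ⟨e, he, hp⟩ := H.isRepresented p.1 p.2
  exact ⟨SymbolicSpace.ofBounded H.one_lt e he.le, he, hp⟩

theorem exists_ne_zero_torus : ∃ x : Torus, x ≠ 0 := by
  refine ⟨torusMk fun _ => 1 / 2, fun h => ?_⟩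
  obtain ⟨z, hz⟩ := torusMk_eq_zero_iff.1 h
  have h1 : (z 0 : ℝ) = 1 / 2 := congrFun hz 0
  have h2 : (2 * z 0 : ℝ) = 1 := by linarith
  have h3 : 2 * z 0 = 1 := by exact_mod_cast h2
  omega

/-! ### Every coding contains the Parry sequences; necessity of index one -/

section

variable {N : Matrix (Fin 2) (Fin 2) ℤ} {β μ : ℝ} (H : IsUnitPair β μ N.trace N.det)

include H

theorem codingHom_eq_of_sub_mem (l : Fin 2 → ℤ) {ε : SymbolicSpace β} {p : ℝ × ℝ}
    (h : p - H.codingPair ε ∈ conjLattice β μ) :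
    codingHom H l ε = torusMk (planeMap N β μ (intVec l) p) := by
  have := torusMk_planeMap_of_mem H l h
  rw [map_sub, map_sub, sub_eq_zero] at this
  exact this.symm

theorem codingHom_zero : codingHom H 0 = 0 := by
  ext1 ε
  rw [codingHom_apply, planeMap_apply]
  simp

/-- If the tails of all sequences of `X` are bounded away from the quasi-greedy expansion of one,
then `X` cannot be mapped onto the torus. -/
theorem not_surjective_of_lexLTWithin {l : Fin 2 → ℤ} (hl : cyclicDet N l ≠ 0)
    {X : Set (SymbolicSpace β)} {J : ℕ}
    (hX : ∀ ε ∈ X, ∀ n : ℤ,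
      LexLTWithin (qgDigits N.trace N.det) J (fun i : ℕ => ε.digit (n + i))) :
    ¬ ∀ x : Torus, ∃ ε ∈ X, codingHom H l ε = x := by
  intro hsurj
  have Q := H.quasiGreedy
  choose c hc using fun z : Fin 2 → ℤ => planeMap_surjective H hl (intVec z)
  set S := val β '' withinSet (qgDigits N.trace N.det) J with hS
  have hclosed : IsClosed S := (Q.isCompact_val_image J).isClosed
  -- Lifting the torus points that come from `(u, 0)` shows every real `u` to be the future of a
  -- sequence in `X` plus one of countably many constants. By Baire's theorem `S` would then have
  -- interior.
  have hcover : ⋃ z : Fin 2 → ℤ, (Homeomorph.subRight (c z).1) ⁻¹' S = Set.univ := by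
    refine Set.eq_univ_of_forall fun u => ?_
    obtain ⟨ε, hε, h⟩ := hsurj (torusMk (planeMap N β μ (intVec l) (u, 0)))
    rw [codingHom_apply] at h
    obtain ⟨z, hz⟩ := torusMk_eq_iff.1 h.symm
    rw [← map_sub, ← hc z, ← sub_eq_zero, ← map_sub] at hz
    have h1 := congrArg Prod.fst (planeMap_eq_zero H hl hz)
    rw [H.codingPair_apply] at h1
    simp only [Prod.fst_sub, Prod.fst_zero] at h1
    refine Set.mem_iUnion.2 ⟨z, fun i : ℕ => ε.digit (0 + 1 + i), fun k => ?_, ?_⟩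
    · simpa [add_assoc] using hX ε hε (0 + 1 + k)
    · change future β ε.digit 0 = u - (c z).1
      linarith
  obtain ⟨z, hz⟩ := nonempty_interior_of_iUnion_of_closed
    (fun z => hclosed.preimage (Homeomorph.subRight (c z).1).continuous) hcover
  rw [← Homeomorph.preimage_interior, hS, Q.interior_val_image J] at hz
  simp at hz

/-- If a finite Parry sequence `f` is missing from `X`, totality says that every tail of every
member of `X` is at most some tail of `f`. These tails are uniformly below `q`, contradicting
surjectivity. Truncation and closedness give the infinite sequences. -/
theorem parry_subset {l : Fin 2 → ℤ} (hl : cyclicDet N l ≠ 0) {X : Set (SymbolicSpace β)}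
    (hcl : IsClosed X) (htot : SymbolicSpace.IsTotal X)
    (hsurj : ∀ x : Torus, ∃ ε ∈ X, codingHom H l ε = x) {ε : SymbolicSpace β}
    (hε : Parry (qgDigits N.trace N.det) ε.digit) : ε ∈ X := by
  have Q := H.quasiGreedy
  have hfin : ∀ f : SymbolicSpace β, Parry (qgDigits N.trace N.det) f.digit → f.IsFinite →
      f ∈ X := by
    intro f hf hfin
    by_contra hfX
    obtain ⟨J, hJ⟩ := Q.exists_lexLTWithin hf hfin
    refine not_surjective_of_lexLTWithin H hl (J := J) (fun ε hε n => ?_) hsurj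
    have h1 : ∃ k, ¬ SymbolicSpace.TailLexLT f k ε n := by
      by_contra hcon
      push Not at hcon
      exact hfX (htot ε hε f ⟨n, hcon⟩)
    obtain ⟨k, hk⟩ := h1
    rcases lexLT_trichotomy (fun i : ℕ => f.digit (k + i)) (fun i : ℕ => ε.digit (n + i)) with
      h | h | h
    · exact absurd h hk
    · exact h ▸ hJ k
    · exact (hJ k).of_lexLT h
  refine hcl.mem_of_tendsto ε.tendsto_trunc (Eventually.of_forall fun m => ?_)
  refine hfin _ (fun k hk => hε k (hk.mono_right fun i => ?_)) (SymbolicSpace.isFinite_ofFinite _)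
  rw [SymbolicSpace.digit_trunc]
  split_ifs
  · exact le_rfl
  · exact Nat.zero_le _

end

/-- A single point with a unique preimage is enough. For index above one, `p` and `p + w` give the
same torus point but distinct classes modulo `ℤ[β]`, so their Parry representatives in `X` differ.
-/
theorem exists_isUnit_cyclicDet {N : Matrix (Fin 2) (Fin 2) ℤ} {μ : ℝ}
    (H : IsUnitPair (leadingEigenvalue N) μ N.trace N.det)
    {φ : SymbolicSpace (leadingEigenvalue N) →+ Torus}
    {X : Set (SymbolicSpace (leadingEigenvalue N))} (hX : IsArithmeticCoding N φ X)
    (huniq : ∃ x, ∃! ε, ε ∈ X ∧ φ ε = x) : ∃ l, IsUnit (cyclicDet N l) := by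
  obtain ⟨l, rfl⟩ := exists_eq_codingHom H hX.continuous hX.map_shift
  have hl0 : l ≠ 0 := by
    rintro rfl
    obtain ⟨x, hx⟩ := exists_ne_zero_torus
    obtain ⟨ε, -, hε⟩ := hX.surjective x
    rw [codingHom_zero] at hε
    exact hx hε.symm
  have hl := cyclicDet_ne_zero H hl0
  refine ⟨l, ?_⟩
  by_contra hu
  obtain ⟨w, hw, hw'⟩ := exists_not_mem_conjLattice H hl hu
  obtain ⟨x, ε₀, -, hε₀⟩ := huniq
  obtain ⟨y, rfl⟩ := torusMk_surjective x
  obtain ⟨p, rfl⟩ := planeMap_surjective H hl y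
  obtain ⟨ε, hε, hεp⟩ := H.exists_parry p
  obtain ⟨ε', hε', hεp'⟩ := H.exists_parry (p + w)
  have h1 := hε₀ ε ⟨parry_subset H hl hX.isClosed hX.total hX.surjective hε,
    codingHom_eq_of_sub_mem H l hεp⟩
  have h2 := hε₀ ε' ⟨parry_subset H hl hX.isClosed hX.total hX.surjective hε', by
    rw [codingHom_eq_of_sub_mem H l hεp', map_add, map_add, hw, add_zero]⟩
  rw [h1] at hεp
  rw [h2] at hεp'
  refine hw' ?_
  have := (conjLattice _ μ).sub_mem hεp' hεp
  rwa [sub_sub_sub_cancel_right, add_sub_cancel_left] at this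

/-! ### Area and fundamental domains on the torus -/

/-- The half-open unit square. -/
def unitBox : Set (Fin 2 → ℝ) := Set.univ.pi fun _ => Set.Ioc 0 (0 + 1)

theorem measurableSet_unitBox : MeasurableSet unitBox :=
  MeasurableSet.univ_pi fun _ => measurableSet_Ioc

theorem measurePreserving_torusMk :
    MeasurePreserving torusMk (volume.restrict unitBox) volume := by
  have h := measurePreserving_pi (fun _ : Fin 2 => (volume : Measure ℝ).restrict (Set.Ioc 0 (0 + 1)))
    (fun _ : Fin 2 => (volume : Measure UnitAddCircle))
    (fun _ => UnitAddCircle.measurePreserving_mk 0)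
  rw [← Measure.restrict_pi_pi] at h
  exact h

theorem injOn_torusMk_unitBox : Set.InjOn torusMk unitBox := by
  intro p hp p' hp' h
  obtain ⟨z, hz⟩ := torusMk_eq_iff.1 h
  funext i
  have h1 : (z i : ℝ) = p i - p' i := congrFun hz i
  have h2 := hp i trivial
  have h3 := hp' i trivial
  have h4 : |(z i : ℝ)| < 1 := by
    rw [h1, abs_lt]
    constructor <;> linarith [h2.1, h2.2, h3.1, h3.2]
  have h5 : z i = 0 := Int.abs_lt_one_iff.1 (by exact_mod_cast h4)
  rw [h5] at h1
  simp only [Int.cast_zero] at h1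
  linarith

theorem exists_add_intVec_mem_unitBox (p : Fin 2 → ℝ) : ∃ z, p - intVec z ∈ unitBox := by
  refine ⟨fun i => ⌈p i⌉ - 1, fun i _ => ?_⟩
  rw [Pi.sub_apply, intVec_apply]
  have h1 := Int.ceil_lt_add_one (p i)
  have h2 := Int.le_ceil (p i)
  push_cast
  constructor <;> linarith

/-- The set is cut along integer translates of the unit box, on each of which the projection is
injective and preserves area. The pieces moved back to their original places are disjoint parts of
`E`. -/
theorem volume_torusMk_image_le {E : Set (Fin 2 → ℝ)} (hE : MeasurableSet E) :
    volume (torusMk '' E) ≤ volume E := by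
  let F : (Fin 2 → ℤ) → Set (Fin 2 → ℝ) := fun z => (fun p => p + intVec z) ⁻¹' E ∩ unitBox
  have hF : ∀ z, MeasurableSet (F z) := fun z =>
    (hE.preimage (measurable_add_const _)).inter measurableSet_unitBox
  have himg : torusMk '' E ⊆ ⋃ z, torusMk '' F z := by
    rintro _ ⟨p, hp, rfl⟩
    obtain ⟨z, hz⟩ := exists_add_intVec_mem_unitBox p
    refine Set.mem_iUnion.2 ⟨z, p - intVec z, ⟨by simpa using hp, hz⟩, ?_⟩
    rw [map_sub, torusMk_intVec, sub_zero]
  have hvol : ∀ z, volume (torusMk '' F z) = volume (F z) := by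
    intro z
    have hm : MeasurableSet (torusMk '' F z) :=
      (hF z).image_of_continuousOn_injOn continuous_torusMk.continuousOn
        (injOn_torusMk_unitBox.mono Set.inter_subset_right)
    rw [← measurePreserving_torusMk.measure_preimage hm.nullMeasurableSet,
      Measure.restrict_apply (hm.preimage continuous_torusMk.measurable)]
    congr 1
    ext p
    constructor
    · rintro ⟨⟨p', hp', h⟩, hp⟩
      rwa [← injOn_torusMk_unitBox hp'.2 hp h]
    · intro hp
      exact ⟨⟨p, hp, rfl⟩, hp.2⟩
  have htrans : ∀ z, volume (F z) = volume ((fun p => p - intVec z) ⁻¹' F z) := fun z => by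
    simp only [sub_eq_add_neg]
    exact (measure_preimage_add_right volume _ _).symm
  have hdisj : Pairwise (Function.onFun Disjoint fun z => (fun p => p - intVec z) ⁻¹' F z) := by
    intro z z' hne
    refine Set.disjoint_left.2 fun p hp hp' => hne ?_
    have h := injOn_torusMk_unitBox hp.2 hp'.2 (by
      simp only [map_sub, torusMk_intVec])
    funext i
    have h1 : p i - (z i : ℝ) = p i - (z' i : ℝ) := congrFun h i
    have h2 : (z i : ℝ) = z' i := by linarith
    exact_mod_cast h2
  calc volume (torusMk '' E) ≤ volume (⋃ z, torusMk '' F z) := measure_mono himg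
    _ ≤ ∑' z, volume (torusMk '' F z) := measure_iUnion_le _
    _ = ∑' z, volume ((fun p => p - intVec z) ⁻¹' F z) :=
        tsum_congr fun z => (hvol z).trans (htrans z)
    _ = volume (⋃ z, (fun p => p - intVec z) ⁻¹' F z) :=
        (measure_iUnion hdisj fun z => (hF z).preimage (measurable_sub_const _)).symm
    _ ≤ volume E := by
      refine measure_mono (Set.iUnion_subset fun z p hp => ?_)
      have := hp.1
      simpa using this

theorem volume_univ_torus : volume (Set.univ : Set Torus) = 1 := by
  rw [volume_pi, Measure.pi_univ]
  simp

/-- A compact set of area at most one that is mapped onto the torus is a fundamental domain up to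
a null set. -/
theorem ae_unique_lift {A : Set (Fin 2 → ℝ)} (hA : IsCompact A) (hvol : volume A ≤ 1)
    (hsurj : torusMk '' A = Set.univ) :
    ∀ᵐ x : Torus, ∀ a ∈ A, ∀ a' ∈ A, torusMk a = x → torusMk a' = x → a = a' := by
  have hmeas := hA.measurableSet
  have hmeas' : ∀ w, MeasurableSet ((fun p => p - intVec w) ⁻¹' A) := fun w =>
    hmeas.preimage (measurable_sub_const _)
  have hnull : ∀ w : Fin 2 → ℤ, w ≠ 0 → volume (A ∩ (fun p => p - intVec w) ⁻¹' A) = 0 := by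
    intro w hw
    -- The points of `A` whose translate by `-w` stays in `A` can be dropped: following `p - k w`
    -- until it leaves the bounded set `A` ends at a retained point of the same class. The retained
    -- part thus has area at least one, which leaves none for the overlap.
    have hcover : torusMk '' (A \ (fun p => p - intVec w) ⁻¹' A) = Set.univ := by
      refine Set.eq_univ_of_forall fun x => ?_
      obtain ⟨p, hp, rfl⟩ := hsurj.symm ▸ Set.mem_univ x
      have hex : ∃ k : ℕ, p - k • intVec w ∉ A := by
        by_contra hcon
        push Not at hcon
        obtain ⟨i, hi⟩ := Function.ne_iff.1 hw
        obtain ⟨R, hR⟩ := hA.isBounded.exists_norm_le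
        obtain ⟨k, hk⟩ := exists_nat_gt (R + |p i|)
        have h1 := (norm_le_pi_norm _ i).trans (hR _ (hcon k))
        rw [Pi.sub_apply, Pi.smul_apply, intVec_apply, Real.norm_eq_abs, nsmul_eq_mul] at h1
        have h2 : (1 : ℝ) ≤ |(w i : ℝ)| := by exact_mod_cast Int.one_le_abs hi
        have h3 : (k : ℝ) * 1 ≤ |(k : ℝ) * w i| := by
          rw [abs_mul, Nat.abs_cast]
          exact mul_le_mul_of_nonneg_left h2 (by positivity)
        have h4 := abs_sub_abs_le_abs_sub ((k : ℝ) * w i) (p i)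
        rw [abs_sub_comm] at h4
        linarith
      classical
      have hspec := Nat.find_spec hex
      have hmin := fun {m : ℕ} => Nat.find_min hex (m := m)
      rcases hn : Nat.find hex with - | n
      · rw [hn] at hspec
        exact absurd hp (by simpa using hspec)
      · rw [hn] at hspec hmin
        refine ⟨p - n • intVec w, ⟨not_not.1 (hmin (Nat.lt_succ_self n)), fun h => hspec ?_⟩, ?_⟩
        · rw [Set.mem_preimage] at h
          rwa [add_smul, one_smul, ← sub_sub]
        · rw [map_sub, map_nsmul, torusMk_intVec, smul_zero, sub_zero]
    have h1 := volume_torusMk_image_le (hmeas.diff (hmeas' w))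
    rw [hcover, volume_univ_torus] at h1
    have h2 := measure_inter_add_sdiff (μ := volume) A (hmeas' w)
    have h3 : volume (A ∩ (fun p => p - intVec w) ⁻¹' A) + 1 ≤ 0 + 1 := by
      rw [zero_add]
      refine le_trans ?_ hvol
      rw [← h2]
      gcongr
    exact le_antisymm (ENNReal.le_of_add_le_add_right ENNReal.one_ne_top h3) bot_le
  have hbad : volume (⋃ w : {w : Fin 2 → ℤ // w ≠ 0},
      torusMk '' (A ∩ (fun p => p - intVec w.1) ⁻¹' A)) = 0 := by
    refine measure_iUnion_null fun w => le_antisymm ?_ bot_le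
    exact (volume_torusMk_image_le (hmeas.inter (hmeas' _))).trans (hnull w.1 w.2).le
  rw [ae_iff]
  refine measure_mono_null (fun x hx => ?_) hbad
  simp only [Set.mem_ofPred_eq] at hx
  push Not at hx
  obtain ⟨a, ha, a', ha', h, h', hne⟩ := hx
  obtain ⟨w, hw⟩ := torusMk_eq_iff.1 (h.trans h'.symm)
  refine Set.mem_iUnion.2 ⟨⟨w, fun h0 => hne ?_⟩, a, ⟨ha, ?_⟩, h⟩
  · rw [h0, map_zero] at hw
    exact sub_eq_zero.1 hw.symm
  · rw [Set.mem_preimage, hw, sub_sub_cancel]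
    exact ha'

theorem measurePreserving_toralMap {N : Matrix (Fin 2) (Fin 2) ℤ} (h : IsUnit N.det) :
    MeasurePreserving (toralMap N) volume volume := by
  refine AddMonoidHom.measurePreserving (continuous_toralMap N) (fun x => ?_) rfl
  refine ⟨toralMap N⁻¹ x, ?_⟩
  rw [← toralMap_mul, Matrix.mul_nonsing_inv N h, toralMap_one]

/-! ### The Parry coding for a vector of index one -/

section

variable {N : Matrix (Fin 2) (Fin 2) ℤ} {β μ : ℝ} (H : IsUnitPair β μ N.trace N.det)
  {l : Fin 2 → ℤ}

include H

/-- In standard coordinates the determinant is `-det (l, N l) / (β - μ)`. -/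
theorem volume_planeMap_image (hl : IsUnit (cyclicDet N l)) (Ω : Set (ℝ × ℝ))
    (hΩ : MeasurableSet Ω) :
    volume (planeMap N β μ (intVec l) '' Ω) = ENNReal.ofReal (β - μ)⁻¹ * volume Ω := by
  have hs := H.sub_pos
  set m := realAct N (intVec l) with hm
  set L := Matrix.toLin' (Matrix.of ![![(β - μ)⁻¹ * (m 0 - μ * l 0), (β - μ)⁻¹ * (β * l 0 - m 0)],
    ![(β - μ)⁻¹ * (m 1 - μ * l 1), (β - μ)⁻¹ * (β * l 1 - m 1)]]) with hL
  have hLp : ∀ p : Fin 2 → ℝ, L p = planeMap N β μ (intVec l) (p 0, p 1) := by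
    intro p
    rw [planeMap_apply]
    funext i
    fin_cases i <;>
      simp [hL, ← hm, Matrix.vecHead, Matrix.vecTail, intVec_apply] <;> ring
  have himg : planeMap N β μ (intVec l) '' Ω = L '' (MeasurableEquiv.finTwoArrow ⁻¹' Ω) := by
    ext x
    constructor
    · rintro ⟨p, hp, rfl⟩
      exact ⟨![p.1, p.2], hp, by rw [hLp]; rfl⟩
    · rintro ⟨p, hp, rfl⟩
      exact ⟨(p 0, p 1), hp, (hLp p).symm⟩
  have hdet : LinearMap.det L = -(β - μ)⁻¹ * cyclicDet N l := by
    have hD : (cyclicDet N l : ℝ) = l 0 * m 1 - l 1 * m 0 := by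
      rw [hm, realAct_intVec, intVec_apply, intVec_apply, cyclicDet]
      push_cast
      ring
    rw [hL, LinearMap.det_toLin', Matrix.det_fin_two, hD]
    simp only [Matrix.of_apply, Matrix.cons_val_zero, Matrix.cons_val_one, Matrix.cons_val',
      Matrix.cons_val_fin_one]
    field_simp
    ring
  have habs : |LinearMap.det L| = (β - μ)⁻¹ := by
    have h1 : |(cyclicDet N l : ℝ)| = 1 := by
      rcases Int.isUnit_iff.1 hl with h | h <;> rw [h] <;> norm_num
    rw [hdet, abs_mul, abs_neg, h1, mul_one, abs_of_pos (inv_pos.2 hs)]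
  rw [himg, Measure.addHaar_image_linearMap, habs,
    (volume_preserving_finTwoArrow ℝ).measure_preimage hΩ.nullMeasurableSet]

/-- There is a compact set of area at most one in the plane that contains the lifts of the images
of all admissible sequences. -/
theorem exists_compact_lift (hl : IsUnit (cyclicDet N l)) :
    ∃ A : Set (Fin 2 → ℝ), IsCompact A ∧ volume A ≤ 1 ∧ ∀ ε : SymbolicSpace β,
      Parry (qgDigits N.trace N.det) ε.digit →
        planeMap N β μ (intVec l) (H.codingPair ε) ∈ A := by
  obtain ⟨κ, s, hκ, hs, hκs, hΩ⟩ := H.exists_rectangles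
  set Ω : Set (ℝ × ℝ) :=
    Set.Icc (0 : ℝ) 1 ×ˢ Set.Icc (1 - β) s ∪ Set.Icc 0 κ ×ˢ Set.Icc (-β) (1 - β) with hΩdef
  have hc : IsCompact Ω := (isCompact_Icc.prod isCompact_Icc).union (isCompact_Icc.prod isCompact_Icc)
  refine ⟨planeMap N β μ (intVec l) '' Ω,
    hc.image (LinearMap.continuous_of_finiteDimensional _), ?_, fun ε hε => ?_⟩
  · rw [volume_planeMap_image H hl Ω hc.measurableSet]
    have h1 : volume Ω ≤ ENNReal.ofReal (β - μ) := by
      refine (measure_union_le _ _).trans ?_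
      rw [Measure.volume_eq_prod, Measure.prod_prod, Measure.prod_prod, Real.volume_Icc,
        Real.volume_Icc, Real.volume_Icc, Real.volume_Icc, ← ENNReal.ofReal_mul (by norm_num),
        ← ENNReal.ofReal_mul (by linarith), ← ENNReal.ofReal_add (by nlinarith) (by nlinarith)]
      exact ENNReal.ofReal_le_ofReal (by nlinarith)
    have h2 := H.sub_pos
    calc ENNReal.ofReal (β - μ)⁻¹ * volume Ω
        ≤ ENNReal.ofReal (β - μ)⁻¹ * ENNReal.ofReal (β - μ) := by gcongr
      _ = 1 := by
        rw [← ENNReal.ofReal_mul (inv_nonneg.2 h2.le), inv_mul_cancel₀ h2.ne', ENNReal.ofReal_one]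
  · exact ⟨_, hΩ ε.digit hε 0, rfl⟩

theorem codingHom_surjOn (hl : cyclicDet N l ≠ 0) (x : Torus) :
    ∃ ε : SymbolicSpace β, Parry (qgDigits N.trace N.det) ε.digit ∧ codingHom H l ε = x := by
  obtain ⟨y, rfl⟩ := torusMk_surjective x
  obtain ⟨p, rfl⟩ := planeMap_surjective H hl y
  obtain ⟨ε, hε, hp⟩ := H.exists_parry p
  exact ⟨ε, hε, codingHom_eq_of_sub_mem H l hp⟩

/-- Shifting the origin of a bounded sequence by one step corresponds to applying the toral map. -/
theorem codingHom_comp_add {e : ℤ → ℕ} {R : ℕ} (h : ∀ n, e n ≤ R)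
    (n : ℤ) :
    codingHom H l (SymbolicSpace.ofBounded H.one_lt (fun k => e (k + (n + 1))) fun _ => h _) =
      toralMap N
        (codingHom H l (SymbolicSpace.ofBounded H.one_lt (fun k => e (k + n)) fun _ => h _)) := by
  rw [← codingHom_shift]
  congr 1
  refine SymbolicSpace.ext fun k => ?_
  rw [SymbolicSpace.digit_shift, SymbolicSpace.digit_ofBounded, SymbolicSpace.digit_ofBounded]
  congr 1
  ring

/-- A unique lift at one time gives only the pair (future, past) at that time. Since the toral map
preserves measure, almost every `x` has unique lifts along its entire orbit, so the futures at all
times are known. -/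
theorem ae_existsUnique (hl : IsUnit (cyclicDet N l)) :
    ∀ᵐ x : Torus, ∃! ε : SymbolicSpace β,
      Parry (qgDigits N.trace N.det) ε.digit ∧ codingHom H l ε = x := by
  have Q := H.quasiGreedy
  have hβ := H.one_lt
  have hdet := H.isUnit_det
  obtain ⟨A, hA, hvol, hmem⟩ := exists_compact_lift H hl
  have hsurj : torusMk '' A = Set.univ := by
    refine Set.eq_univ_of_forall fun x => ?_
    obtain ⟨ε, hε, hx⟩ := codingHom_surjOn H hl.ne_zero x
    exact ⟨_, hmem ε hε, hx⟩
  have hae := ae_unique_lift hA hvol hsurj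
  have hdetinv : IsUnit (N⁻¹).det := Matrix.isUnit_nonsing_inv_det N hdet
  have hpow : ∀ {K : Matrix (Fin 2) (Fin 2) ℤ}, IsUnit K.det → ∀ n : ℕ, IsUnit (K ^ n).det := by
    intro K hK n
    rw [Matrix.det_pow]
    exact hK.pow n
  have h1 := ae_all_iff.2 fun n : ℕ =>
    (measurePreserving_toralMap (hpow hdet n)).quasiMeasurePreserving.ae hae
  have h2 := ae_all_iff.2 fun n : ℕ =>
    (measurePreserving_toralMap (hpow hdetinv n)).quasiMeasurePreserving.ae hae
  filter_upwards [h1, h2] with x h1 h2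
  refine existsUnique_of_exists_of_unique (codingHom_surjOn H hl.ne_zero x) ?_
  rintro ε ε' ⟨hε, hx⟩ ⟨hε', hx'⟩
  have hiter : ∀ ε : SymbolicSpace β, ∀ hε : Parry (qgDigits N.trace N.det) ε.digit,
      codingHom H l ε = x → ∀ n : ℕ,
      codingHom H l (SymbolicSpace.ofBounded hβ (fun k => ε.digit (k + n)) fun _ => hε.le _) =
        toralMap (N ^ n) x ∧
      codingHom H l (SymbolicSpace.ofBounded hβ (fun k => ε.digit (k + -n)) fun _ => hε.le _) =
        toralMap (N⁻¹ ^ n) x := by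
    intro ε hε hx n
    induction n with
    | zero =>
      have e1 : SymbolicSpace.ofBounded hβ (fun k => ε.digit (k + ((0 : ℕ) : ℤ))) (fun _ => hε.le _)
          = ε := SymbolicSpace.ext fun k => by simp [SymbolicSpace.digit_ofBounded]
      have e2 : SymbolicSpace.ofBounded hβ (fun k => ε.digit (k + -((0 : ℕ) : ℤ))) (fun _ => hε.le _)
          = ε := SymbolicSpace.ext fun k => by simp [SymbolicSpace.digit_ofBounded]
      rw [e1, e2, pow_zero, pow_zero, toralMap_one, hx]
      exact ⟨rfl, rfl⟩
    | succ n ih =>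
      constructor
      · have := codingHom_comp_add (l := l) H hε.le n
        rw [pow_succ', toralMap_mul, ← ih.1, ← this]
        rfl
      · have := codingHom_comp_add (l := l) H hε.le (-((n + 1 : ℕ) : ℤ))
        have e1 : -((n + 1 : ℕ) : ℤ) + 1 = -(n : ℤ) := by
          push_cast
          ring
        simp only [e1] at this
        rw [pow_succ', toralMap_mul, ← ih.2, this, ← toralMap_mul,
          Matrix.nonsing_inv_mul N hdet, toralMap_one]
  have hfut : ∀ n : ℤ, future β ε.digit n = future β ε'.digit n := by
    intro n
    have key : codingHom H l (SymbolicSpace.ofBounded hβ (fun k => ε.digit (k + n)) fun _ => hε.le _)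
        = codingHom H l (SymbolicSpace.ofBounded hβ (fun k => ε'.digit (k + n)) fun _ => hε'.le _) ∧
        ∀ a ∈ A, ∀ a' ∈ A,
          torusMk a = codingHom H l
            (SymbolicSpace.ofBounded hβ (fun k => ε.digit (k + n)) fun _ => hε.le _) →
          torusMk a' = codingHom H l
            (SymbolicSpace.ofBounded hβ (fun k => ε.digit (k + n)) fun _ => hε.le _) → a = a' := by
      obtain ⟨m, rfl | rfl⟩ := n.eq_nat_or_neg
      · rw [(hiter ε hε hx m).1, (hiter ε' hε' hx' m).1]
        exact ⟨rfl, h1 m⟩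
      · rw [(hiter ε hε hx m).2, (hiter ε' hε' hx' m).2]
        exact ⟨rfl, h2 m⟩
    have heq := key.2 _ (hmem _ (hε.comp_add n)) _ (hmem _ (hε'.comp_add n)) rfl key.1.symm
    rw [← sub_eq_zero, ← map_sub] at heq
    have h3 := congrArg Prod.fst (planeMap_eq_zero H hl.ne_zero heq)
    rw [Prod.fst_sub, Prod.fst_zero, sub_eq_zero, H.codingPair_apply, H.codingPair_apply] at h3
    have e1 := future_comp_add β ε.digit n 0
    have e2 := future_comp_add β ε'.digit n 0
    rw [zero_add] at e1 e2
    rw [← e1, ← e2]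
    exact h3
  refine SymbolicSpace.ext fun n => ?_
  -- Each digit is `β` times the previous future minus the current one.
  have h3 := H.future_eq hε n
  have h4 := H.future_eq hε' n
  rw [hfut, hfut] at h3
  have : (ε.digit n : ℝ) = ε'.digit n := by linarith
  exact_mod_cast this

/-- Equal images differ by an element of `ℤ[β]`. Shifting backwards until both pasts vanish makes
its conjugate zero, so the futures there coincide, and expansions with all tails below one are
unique. -/
theorem injOn_finite (hl : IsUnit (cyclicDet N l)) :
    Set.InjOn (codingHom H l)
      {ε : SymbolicSpace β | Parry (qgDigits N.trace N.det) ε.digit ∧ ε.IsFinite} := by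
  rintro ε ⟨hε, hfin⟩ ε' ⟨hε', hfin'⟩ h
  have Q := H.quasiGreedy
  have hβ := H.one_lt
  rw [codingHom_apply, codingHom_apply, ← sub_eq_zero, ← map_sub, ← map_sub] at h
  have h0 := mem_conjLattice_of_torusMk_eq_zero H hl h
  have hback : ∀ n : ℕ, (future β ε.digit (-n) - future β ε'.digit (-n),
      past μ ε.digit (-n) - past μ ε'.digit (-n)) ∈ conjLattice β μ := by
    intro n
    induction n with
    | zero =>
      rw [H.codingPair_apply, H.codingPair_apply] at h0
      simpa using h0
    | succ n ih =>
      have e1 : -((n + 1 : ℕ) : ℤ) = -(n : ℤ) - 1 := by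
        push_cast
        ring
      rw [e1]
      set u := future β ε.digit (-n - 1) - future β ε'.digit (-n - 1) with hu
      set v := past μ ε.digit (-n - 1) - past μ ε'.digit (-n - 1) with hv
      have hU : (β * u, μ * v) ∈ conjLattice β μ := by
        convert! (conjLattice β μ).add_mem ih
          (intCast_mem_conjLattice β μ ((ε.digit (-n) : ℤ) - ε'.digit (-n))) using 1
        have f1 := H.future_eq hε (-n)
        have f2 := H.future_eq hε' (-n)
        have g1 := H.past_eq hε (-n)
        have g2 := H.past_eq hε' (-n)
        ext
        · simp only [Prod.fst_add, hu]
          push_cast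
          linarith
        · simp only [Prod.snd_add, hv]
          push_cast
          linarith
      have hσ : (N.det : ℝ) * N.det = 1 := by
        rcases H.sign with h | h <;> rw [h] <;> norm_num
      -- Division by the unit stays in the lattice: `β⁻¹ = σ (r - β)`, and likewise for `μ`.
      convert! (conjLattice β μ).zsmul_mem ((conjLattice β μ).sub_mem
        ((conjLattice β μ).zsmul_mem hU N.trace) (H.mul_mem hU)) N.det using 1
      rw [← H.mul_eq] at hσ
      ext
      · simp only [Prod.smul_fst, Prod.fst_sub]
        rw [zsmul_eq_mul, zsmul_eq_mul]
        rw [← H.add_eq, ← H.mul_eq]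
        linear_combination (-u) * hσ
      · simp only [Prod.smul_snd, Prod.snd_sub]
        rw [zsmul_eq_mul, zsmul_eq_mul]
        rw [← H.add_eq, ← H.mul_eq]
        linear_combination (-v) * hσ
  obtain ⟨b, hb⟩ := hfin.bddBelow
  obtain ⟨b', hb'⟩ := hfin'.bddBelow
  set m : ℕ := b.natAbs + b'.natAbs + 1 with hm
  have hz : ∀ k : ℤ, k ≤ -m → ε.digit k = 0 := by
    intro k hk
    by_contra hne
    have := hb (show k ∈ {n | ε.digit n ≠ 0} from hne)
    omega
  have hz' : ∀ k : ℤ, k ≤ -m → ε'.digit k = 0 := by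
    intro k hk
    by_contra hne
    have := hb' (show k ∈ {n | ε'.digit n ≠ 0} from hne)
    omega
  have hp : past μ ε.digit (-m) = 0 := by
    rw [past, neg_eq_zero]
    convert! tsum_zero with k
    rw [hz _ (by omega)]
    simp
  have hp' : past μ ε'.digit (-m) = 0 := by
    rw [past, neg_eq_zero]
    convert! tsum_zero with k
    rw [hz' _ (by omega)]
    simp
  have h1 := hback m
  rw [hp, hp', sub_zero] at h1
  have h2 := sub_eq_zero.1 (H.eq_zero_of_snd h1)
  have hlt : ∀ {ε : SymbolicSpace β}, Parry (qgDigits N.trace N.det) ε.digit → ε.IsFinite →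
      ∀ (n : ℤ) (k : ℕ), val β (fun i : ℕ => (fun j : ℕ => ε.digit (n + j)) (k + i)) < 1 := by
    intro ε hε hfin n k
    have e1 : (fun i : ℕ => (fun j : ℕ => ε.digit (n + j)) (k + i)) =
        fun i : ℕ => ε.digit (n + k + i) := by
      funext i
      dsimp only
      congr 1
      push_cast
      ring
    rw [e1]
    exact Q.val_lt_one (hε.tail _) (Q.lexLT_of_finite hε hfin _)
  have h3 := eq_of_val_eq hβ (a := fun i : ℕ => ε.digit (-m + 1 + i))
    (b := fun i : ℕ => ε'.digit (-m + 1 + i)) (fun k => hε.le _) (fun k => hε'.le _)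
    (hlt hε hfin _) (hlt hε' hfin' _) h2
  refine SymbolicSpace.ext fun n => ?_
  rcases le_or_gt n (-m) with hn | hn
  · rw [hz n hn, hz' n hn]
  · have := congrFun h3 (n - (-m + 1)).toNat
    have e1 : (-m : ℤ) + 1 + ((n - (-m + 1)).toNat : ℤ) = n := by omega
    rwa [e1] at this

end

theorem admitsBijectiveArithmeticCoding_of_isUnit {N : Matrix (Fin 2) (Fin 2) ℤ} {μ : ℝ}
    (H : IsUnitPair (leadingEigenvalue N) μ N.trace N.det) {l : Fin 2 → ℤ}
    (hl : IsUnit (cyclicDet N l)) : AdmitsBijectiveArithmeticCoding N := by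
  refine ⟨codingHom H l, {ε | Parry (qgDigits N.trace N.det) ε.digit},
    ⟨continuous_codingHom H l, codingHom_shift H l, ?_, fun ε => ?_, ?_, ?_, ?_⟩, ?_⟩
  · exact (isClosed_parry _).preimage (continuous_pi SymbolicSpace.continuous_digit)
  · refine ⟨fun h => ?_, fun h => Parry.comp_add h 1⟩
    have := Parry.comp_add h (-1)
    simpa [SymbolicSpace.digit_shift] using this
  -- If a tail of `ε'` exceeded `q`, the larger tail of `ε` would too.
  · rintro ε hε ε' ⟨n, hn⟩ k hk
    exact hε n (hk.trans (hn k))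
  · exact codingHom_surjOn H hl.ne_zero
  · exact injOn_finite H hl
  · exact ae_existsUnique H hl

/-! ### Hyperbolicity and the final equivalence -/

/-- The eigenvalues of a hyperbolic matrix of positive trace. -/
theorem exists_isUnitPair {N : Matrix (Fin 2) (Fin 2) ℤ} (hdet : N.det = 1 ∨ N.det = -1)
    (htr : 0 < N.trace)
    (hroot : ∀ z : ℂ, z ^ 2 - (N.trace : ℂ) * z + (N.det : ℂ) = 0 → ‖z‖ ≠ 1) :
    ∃ μ, IsUnitPair (leadingEigenvalue N) μ N.trace N.det := by
  have htr' : (1 : ℝ) ≤ N.trace := by exact_mod_cast htr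
  have h3 : N.det = 1 → 3 ≤ N.trace := by
    intro h1
    by_contra hlt
    have h12 : N.trace = 1 ∨ N.trace = 2 := by omega
    rcases h12 with h | h
    -- With determinant one, trace `1` has a primitive sixth root of unity as eigenvalue; trace `2`
    -- has the eigenvalue `1`.
    · refine hroot ((1 / 2 : ℝ) + (Real.sqrt 3 / 2 : ℝ) * Complex.I) ?_ ?_
      · have h4 : ((Real.sqrt 3 : ℝ) : ℂ) ^ 2 = 3 := by
          rw [← Complex.ofReal_pow, Real.sq_sqrt (by norm_num)]
          norm_num
        rw [h, h1]
        push_cast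
        linear_combination (1 / 4 : ℂ) * Complex.I ^ 2 * h4 + (3 / 4 : ℂ) * Complex.I_sq
      · rw [Complex.norm_add_mul_I, Real.sqrt_eq_one, div_pow, div_pow, Real.sq_sqrt (by norm_num)]
        norm_num
    · exact hroot 1 (by rw [h, h1]; norm_num) (by simp)
  have hdisc : (0 : ℝ) ≤ (N.trace : ℝ) ^ 2 - 4 * N.det := by
    rcases hdet with h | h
    · have : (3 : ℝ) ≤ N.trace := by exact_mod_cast h3 h
      rw [h]
      push_cast
      nlinarith
    · rw [h]
      push_cast
      nlinarith
  have hsq := Real.sq_sqrt hdisc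
  have hs0 := Real.sqrt_nonneg ((N.trace : ℝ) ^ 2 - 4 * N.det)
  refine ⟨((N.trace : ℝ) - Real.sqrt ((N.trace : ℝ) ^ 2 - 4 * N.det)) / 2, ?_, ?_, ?_, hdet⟩
  · rw [leadingEigenvalue]
    rcases hdet with h | h
    · have : (3 : ℝ) ≤ N.trace := by exact_mod_cast h3 h
      linarith
    · have : 1 < Real.sqrt ((N.trace : ℝ) ^ 2 - 4 * N.det) := by
        rw [Real.lt_sqrt (by norm_num), h]
        push_cast
        nlinarith
      linarith
  · rw [leadingEigenvalue]
    ring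
  · rw [leadingEigenvalue]
    linear_combination (-1 / 4 : ℝ) * hsq

theorem IsHyperbolic.norm_ne_one {M : Matrix (Fin 2) (Fin 2) ℤ} (hM : IsHyperbolic M) {z : ℂ}
    (hz : z ^ 2 - (M.trace : ℂ) * z + (M.det : ℂ) = 0) : ‖z‖ ≠ 1 := by
  refine hM z ?_
  rw [spectrum.mem_iff, Matrix.isUnit_iff_isUnit_det, isUnit_iff_ne_zero, not_not,
    Matrix.det_fin_two, ← hz, Matrix.trace_fin_two, Matrix.det_fin_two]
  simp [Matrix.algebraMap_matrix_apply]
  ring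

theorem exists_isUnit_cyclicDet_iff (N : Matrix (Fin 2) (Fin 2) ℤ) :
    (∃ l, IsUnit (cyclicDet N l)) ↔
      ∃ x y : ℤ, associatedForm N x y = 1 ∨ associatedForm N x y = -1 := by
  constructor
  · rintro ⟨l, hl⟩
    refine ⟨l 1, -l 0, ?_⟩
    rw [associatedForm_eq_neg_cyclicDet]
    rcases Int.isUnit_iff.1 hl with h | h <;> simp [h]
  · rintro ⟨x, y, h⟩
    refine ⟨![-y, x], ?_⟩
    have := associatedForm_eq_neg_cyclicDet N ![-y, x]
    simp only [Matrix.cons_val_one, Matrix.cons_val_zero, neg_neg] at this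
    rw [this] at h
    rw [Int.isUnit_iff]
    omega

theorem admitsBijectiveArithmeticCoding_iff {N : Matrix (Fin 2) (Fin 2) ℤ}
    (hdet : N.det = 1 ∨ N.det = -1) (htr : 0 < N.trace)
    (hroot : ∀ z : ℂ, z ^ 2 - (N.trace : ℂ) * z + (N.det : ℂ) = 0 → ‖z‖ ≠ 1) :
    AdmitsBijectiveArithmeticCoding N ↔
      ∃ x y : ℤ, associatedForm N x y = 1 ∨ associatedForm N x y = -1 := by
  obtain ⟨μ, H⟩ := exists_isUnitPair hdet htr hroot
  rw [← exists_isUnit_cyclicDet_iff]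
  constructor
  · rintro ⟨φ, X, hX, hae⟩
    have : NeZero (volume : Measure Torus) := ⟨fun h => by
      have h1 := volume_univ_torus
      rw [h] at h1
      simp at h1⟩
    exact exists_isUnit_cyclicDet H hX hae.exists
  · rintro ⟨l, hl⟩
    exact admitsBijectiveArithmeticCoding_of_isUnit H hl

/-- Solvability of `f = ±1` is therefore the same for `M` and `-M`, which settles negative trace. -/
theorem associatedForm_neg (M : Matrix (Fin 2) (Fin 2) ℤ) (x y : ℤ) :
    associatedForm (-M) x y = -associatedForm M x y := by
  simp only [associatedForm, Matrix.neg_apply]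
  ring

end ToralCoding

end

theorem theorem2p5 (M : GL (Fin 2) ℤ)
    (hM : IsHyperbolic (M : Matrix (Fin 2) (Fin 2) ℤ))
    (r σ : ℤ) (hr : r = (M : Matrix (Fin 2) (Fin 2) ℤ).trace)
    (hσ : σ = (M : Matrix (Fin 2) (Fin 2) ℤ).det) :
    -- bijective arithmetic codings exist iff `M` is conjugate to its companion matrix
    (0 < r →
      (AdmitsBijectiveArithmeticCoding (M : Matrix (Fin 2) (Fin 2) ℤ) ↔
        AlgebraicallyConjugate (M : Matrix (Fin 2) (Fin 2) ℤ) (companionMatrix r σ))) ∧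
    -- for negative trace the coding is that of the automorphism with matrix `-M`
    (r < 0 →
      (AdmitsBijectiveArithmeticCoding (-(M : Matrix (Fin 2) (Fin 2) ℤ)) ↔
        AlgebraicallyConjugate (M : Matrix (Fin 2) (Fin 2) ℤ) (companionMatrix r σ))) ∧
    -- the conjugacy holds iff `f(x, y) = ±1` is solvable
    (AlgebraicallyConjugate (M : Matrix (Fin 2) (Fin 2) ℤ) (companionMatrix r σ) ↔
      ∃ x y : ℤ, associatedForm (M : Matrix (Fin 2) (Fin 2) ℤ) x y = 1 ∨
        associatedForm (M : Matrix (Fin 2) (Fin 2) ℤ) x y = -1) ∧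
    -- taking the first row is a bijection from the conjugating matrices onto the solutions
    Set.BijOn
      (fun B : GL (Fin 2) ℤ =>
        ((B : Matrix (Fin 2) (Fin 2) ℤ) 0 0, (B : Matrix (Fin 2) (Fin 2) ℤ) 0 1))
      {B | Conjugates B (M : Matrix (Fin 2) (Fin 2) ℤ) (companionMatrix r σ)}
      {p | associatedForm (M : Matrix (Fin 2) (Fin 2) ℤ) p.1 p.2 = 1 ∨
        associatedForm (M : Matrix (Fin 2) (Fin 2) ℤ) p.1 p.2 = -1} ∧
    -- and the second row is `(z, t) = -det M · (x, y) M⁻¹`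
    (∀ B : GL (Fin 2) ℤ,
      Conjugates B (M : Matrix (Fin 2) (Fin 2) ℤ) (companionMatrix r σ) →
      (B : Matrix (Fin 2) (Fin 2) ℤ) 1 =
        (-σ) • Matrix.vecMul ((B : Matrix (Fin 2) (Fin 2) ℤ) 0)
          ((M⁻¹ : GL (Fin 2) ℤ) : Matrix (Fin 2) (Fin 2) ℤ)) := by
  subst hr hσ
  have hdet : (M : Matrix (Fin 2) (Fin 2) ℤ).det = 1 ∨ (M : Matrix (Fin 2) (Fin 2) ℤ).det = -1 :=
    Int.isUnit_iff.1 ((Matrix.isUnit_iff_isUnit_det _).1 M.isUnit)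
  refine ⟨fun hr => ?_, fun hr => ?_, algebraicallyConjugate_companionMatrix_iff _,
    bijOn_conjugates _, second_row_of_conjugates M⟩
  · rw [algebraicallyConjugate_companionMatrix_iff]
    exact admitsBijectiveArithmeticCoding_iff hdet hr fun z hz => hM.norm_ne_one hz
  · have hdetneg : (-(M : Matrix (Fin 2) (Fin 2) ℤ)).det = (M : Matrix (Fin 2) (Fin 2) ℤ).det := by
      rw [Matrix.det_neg, Fintype.card_fin]
      ring
    rw [algebraicallyConjugate_companionMatrix_iff, admitsBijectiveArithmeticCoding_iff
      (hdetneg.symm ▸ hdet) (by rw [Matrix.trace_neg]; omega) fun z hz => ?_]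
    · simp only [associatedForm_neg]
      refine exists_congr fun x => exists_congr fun y => ?_
      constructor <;> intro h <;> omega
    -- The eigenvalues of `-M` are the negatives of those of `M`.
    · rw [← norm_neg]
      refine hM.norm_ne_one ?_
      rw [hdetneg, Matrix.trace_neg] at hz
      rw [← hz]
      push_cast
      ring
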